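/- Let $k\ge 1$ and $q=(q_1,\dots,q_k)\in(0,1)^k$. Let $\mathcal W_0^k=\{z\in\mathbb Z^k: 0\le z_1\le z_2\le\dots\le z_k\}$. A symplectic Gelfand–Tsetlin pattern with $2k$ rows is an array $x=(x^1,\dots,x^{2k})$ with $x^{2i-1},x^{2i}\in\mathbb Z_{\ge 0}^i$ for $1\le i\le k$, such that $x^{2i-1}_1\le x^{2i}_1\le x^{2i-1}_2\le x^{2i}_2\le\dots\le x^{2i-1}_i\le x^{2i}_i$ for $1\le i\le k$, and $x^{2i+1}_j\le x^{2i}_j\le x^{2i+1}_{j+1}$ for $1\le j\le i<k$. For $z\in\mathcal W_0^k$ the symplectic Schur function is $$Sp^{2k}_z(q)=\sum_{x:\,x^{2k}=z}\ \prod_{i=1}^k q_i^{\,2|x^{2i-1}|-|x^{2i-2}|-|x^{2i}|},$$ the sum being over all such patterns with bottom row $z$, where $|\cdot|$ is the sum of the entries and $|x^0|=0$. Let $Z$ be the continuous-time random walk on $\mathbb Z^k$ (with càdlàg paths) started at $0$ whose components are independent, the $i$-th one jumping by $+1$ at rate $q_i^{-1}$ and by $-1$ at rate $q_i$, and let $Q$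 be its $Q$-matrix. Let $Z^\dagger$ be the Doob transform of $Z$, killed on leaving $\mathcal W_0^k$, by the function $h(x)=q_1^{x_1}\cdots q_k^{x_k}\,Sp^{2k}_x(q)$, that is, the càdlàg continuous-time Markov chain on $\mathcal W_0^k$ with $Q$-matrix $Q^\dagger(x,y)=h(x)^{-1}Q(x,y)h(y)$, started at $0$. Let $\tilde Z$ be a process with càdlàg paths that is independent of $Z$ and has the same law as $-Z$, and put $$\bar Z=(Z_1,\tilde Z_1,Z_2,\tilde Z_2,\dots,Z_k,\tilde Z_k).$$ Then the suprema below are finite, and the following two processes have the same law: $$\bigl(Z^\dagger_k(t);\,t\ge 0\bigr)\ \overset{\mathrm{dist}}{=}\ \Bigl(\ \sup_{0\le t_1\le\dots\le t_{2k+1}=t}\ \sum_{i=1}^{2k}\bigl(\bar Z_i(t_{i+1})-\bar Z_i(t_i)\bigr);\ t\ge 0\Bigr).$$ -/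

import Mathlib

open MeasureTheory ProbabilityTheory Filter Topology
open scoped NNReal

noncomputable section

/-! ### Continuous-time Markov chains with a given (bounded) Q-matrix -/

/-- Entries of the powers of a matrix indexed by an arbitrary set. In every use below the
rows of `Q` have only finitely many non-zero entries, so the sums are finite. -/
def qPow {E : Type*} (Q : E → E → ℝ) : ℕ → E → E → ℝ
  | 0, x, y => by
      classical
      exact if x = y then 1 else 0
  | n + 1, x, y => ∑' z, Q x z * qPow Q n z y

/-- The entry `(x, y)` of `exp (t Q) = ∑ n, t ^ n / n! • Q ^ n`: the transition probabilities
of the Markov chain whose Q-matrix is `Q`, for `Q` with bounded rates. -/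
def transitionProb {E : Type*} (Q : E → E → ℝ) (t : ℝ) (x y : E) : ℝ :=
  ∑' n : ℕ, t ^ n / (n.factorial : ℝ) * qPow Q n x y

/-- All paths of `X` are right-continuous with left limits, for the discrete topology on the
state space `E`. -/
def IsCadlag {E Ω : Type*} (X : ℝ≥0 → Ω → E) : Prop :=
  ∀ ω t, (∀ᶠ s in 𝓝[>] t, X s ω = X t ω) ∧ ∃ y, ∀ᶠ s in 𝓝[<] t, X s ω = y

/-- `X` is a càdlàg Markov chain in continuous time on the countable discrete set `E` with
(bounded) Q-matrix `Q`, started at `x₀`: its finite-dimensional distributions are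
`P(X_{t₁} = y₁, …, X_{tₙ} = yₙ) = ∏ⱼ p_{tⱼ - tⱼ₋₁}(yⱼ₋₁, yⱼ)`, with `t₀ = 0` and `y₀ = x₀`. -/
structure IsMarkovChain {E Ω : Type*} [MeasurableSpace Ω] (Q : E → E → ℝ) (x₀ : E)
    (P : Measure Ω) (X : ℝ≥0 → Ω → E) : Prop where
  cadlag : IsCadlag X
  measurable : ∀ t y, MeasurableSet {ω | X t ω = y}
  fdd : ∀ (n : ℕ) (t : Fin (n + 1) → ℝ≥0), Monotone t → t 0 = 0 →
    ∀ y : Fin (n + 1) → E, y 0 = x₀ →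
      P.real {ω | ∀ j, X (t j) ω = y j} =
        ∏ j : Fin n, transitionProb Q ((t j.succ : ℝ) - (t j.castSucc : ℝ)) (y j.castSucc) (y j.succ)

/-! ### The random walk, the chamber and symplectic Schur functions -/

/-- The Q-matrix of the random walk on `ℤ ^ k` whose `i`-th component, independently of the
others, jumps to the right at rate `(q i)⁻¹` and to the left at rate `q i`. -/
def walkQ {k : ℕ} (q : Fin k → ℝ) (x y : Fin k → ℤ) : ℝ :=
  (if y = x then -∑ i, (q i + (q i)⁻¹) else 0) +
    ∑ i, ((if y = x + Pi.single i 1 then (q i)⁻¹ else 0) +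
      (if y = x - Pi.single i 1 then q i else 0))

/-- The set `{z ∈ ℤ ^ k : 0 ≤ z₁ ≤ z₂ ≤ ⋯ ≤ z_k}`. -/
def chamber (k : ℕ) : Set (Fin k → ℤ) := {z | Monotone z ∧ ∀ i, 0 ≤ z i}

/-- The origin, as a point of the chamber. -/
def chamberZero (k : ℕ) : chamber k := ⟨0, fun _ _ _ => le_rfl, fun _ => le_rfl⟩

/-- An array with `2k` rows. For `i : Fin k` (counted from zero) `odd i` is row `2 i + 1` and
`even i` is row `2 i + 2`, each with `i + 1` entries. -/
structure SympArray (k : ℕ) where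
  odd : (i : Fin k) → Fin (i + 1) → ℤ
  even : (i : Fin k) → Fin (i + 1) → ℤ

/-- Symplectic Gelfand-Tsetlin patterns with `2k` rows: non-negative integer entries, and
interlacing of consecutive rows. -/
structure SympArray.IsPattern {k : ℕ} (x : SympArray k) : Prop where
  odd_nonneg : ∀ i j, 0 ≤ x.odd i j
  even_nonneg : ∀ i j, 0 ≤ x.even i j
  odd_le_even : ∀ i j, x.odd i j ≤ x.even i j
  even_le_odd_next : ∀ (i : Fin k) (j : Fin i), x.even i j.castSucc ≤ x.odd i j.succ
  odd_le_even_prev : ∀ (i : ℕ) (hi : i + 1 < k) (j : Fin (i + 1)),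
    x.odd ⟨i + 1, hi⟩ j.castSucc ≤ x.even ⟨i, Nat.lt_of_succ_lt hi⟩ j
  even_prev_le_odd : ∀ (i : ℕ) (hi : i + 1 < k) (j : Fin (i + 1)),
    x.even ⟨i, Nat.lt_of_succ_lt hi⟩ j ≤ x.odd ⟨i + 1, hi⟩ j.succ

/-- The bottom row (row `2k`) of the array is `z`. -/
def SympArray.HasBottomRow {k : ℕ} (x : SympArray k) (z : Fin k → ℤ) : Prop :=
  ∀ (i : Fin k), (i : ℕ) + 1 = k → ∀ j : Fin (i + 1), x.even i j = z (Fin.castLE i.isLt j)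

/-- The sum of the entries of the row above `odd i` (row `2 i`), which is `0` for the empty
row `0`. -/
def SympArray.prevSum {k : ℕ} (x : SympArray k) (i : Fin k) : ℤ :=
  if 0 < (i : ℕ) then ∑ j, x.even ⟨i - 1, (Nat.sub_le _ _).trans_lt i.isLt⟩ j else 0

/-- The geometric weight `∏ᵢ qᵢ ^ (|x^{2i-1}| - |x^{2i-2}| + |x^{2i-1}| - |x^{2i}|)`. -/
def SympArray.weight {k : ℕ} (q : Fin k → ℝ) (x : SympArray k) : ℝ :=
  ∏ i, q i ^ ((∑ j, x.odd i j) - x.prevSum i + (∑ j, x.odd i j) - ∑ j, x.even i j)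

/-- The symplectic Schur function `Sp^{2k}_z(q₁, …, q_k)`, the weighted sum over the (finitely
many) symplectic patterns with bottom row `z`. -/
def sympSchur {k : ℕ} (q : Fin k → ℝ) (z : Fin k → ℤ) : ℝ :=
  ∑ᶠ x ∈ {x : SympArray k | x.IsPattern ∧ x.HasBottomRow z}, x.weight q

/-- The harmonic function `h(x) = q₁^{x₁} ⋯ q_k^{x_k} Sp^{2k}_x(q)` for the walk killed on
leaving the chamber. -/
def harmonicH {k : ℕ} (q : Fin k → ℝ) (x : Fin k → ℤ) : ℝ :=
  (∏ i, q i ^ x i) * sympSchur q x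

/-- The Q-matrix of the Doob `h`-transform of the chain with Q-matrix `Q` killed on leaving
the set `W`. -/
def doobQ {E : Type*} (Q : E → E → ℝ) (h : E → ℝ) (W : Set E) (x y : W) : ℝ :=
  (h x)⁻¹ * Q x y * h y

/-! ### The path functional -/

/-- The `2k`-dimensional process `(Z₁, Z'₁, Z₂, Z'₂, …, Z_k, Z'_k)`. -/
def interleave {k : ℕ} {Ω : Type*} (Z Z' : ℝ≥0 → Ω → Fin k → ℤ) (t : ℝ≥0) (ω : Ω)
    (i : Fin (2 * k)) : ℤ :=
  if (i : ℕ) % 2 = 0 then Z t ω ⟨i / 2, Nat.div_lt_of_lt_mul i.isLt⟩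
  else Z' t ω ⟨i / 2, Nat.div_lt_of_lt_mul i.isLt⟩

/-- The set of the sums `∑_{i=1}^m (Y_i(t_{i+1}) - Y_i(t_i))` over all
`0 ≤ t₁ ≤ ⋯ ≤ t_{m+1} = t`. -/
def pathSums {m : ℕ} (Y : ℝ≥0 → Fin m → ℤ) (t : ℝ≥0) : Set ℤ :=
  {s | ∃ τ : Fin (m + 1) → ℝ≥0, Monotone τ ∧ τ (Fin.last m) = t ∧
    s = ∑ i : Fin m, (Y (τ i.succ) i - Y (τ i.castSucc) i)}

end

noncomputable section

/-! ### Exponentials of bounded operators -/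

section Exponential

open NormedSpace

variable {𝔸 : Type*} [NormedRing 𝔸] [NormedAlgebra ℝ 𝔸] [CompleteSpace 𝔸]

/-! The two processes are two projections of one Markovian dynamics on symplectic patterns. Give row
`n + 1` the rates `rowRate q n` to the right and its inverse to the left. A particle that jumps is
blocked by the row above and pushes the rows below; both rules are expressed by `clamp`, which moves
a row to the nearest sequence interlacing with the row above. The generator is `patGen`.

Bottom row. Sum functions of the pattern against the geometric weight with the bottom row held fixed
(`patSum`). By `patSum_patGen` this sum intertwines `patGen` with a walk of unit rates on
partitions, with a constant exit rate after an even number of rows. The proof adds one row at a time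
and reduces to `two_rows_intertwine`, an identity for each fixed pair of adjacent rows. The total
weight is the symplectic Schur function: the weights come out with each `q i` inverted, but
reflecting every odd row between its two neighbours undoes the inversion
(`finsum_stripWeight_mul_stripWeight`, `sympSchur_eq_patSum`). The factor `∏ q i ^ x i` in `h` turns
the rates of the walk into unit rates, so the averaged dynamics of the bottom row is the Doob
transform (`tsum_doobQ_mul_patAvg`).

Right edge. The largest entries of the rows evolve autonomously (`patGen_comp_edge`): each performs
its own walk and is kept above its predecessor, the first one above zero. Unfolding this recursion
for a discrete-time driving path gives the maximum in last-passage form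
(`isGreatest_topVal_edgeChain`). For a càdlàg integer path the value on a fine grid equals the
supremum in continuous time (`IsCadlagPath.eventually_topVal_edgeChain_eq`). One grid step has
transition operator `1 + δ G + O(δ ^ 2)` with `G` the generator of the edge, whence the
finite-dimensional distributions (`integral_prod_pathSums`).

Comparison. The last entry of the bottom row is also the last entry of the edge. No process on
patterns is constructed: all semigroups are exponentials of bounded operators on bounded functions,
and `Related` says that a function on the chamber and a function of the edge come from one function
on patterns. This relation survives the semigroups and multiplication by functions of the common
coordinate, so `iterExpect_doobOp` equates the finite-dimensional distributions, which determine the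
law. -/

theorem norm_exp_le_exp_norm [NormOneClass 𝔸] (x : 𝔸) : ‖exp x‖ ≤ Real.exp ‖x‖ := by
  have h := exp_series_hasSum_exp' (𝕂 := ℝ) x
  have h' := exp_series_hasSum_exp' (𝕂 := ℝ) ‖x‖
  rw [← Real.exp_eq_exp_ℝ] at h'
  refine h.norm_le_of_bounded h' fun n => ?_
  rw [norm_smul, smul_eq_mul, Real.norm_of_nonneg (by positivity)]
  gcongr
  exact norm_pow_le x n

theorem norm_exp_sub_one_sub_le [NormOneClass 𝔸] (x : 𝔸) :
    ‖exp x - 1 - x‖ ≤ ‖x‖ ^ 2 * Real.exp ‖x‖ := by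
  have h := exp_series_hasSum_exp' (𝕂 := ℝ) x
  have h' := exp_series_hasSum_exp' (𝕂 := ℝ) ‖x‖
  rw [← Real.exp_eq_exp_ℝ] at h'
  have h2 := (hasSum_nat_add_iff' 2).2 h
  have e : exp x - 1 - x = exp x - ∑ i ∈ Finset.range 2, ((i.factorial : ℝ)⁻¹ • x ^ i) := by
    simp [Finset.sum_range_succ, sub_sub]
  rw [e]
  refine h2.norm_le_of_bounded (h'.mul_left (‖x‖ ^ 2)) fun n => ?_
  rw [norm_smul, smul_eq_mul, Real.norm_of_nonneg (by positivity)]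
  have h3 : ‖x ^ (n + 2)‖ ≤ ‖x‖ ^ (n + 2) := norm_pow_le x _
  have h4 : (((n + 2).factorial : ℝ))⁻¹ ≤ ((n.factorial : ℝ))⁻¹ := by
    gcongr; omega
  calc _ ≤ ((n.factorial : ℝ))⁻¹ * ‖x‖ ^ (n + 2) := by gcongr
    _ = _ := by ring

/-- Telescoping. Only `x` is taken to be a contraction; for `y` a bound on the powers is enough,
since `exp (d • G)` is not assumed to be a contraction. -/
theorem norm_pow_sub_pow_le [NormOneClass 𝔸] {x y : 𝔸} {M : ℝ} (hx : ‖x‖ ≤ 1) (m : ℕ)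
    (hy : ∀ j ≤ m, ‖y ^ j‖ ≤ M) : ‖x ^ m - y ^ m‖ ≤ m * (‖x - y‖ * M) := by
  induction m with
  | zero => simp
  | succ m ih =>
    have e : x ^ (m + 1) - y ^ (m + 1) = x * (x ^ m - y ^ m) + (x - y) * y ^ m := by
      rw [pow_succ', pow_succ']; noncomm_ring
    have ih' := ih fun j hj => hy j (by omega)
    have hM : 0 ≤ M := (norm_nonneg _).trans (hy 0 (by omega))
    rw [e]
    calc _ ≤ ‖x‖ * ‖x ^ m - y ^ m‖ + ‖x - y‖ * ‖y ^ m‖ :=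
          (norm_add_le _ _).trans (add_le_add (norm_mul_le _ _) (norm_mul_le _ _))
      _ ≤ 1 * (m * (‖x - y‖ * M)) + ‖x - y‖ * M := by
          gcongr
          exact hy m (by omega)
      _ = _ := by push_cast; ring

theorem exp_natCast_mul_smul (G : 𝔸) (m : ℕ) (d : ℝ) :
    exp ((m * d : ℝ) • G) = exp (d • G) ^ m := by
  letI : NormedAlgebra ℚ 𝔸 := NormedAlgebra.restrictScalars ℚ ℝ 𝔸
  rw [← exp_nsmul, mul_smul, Nat.cast_smul_eq_nsmul]

theorem tendsto_exp_smul (G : 𝔸) {s : ℕ → ℝ} {t : ℝ} (h : Tendsto s atTop (𝓝 t)) :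
    Tendsto (fun N => exp (s N • G)) atTop (𝓝 (exp (t • G))) := by
  letI : NormedAlgebra ℚ 𝔸 := NormedAlgebra.restrictScalars ℚ ℝ 𝔸
  exact (exp_continuous.tendsto _).comp (h.smul_const G)

/-- Powers of approximately infinitesimal contractions converge to the exponential. -/
theorem tendsto_pow_exp [NormOneClass 𝔸] (G : 𝔸) {K : ℕ → 𝔸} {d : ℕ → ℝ} {m : ℕ → ℕ} {t C : ℝ}
    (hd : ∀ N, 0 ≤ d N) (hd0 : Tendsto d atTop (𝓝 0)) (hK : ∀ N, ‖K N‖ ≤ 1)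
    (hKG : ∀ᶠ N in atTop, ‖K N - 1 - d N • G‖ ≤ C * d N ^ 2)
    (hm : Tendsto (fun N => m N * d N) atTop (𝓝 t)) :
    Tendsto (fun N => K N ^ m N) atTop (𝓝 (exp (t • G))) := by
  have h1 := tendsto_exp_smul G hm
  have key : Tendsto (fun N => K N ^ m N - exp ((m N * d N : ℝ) • G)) atTop (𝓝 0) := by
    -- This bounds `exp (d N • G) ^ j` for all `j ≤ m N` once `m N * d N < t + 1`. The error after
    -- `m N` steps is then of order `(m N * d N) * d N`, which tends to zero.
    set M : ℝ := Real.exp ((t + 1) * ‖G‖)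
    have hb : Tendsto (fun N => (m N * d N) * d N * ((C + ‖G‖ ^ 2 * Real.exp ‖G‖) * M)) atTop
        (𝓝 (t * 0 * ((C + ‖G‖ ^ 2 * Real.exp ‖G‖) * M))) :=
      (hm.mul hd0).mul_const _
    rw [mul_zero, zero_mul] at hb
    refine squeeze_zero_norm' ?_ hb
    filter_upwards [hm.eventually (gt_mem_nhds (lt_add_one t)), hKG,
      hd0.eventually (gt_mem_nhds one_pos)] with N h2 h3 h4
    rw [exp_natCast_mul_smul]
    have hy : ∀ j ≤ m N, ‖exp (d N • G) ^ j‖ ≤ M := by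
      intro j hj
      rw [← exp_natCast_mul_smul]
      refine (norm_exp_le_exp_norm _).trans (Real.exp_le_exp.2 ?_)
      rw [norm_smul, Real.norm_of_nonneg (mul_nonneg (by positivity) (hd N))]
      gcongr
      calc (j : ℝ) * d N ≤ m N * d N := by
            have := hd N
            gcongr
        _ ≤ _ := h2.le
    refine (norm_pow_sub_pow_le (hK N) (m N) hy).trans ?_
    have h5 : ‖exp (d N • G) - 1 - d N • G‖ ≤ d N ^ 2 * (‖G‖ ^ 2 * Real.exp ‖G‖) := by
      refine (norm_exp_sub_one_sub_le _).trans ?_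
      rw [norm_smul, Real.norm_of_nonneg (hd N), mul_pow, mul_assoc]
      have := hd N
      gcongr
      exact mul_le_of_le_one_left (norm_nonneg _) h4.le
    have h6 : ‖K N - exp (d N • G)‖ ≤ d N ^ 2 * (C + ‖G‖ ^ 2 * Real.exp ‖G‖) := by
      have e : K N - exp (d N • G) = (K N - 1 - d N • G) - (exp (d N • G) - 1 - d N • G) := by
        abel
      rw [e]
      refine (norm_sub_le _ _).trans ?_
      linarith
    calc (m N : ℝ) * (‖K N - exp (d N • G)‖ * M)
        ≤ m N * (d N ^ 2 * (C + ‖G‖ ^ 2 * Real.exp ‖G‖) * M) := by gcongr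
      _ = _ := by ring
  have := key.add h1
  simpa using this

/-- A closed linear relation which is invariant under a pair of bounded operators is invariant
under the semigroups they generate. -/
theorem exp_mem_of_invariant {V W : Type*} [NormedAddCommGroup V] [NormedSpace ℝ V]
    [CompleteSpace V] [NormedAddCommGroup W] [NormedSpace ℝ W] [CompleteSpace W]
    (R : Submodule ℝ (V × W)) (hR : IsClosed (R : Set (V × W))) (A : V →L[ℝ] V) (B : W →L[ℝ] W)
    (h : ∀ p ∈ R, (A p.1, B p.2) ∈ R) (t : ℝ) {p : V × W} (hp : p ∈ R) :
    (exp (t • A) p.1, exp (t • B) p.2) ∈ R := by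
  have hA := (exp_series_hasSum_exp' (𝕂 := ℝ) (t • A)).mapL
    (ContinuousLinearMap.apply ℝ V p.1)
  have hB := (exp_series_hasSum_exp' (𝕂 := ℝ) (t • B)).mapL
    (ContinuousLinearMap.apply ℝ W p.2)
  have hAB := hA.prodMk hB
  -- The same partial sum of the exponential series is taken in both components, so it stays in `R`;
  -- closedness handles the limit.
  refine hR.mem_of_tendsto hAB (Eventually.of_forall fun S => R.sum_mem fun n _ => ?_)
  have hpow : ∀ n, ((A ^ n) p.1, (B ^ n) p.2) ∈ R := by
    intro n
    induction n with
    | zero => exact hp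
    | succ n ih =>
      rw [pow_succ', pow_succ']
      exact h _ ih
  have := R.smul_mem ((n.factorial : ℝ)⁻¹ * t ^ n) (hpow n)
  simpa [smul_pow, smul_smul] using this

end Exponential
end

noncomputable section

/-! ### Bounded functions and matrices acting on them -/

open scoped ENNReal in
/-- The Banach space of bounded real functions on `E`. -/
def BddFun (E : Type*) : Type _ := lp (fun _ : E => ℝ) ∞

namespace BddFun

variable {E : Type*}

instance : NormedAddCommGroup (BddFun E) :=
  inferInstanceAs (NormedAddCommGroup (lp (fun _ : E => ℝ) ⊤))

instance : NormedSpace ℝ (BddFun E) :=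
  inferInstanceAs (NormedSpace ℝ (lp (fun _ : E => ℝ) ⊤))

instance : CompleteSpace (BddFun E) :=
  inferInstanceAs (CompleteSpace (lp (fun _ : E => ℝ) ⊤))

instance : Mul (BddFun E) := inferInstanceAs (Mul (lp (fun _ : E => ℝ) ⊤))

instance : FunLike (BddFun E) E ℝ where
  coe f := f.1
  coe_injective := fun _ _ h => Subtype.ext h

/-- A bounded function from a function with an explicit bound. -/
def mk (f : E → ℝ) (C : ℝ) (h : ∀ x, |f x| ≤ C) : BddFun E :=
  ⟨f, memℓp_infty ⟨C, by rintro _ ⟨x, rfl⟩; exact h x⟩⟩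

@[simp]
theorem mk_apply (f : E → ℝ) (C : ℝ) (h : ∀ x, |f x| ≤ C) (x : E) : mk f C h x = f x := rfl

@[ext]
theorem ext {f g : BddFun E} (h : ∀ x, f x = g x) : f = g := DFunLike.ext _ _ h

@[simp]
theorem add_apply (f g : BddFun E) (x : E) : (f + g) x = f x + g x := rfl

@[simp]
theorem sub_apply (f g : BddFun E) (x : E) : (f - g) x = f x - g x := rfl

@[simp]
theorem zero_apply (x : E) : (0 : BddFun E) x = 0 := rfl

@[simp]
theorem smul_apply (c : ℝ) (f : BddFun E) (x : E) : (c • f) x = c * f x := rfl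

@[simp]
theorem mul_apply (f g : BddFun E) (x : E) : (f * g) x = f x * g x := rfl

theorem abs_apply_le (f : BddFun E) (x : E) : |f x| ≤ ‖f‖ :=
  lp.norm_apply_le_norm ENNReal.top_ne_zero f x

theorem norm_le {f : BddFun E} {C : ℝ} (hC : 0 ≤ C) (h : ∀ x, |f x| ≤ C) : ‖f‖ ≤ C :=
  lp.norm_le_of_forall_le hC h

/-- Evaluation at a point. -/
def evalL (x : E) : BddFun E →L[ℝ] ℝ :=
  LinearMap.mkContinuous
    { toFun := fun f => f x
      map_add' := fun _ _ => rfl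
      map_smul' := fun _ _ => rfl } 1
    fun f => (f.abs_apply_le x).trans_eq (one_mul _).symm

@[simp]
theorem evalL_apply (x : E) (f : BddFun E) : evalL x f = f x := rfl

theorem sum_apply {ι : Type*} (s : Finset ι) (f : ι → BddFun E) (x : E) :
    (∑ i ∈ s, f i) x = ∑ i ∈ s, f i x :=
  map_sum (evalL x) f s

/-- The indicator function of a set, as a bounded function. -/
def indicator (S : Set E) : BddFun E :=
  mk (S.indicator 1) 1 fun x => by
    by_cases h : x ∈ S <;> simp [h]

open Classical in
@[simp]
theorem indicator_apply (S : Set E) (x : E) : indicator S x = if x ∈ S then 1 else 0 := by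
  simp [indicator, Set.indicator_apply]

instance [Nonempty E] : Nontrivial (BddFun E) :=
  ⟨indicator Set.univ, 0, fun h => by
    have := congrArg (fun f : BddFun E => f (Classical.arbitrary E)) h
    simp at this⟩

end BddFun

section BoundedOperators

open NormedSpace

variable {E F : Type*}

/-- The bounded operator given by a linear map on all functions which preserves boundedness. -/
def boundedOp (A : (E → ℝ) →ₗ[ℝ] (F → ℝ)) (C : ℝ)
    (hA : ∀ f B, (∀ x, |f x| ≤ B) → ∀ x, |A f x| ≤ C * B) : BddFun E →L[ℝ] BddFun F :=
  LinearMap.mkContinuousOfExistsBound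
    { toFun := fun f => BddFun.mk (A f) (C * ‖f‖)
        fun x => hA f ‖f‖ f.abs_apply_le x
      map_add' := fun f g => by
        ext x
        exact congrFun (A.map_add f g) x
      map_smul' := fun c f => by
        ext x
        exact congrFun (A.map_smul c f) x }
    ⟨|C|, fun f => BddFun.norm_le (by positivity) fun x =>
      (hA f ‖f‖ f.abs_apply_le x).trans (by gcongr; exact le_abs_self C)⟩

variable {Q : E → E → ℝ} {T : BddFun E →L[ℝ] BddFun E}

theorem qPow_eq (hT : ∀ f x, T f x = ∑' y, Q x y * f y) (n : ℕ) (x y : E) :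
    qPow Q n x y = (T ^ n) (BddFun.indicator {y}) x := by
  induction n generalizing x with
  | zero =>
    by_cases h : x = y <;> simp [qPow, h]
  | succ n ih =>
    rw [pow_succ', mul_apply_eq_comp, hT]
    simp only [qPow, ih]

theorem hasSum_exp_apply (T : BddFun E →L[ℝ] BddFun E) (t : ℝ) (f : BddFun E) (x : E) :
    HasSum (fun n : ℕ => t ^ n / (n.factorial : ℝ) * (T ^ n) f x) (exp (t • T) f x) := by
  have hA := (exp_series_hasSum_exp' (𝕂 := ℝ) (t • T)).mapL
    (ContinuousLinearMap.apply ℝ (BddFun E) f)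
  have hB := hA.mapL (BddFun.evalL x)
  refine hB.congr_fun fun n => ?_
  simp only [smul_pow, map_smul, BddFun.evalL_apply, ContinuousLinearMap.apply_apply, smul_eq_mul]
  ring

theorem transitionProb_eq (hT : ∀ f x, T f x = ∑' y, Q x y * f y) (t : ℝ) (x y : E) :
    transitionProb Q t x y = exp (t • T) (BddFun.indicator {y}) x := by
  rw [transitionProb, ← (hasSum_exp_apply T t _ x).tsum_eq]
  simp only [qPow_eq hT]

theorem exists_finset_pow_apply_eq_zero (hT : ∀ f x, T f x = ∑' y, Q x y * f y)
    (hQ : ∀ x, (Function.support (Q x)).Finite) (n : ℕ) (x : E) :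
    ∃ S : Finset E, ∀ f : BddFun E, (∀ y ∈ S, f y = 0) → (T ^ n) f x = 0 := by
  classical
  induction n generalizing x with
  | zero => exact ⟨{x}, fun f hf => by simpa using hf x (by simp)⟩
  | succ n ih =>
    choose S hS using ih
    refine ⟨(hQ x).toFinset.biUnion S, fun f hf => ?_⟩
    rw [pow_succ', mul_apply_eq_comp, hT]
    refine (tsum_congr fun y => ?_).trans tsum_zero
    by_cases hy : Q x y = 0
    · simp [hy]
    · rw [hS y f fun z hz => hf z ?_, mul_zero]
      exact Finset.mem_biUnion.2 ⟨y, by simpa using hy, hz⟩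

/-- The tail of the exponential series is small in operator norm, and each of the finitely many
remaining powers sees only finitely many states from `x`. -/
theorem exists_finset_abs_exp_apply_le (hT : ∀ f x, T f x = ∑' y, Q x y * f y)
    (hQ : ∀ x, (Function.support (Q x)).Finite) (t : ℝ) (x : E) {ε : ℝ} (hε : 0 < ε) :
    ∃ S : Finset E, ∀ f : BddFun E, (∀ y ∈ S, f y = 0) → |exp (t • T) f x| ≤ ε * ‖f‖ := by
  classical
  choose S hS using fun n => exists_finset_pow_apply_eq_zero hT hQ n x
  have hA := exp_series_hasSum_exp' (𝕂 := ℝ) (t • T)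
  obtain ⟨I, hI⟩ := (Metric.tendsto_nhds.1 hA ε hε).exists
  rw [dist_comm, dist_eq_norm] at hI
  refine ⟨I.biUnion S, fun f hf => ?_⟩
  have h0 : (∑ n ∈ I, ((n.factorial : ℝ)⁻¹ • (t • T) ^ n)) f x = 0 := by
    rw [_root_.sum_apply, BddFun.sum_apply]
    refine Finset.sum_eq_zero fun n hn => ?_
    have := hS n f fun y hy => hf y (Finset.mem_biUnion.2 ⟨n, hn, hy⟩)
    rw [smul_pow, smul_smul, _root_.smul_apply, BddFun.smul_apply, this, mul_zero]
  have h1 := ((exp (t • T) - ∑ n ∈ I, ((n.factorial : ℝ)⁻¹ • (t • T) ^ n)) f).abs_apply_le x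
  have h2 := ContinuousLinearMap.le_opNorm (exp (t • T) - ∑ n ∈ I, ((n.factorial : ℝ)⁻¹ • (t • T) ^ n)) f
  refine (le_of_eq ?_).trans (h1.trans (h2.trans (by gcongr)))
  rw [_root_.sub_apply, BddFun.sub_apply, h0, sub_zero]

/-- A bounded function need not be a norm limit of finitely supported ones, so continuity of the
operator does not suffice. The concentration on a finite set given by
`exists_finset_abs_exp_apply_le` takes its place. -/
theorem hasSum_transitionProb_mul (hT : ∀ f x, T f x = ∑' y, Q x y * f y)
    (hQ : ∀ x, (Function.support (Q x)).Finite) (t : ℝ) (f : BddFun E) (x : E) :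
    HasSum (fun y => transitionProb Q t x y * f y) (exp (t • T) f x) := by
  classical
  refine Metric.tendsto_atTop.2 fun ε hε => ?_
  -- The function `g - f` below has norm at most `‖f‖`; the `+ 1` covers the case `f = 0`.
  obtain ⟨S, hS⟩ := exists_finset_abs_exp_apply_le hT hQ t x
    (show 0 < ε / (2 * (‖f‖ + 1)) by positivity)
  refine ⟨S, fun I hI => ?_⟩
  set g : BddFun E := ∑ y ∈ I, f y • BddFun.indicator {y}
  have hg : ∀ z, g z = if z ∈ I then f z else 0 := by
    intro z
    simp only [g, BddFun.sum_apply, BddFun.smul_apply,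
      BddFun.indicator_apply, Set.mem_singleton_iff,
      mul_ite, mul_one, mul_zero]
    rw [Finset.sum_ite_eq]
  have e : ∑ y ∈ I, transitionProb Q t x y * f y = exp (t • T) g x := by
    simp only [g, map_sum, BddFun.sum_apply, map_smul,
      BddFun.smul_apply, transitionProb_eq hT, mul_comm]
  have h1 := hS (g - f) fun y hy => by simp [hg, hI hy]
  have h2 : ‖g - f‖ ≤ ‖f‖ := BddFun.norm_le (norm_nonneg _) fun z => by
    by_cases hz : z ∈ I
    · simp [hg, hz]
    · simpa [hg, hz] using f.abs_apply_le z
  rw [Real.dist_eq, e, ← BddFun.sub_apply, ← map_sub]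
  refine h1.trans_lt ?_
  rw [div_mul_eq_mul_div, div_lt_iff₀ (by positivity)]
  have : 0 ≤ ‖f‖ := norm_nonneg f
  nlinarith

end BoundedOperators

/-! ### Expectations along a Markov chain -/

section Expectation

open NormedSpace

variable {E : Type*}

/-- The expectation of `f 0 (X (t 0)) * ⋯ * f (m - 1) (X (t (m - 1))) * g (X (t m))` for a Markov
process whose transition operator from time `t j` to time `t (j + 1)` is `U j`. -/
def iterExpect (U : ℕ → BddFun E →L[ℝ] BddFun E) (f : ℕ → BddFun E) (x₀ : E) :
    ℕ → BddFun E → ℝ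
  | 0, g => g x₀
  | m + 1, g => iterExpect U f x₀ m (f m * U m g)

variable {Ω : Type*} [MeasurableSpace Ω] {P : Measure Ω} [IsProbabilityMeasure P]

/-- Times are removed from the last one backwards: `hstep` replaces `g` at the last time by `U m g`
one time earlier, where it absorbs the factor `f m`. -/
theorem integral_prod_eq_iterExpect {U : ℕ → BddFun E →L[ℝ] BddFun E} {f : ℕ → BddFun E}
    {x₀ : E} {X : ℕ → Ω → E} (h0 : ∀ᵐ ω ∂P, X 0 ω = x₀)
    (hstep : ∀ (m : ℕ) (g : BddFun E), ∫ ω, (∏ j ∈ Finset.range (m + 1), f j (X j ω)) * g (X (m + 1) ω) ∂P =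
      ∫ ω, (∏ j ∈ Finset.range (m + 1), f j (X j ω)) * U m g (X m ω) ∂P) (m : ℕ) (g : BddFun E) :
    ∫ ω, (∏ j ∈ Finset.range m, f j (X j ω)) * g (X m ω) ∂P = iterExpect U f x₀ m g := by
  induction m generalizing g with
  | zero =>
    simp only [Finset.range_zero, Finset.prod_empty, one_mul, iterExpect]
    rw [integral_congr_ae (g := fun _ => g x₀)]
    · simp
    · filter_upwards [h0] with ω h
      rw [h]
  | succ m ih =>
    rw [hstep, iterExpect, ← ih]
    simp only [Finset.prod_range_succ, BddFun.mul_apply, mul_assoc]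

theorem measurable_of_countable_fibers {E' : Type*} [Countable E'] [MeasurableSpace E']
    {X : Ω → E'} (h : ∀ y, MeasurableSet {ω | X ω = y}) : Measurable X :=
  measurable_to_countable' h

/-- Integrals of functions of a random variable with values in a countable set. -/
theorem integral_comp_countable {E' : Type*} [Countable E'] [MeasurableSpace E']
    [MeasurableSingletonClass E'] {X : Ω → E'} (hX : Measurable X) {h : E' → ℝ} {C : ℝ}
    (hC : ∀ y, |h y| ≤ C) :
    HasSum (fun y => P.real {ω | X ω = y} * h y) (∫ ω, h (X ω) ∂P) := by
  have hi : Integrable h (P.map X) :=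
    (integrable_const C).mono' (Measurable.of_discrete).aestronglyMeasurable
      (Eventually.of_forall hC)
  have : IsProbabilityMeasure (P.map X) := Measure.isProbabilityMeasure_map hX.aemeasurable
  have h1 : ∫ ω, h (X ω) ∂P = ∫ y, h y ∂(P.map X) :=
    (integral_map hX.aemeasurable (Measurable.of_discrete).aestronglyMeasurable).symm
  rw [h1]
  have h2 := hasSum_integral_iUnion (μ := P.map X) (f := h) (s := fun y : E' => {y})
    (fun y => measurableSet_singleton y)
    (fun a b hab => by simpa [Function.onFun] using hab) hi.integrableOn
  have h3 : (⋃ y : E', {y}) = Set.univ := by ext; simp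
  rw [h3, Measure.restrict_univ] at h2
  refine h2.congr_fun fun y => ?_
  rw [integral_singleton, smul_eq_mul, map_measureReal_apply hX (measurableSet_singleton y)]
  rfl

variable [Countable E] [MeasurableSpace E] [MeasurableSingletonClass E]

theorem IsMarkovChain.ae_zero {Q : E → E → ℝ} {x₀ : E} {X : ℝ≥0 → Ω → E}
    (hX : IsMarkovChain Q x₀ P X) : ∀ᵐ ω ∂P, X 0 ω = x₀ := by
  have h := hX.fdd 0 (fun _ => 0) (fun _ _ _ => le_rfl) rfl (fun _ => x₀) rfl
  simp only [Finset.univ_eq_empty, Finset.prod_empty, forall_const] at h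
  rw [measureReal_def] at h
  have h' : P {ω | X 0 ω = x₀} = 1 := by
    rw [← ENNReal.toReal_eq_one_iff]; exact h
  exact (prob_compl_eq_zero_iff (hX.measurable 0 x₀)).2 h'

theorem IsMarkovChain.fdd_snoc {Q : E → E → ℝ} {x₀ : E} {X : ℝ≥0 → Ω → E}
    (hX : IsMarkovChain Q x₀ P X) {t : ℕ → ℝ≥0} (ht : Monotone t) (ht0 : t 0 = 0) (m : ℕ)
    (v : Fin (m + 1) → E) (u : E) :
    P.real {ω | (fun j : Fin (m + 1) => X (t j) ω) = v ∧ X (t (m + 1)) ω = u} =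
      P.real {ω | (fun j : Fin (m + 1) => X (t j) ω) = v} *
        transitionProb Q ((t (m + 1) : ℝ) - t m) (v (Fin.last m)) u := by
  by_cases hv : v 0 = x₀
  · have h1 := hX.fdd m (fun j => t j) (fun i j hij => ht hij) ht0 v hv
    have h2 := hX.fdd (m + 1) (fun j => t j) (fun i j hij => ht hij) ht0 (Fin.snoc v u)
      (by rw [← Fin.castSucc_zero, Fin.snoc_castSucc, hv])
    rw [Fin.prod_univ_castSucc] at h2
    simp only [Fin.succ_castSucc, Fin.snoc_castSucc, Fin.succ_last, Fin.snoc_last,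
      Fin.val_castSucc, Fin.val_last] at h2
    have e1 : {ω | (fun j : Fin (m + 1) => X (t j) ω) = v} = {ω | ∀ j : Fin (m + 1), X (t j) ω = v j} := by
      ext ω; simp [funext_iff]
    have e2 : {ω | (fun j : Fin (m + 1) => X (t j) ω) = v ∧ X (t (m + 1)) ω = u} =
        {ω | ∀ j : Fin (m + 1 + 1), X (t j) ω = (Fin.snoc v u : Fin (m + 1 + 1) → E) j} := by
      ext ω
      simp [funext_iff, Fin.forall_fin_succ']
    rw [e1, e2, h1, h2]
    simp
  -- For a history that does not begin at `x₀` the distributions in `fdd` say nothing, but both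
  -- sides vanish.
  · have h0 : P.real {ω | (fun j : Fin (m + 1) => X (t j) ω) = v} = 0 := by
      rw [measureReal_eq_zero_iff]
      refine measure_mono_null ?_ (ae_iff.1 hX.ae_zero)
      intro ω hω h
      exact hv (by rw [← (show _ = v from hω)]; simpa [ht0] using h)
    rw [h0, zero_mul]
    refine le_antisymm ?_ measureReal_nonneg
    rw [← h0]
    exact measureReal_mono fun ω hω => hω.1

/-- This is the Markov property for functions of the whole sampled history: sum the
finite-dimensional distributions over the last state first. -/
theorem IsMarkovChain.integral_step {Q : E → E → ℝ} {T : BddFun E →L[ℝ] BddFun E} {x₀ : E}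
    {X : ℝ≥0 → Ω → E} (hX : IsMarkovChain Q x₀ P X) (hT : ∀ f x, T f x = ∑' y, Q x y * f y)
    (hQ : ∀ x, (Function.support (Q x)).Finite) {t : ℕ → ℝ≥0} (ht : Monotone t) (ht0 : t 0 = 0)
    (m : ℕ) {h : (Fin (m + 1) → E) → ℝ} {C : ℝ} (hC : ∀ v, |h v| ≤ C) (g : BddFun E) :
    ∫ ω, h (fun j => X (t j) ω) * g (X (t (m + 1)) ω) ∂P =
      ∫ ω, h (fun j => X (t j) ω) * exp (((t (m + 1) : ℝ) - t m) • T) g (X (t m) ω) ∂P := by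
  have hmeas : ∀ s, Measurable (X s) := fun s => measurable_of_countable_fibers (hX.measurable s)
  have hV : Measurable (fun ω (j : Fin (m + 1)) => X (t j) ω) :=
    measurable_pi_lambda _ fun j => hmeas _
  set S := exp (((t (m + 1) : ℝ) - t m) • T)
  have hb : ∀ (g : BddFun E) (v : Fin (m + 1) → E) u, |h v * g u| ≤ C * ‖g‖ := by
    intro g v u
    rw [abs_mul]
    exact mul_le_mul (hC v) (g.abs_apply_le u) (abs_nonneg _) ((abs_nonneg _).trans (hC v))
  have h1 := integral_comp_countable (P := P) (hV.prodMk (hmeas (t (m + 1))))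
    (h := fun p => h p.1 * g p.2) (C := C * ‖g‖) fun p => hb g p.1 p.2
  have h2 := integral_comp_countable (P := P) hV
    (h := fun v => h v * S g (v (Fin.last m))) (C := C * ‖S g‖) fun v => hb (S g) v _
  simp only [Prod.ext_iff, hX.fdd_snoc ht ht0] at h1
  simp only [Fin.val_last] at h2
  refine (h1.prod_fiberwise fun v => ?_).unique h2
  have h3 := (hasSum_transitionProb_mul hT hQ ((t (m + 1) : ℝ) - t m) g (v (Fin.last m))).mul_left
    (P.real {ω | (fun j : Fin (m + 1) => X (t j) ω) = v} * h v)
  rw [mul_assoc] at h3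
  refine h3.congr_fun fun u => ?_
  ring

/-- The finite-dimensional distributions of a Markov chain through its transition operators. -/
theorem IsMarkovChain.integral_prod {Q : E → E → ℝ} {T : BddFun E →L[ℝ] BddFun E} {x₀ : E}
    {X : ℝ≥0 → Ω → E} (hX : IsMarkovChain Q x₀ P X) (hT : ∀ f x, T f x = ∑' y, Q x y * f y)
    (hQ : ∀ x, (Function.support (Q x)).Finite) {t : ℕ → ℝ≥0} (ht : Monotone t) (ht0 : t 0 = 0)
    (f : ℕ → BddFun E) (m : ℕ) (g : BddFun E) :
    ∫ ω, (∏ j ∈ Finset.range m, f j (X (t j) ω)) * g (X (t m) ω) ∂P =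
      iterExpect (fun j => exp (((t (j + 1) : ℝ) - t j) • T)) f x₀ m g := by
  refine integral_prod_eq_iterExpect (X := fun j => X (t j)) (by simpa [ht0] using hX.ae_zero)
    (fun m g => ?_) m g
  have hb : ∀ v : Fin (m + 1) → E, |∏ j : Fin (m + 1), f j (v j)| ≤ ∏ j : Fin (m + 1), ‖f j‖ := by
    intro v
    rw [Finset.abs_prod]
    exact Finset.prod_le_prod (fun _ _ => abs_nonneg _) fun j _ => (f j).abs_apply_le _
  have := hX.integral_step hT hQ ht ht0 m hb g
  simpa only [Finset.prod_range] using this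

end Expectation
end

noncomputable section

/-! ### Interlacing partitions -/

/-- A partition with at most `d` parts, listed in decreasing order and padded by zeros. -/
structure IsRow (d : ℕ) (z : ℕ → ℤ) : Prop where
  le : ∀ j, z (j + 1) ≤ z j
  zero : ∀ j, d ≤ j → z j = 0

theorem IsRow.nonneg {d : ℕ} {z : ℕ → ℤ} (h : IsRow d z) (j : ℕ) : 0 ≤ z j := by
  rw [← h.zero (d + j) (by omega)]
  exact antitone_nat_of_succ_le h.le (by omega)

/-- Interlacing of the partitions `u` and `z`: the skew shape `z / u` is a horizontal strip. -/
def Interlace (u z : ℕ → ℤ) : Prop := ∀ j, z (j + 1) ≤ u j ∧ u j ≤ z j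

/-- The nearest sequence to `y` which interlaces with `u`. -/
def clamp (y u : ℕ → ℤ) : ℕ → ℤ
  | 0 => max (y 0) (u 0)
  | j + 1 => min (max (y (j + 1)) (u (j + 1))) (u j)

theorem clamp_eq_self {u z : ℕ → ℤ} (h : Interlace u z) : clamp z u = z := by
  ext i
  rcases i with _ | i
  · exact max_eq_left (h 0).2
  · have := h i
    have := h (i + 1)
    simp only [clamp]
    omega

open Classical in
/-- The weight `a ^ (|z| - |u|)` of a pair of interlacing partitions. -/
def stripWeight (d : ℕ) (a : ℝ) (u z : ℕ → ℤ) : ℝ :=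
  if Interlace u z then a ^ (∑ j ∈ Finset.range d, (z j - u j)) else 0

theorem sum_add_single_sub {d j : ℕ} (hj : j < d) (z u : ℕ → ℤ) (c : ℤ) :
    ∑ i ∈ Finset.range d, ((z + Pi.single j c : ℕ → ℤ) i - u i) =
      ∑ i ∈ Finset.range d, (z i - u i) + c := by
  have : ∀ i, (z + Pi.single j c : ℕ → ℤ) i - u i = (z i - u i) + if i = j then c else 0 := by
    intro i
    simp only [Pi.add_apply, Pi.single_apply]
    ring
  simp only [this, Finset.sum_add_distrib, Finset.sum_ite_eq', Finset.mem_range, hj, if_true]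

theorem sum_sub_add_single {d j : ℕ} (hj : j < d) (z u : ℕ → ℤ) (c : ℤ) :
    ∑ i ∈ Finset.range d, (z i - (u + Pi.single j c : ℕ → ℤ) i) =
      ∑ i ∈ Finset.range d, (z i - u i) - c := by
  have : ∀ i, z i - (u + Pi.single j c : ℕ → ℤ) i = (z i - u i) - if i = j then c else 0 := by
    intro i
    simp only [Pi.add_apply, Pi.single_apply]
    ring
  simp only [this, Finset.sum_sub_distrib, Finset.sum_ite_eq', Finset.mem_range, hj, if_true]

/-! ### One jump in a pair of interlacing rows -/

section TwoRows

variable {d' d : ℕ} {a : ℝ} {u z : ℕ → ℤ}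

theorem add_single_apply (z : ℕ → ℤ) (j : ℕ) (c : ℤ) (i : ℕ) :
    (z + Pi.single j c : ℕ → ℤ) i = z i + if i = j then c else 0 := by
  simp [Pi.single_apply]

open Classical in
-- The upper row arrives at `u` by raising entry `j`. Either `z` still interlaces and only a factor
-- `a` is gained, or `u j = z j + 1` and the clamp pushes `z j` up by one; a push leaves `|z| - |u|`
-- as it was before the jump.
theorem stripWeight_up_left (ha : a ≠ 0) (hd : d' ≤ d) (hu : IsRow d' u) (hz : IsRow d z)
    (G : (ℕ → ℤ) → ℝ) {j : ℕ} (hj : j < d') :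
    stripWeight d a (u + Pi.single j (-1)) z * G (clamp z u) =
      a * (if z (j + 1) < u j then 1 else 0) * (stripWeight d a u z * G z) +
        (if u j = z j + 1 then stripWeight d a u (z + Pi.single j 1) * G (z + Pi.single j 1)
          else 0) := by
  have hjd : j < d := hj.trans_le hd
  simp only [stripWeight, sum_sub_add_single hjd, sum_add_single_sub hjd, sub_neg_eq_add,
    zpow_add_one₀ ha]
  by_cases h1 : Interlace (u + Pi.single j (-1)) z
  · by_cases h2 : u j ≤ z j
    · have h3 : Interlace u z := by
        intro i
        have := h1 i
        simp only [add_single_apply] at this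
        grind
      have h4 := h1 j
      simp only [add_single_apply, if_true] at h4
      rw [if_pos h1, if_pos h3, if_pos (by omega), if_neg (by omega), clamp_eq_self h3]
      ring
    · have h4 := h1 j
      simp only [add_single_apply, if_true] at h4
      have h3 : ¬ Interlace u z := fun h => h2 (h j).2
      have h5 : clamp z u = z + Pi.single j 1 := by
        ext i
        rcases i with _ | i
        · have := h1 0
          simp only [clamp, add_single_apply] at this ⊢
          grind
        · have := h1 i
          have := h1 (i + 1)
          have := hu.le i
          simp only [clamp, add_single_apply] at *
          grind
      have h6 : Interlace u (z + Pi.single j 1) := by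
        intro i
        have := h1 i
        have := hu.le i
        simp only [add_single_apply] at *
        grind
      rw [if_pos h1, if_neg h3, if_pos (by omega : u j = z j + 1), if_pos h6, h5]
      ring
  · rw [if_neg h1]
    have h2 : Interlace u z → ¬ z (j + 1) < u j := by
      intro h h'
      refine h1 fun i => ?_
      have := h i
      simp only [add_single_apply]
      grind
    have h3 : Interlace u (z + Pi.single j 1) → u j ≠ z j + 1 := by
      intro h h'
      refine h1 fun i => ?_
      have := h i
      have := hz.le i
      simp only [add_single_apply] at *
      grind
    grind

open Classical in
-- An upward jump of the lower row is blocked exactly when `z j = u (j - 1)`; the first entry is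
-- never blocked.
theorem stripWeight_up_mid (hu : IsRow d' u) (hz : IsRow d z)
    (G : (ℕ → ℤ) → ℝ) (j : ℕ) :
    stripWeight d a u z * G (clamp (z + Pi.single j 1) u) =
      stripWeight d a u z * (if j = 0 ∨ z j < u (j - 1) then G (z + Pi.single j 1) else G z) := by
  by_cases h : Interlace u z
  · congr 2
    split_ifs with h1
    · refine congrArg G (clamp_eq_self fun i => ?_)
      have := h i
      simp only [add_single_apply] at *
      grind
    · refine congrArg G ?_
      ext i
      rcases i with _ | i
      · have := h 0
        simp only [clamp, add_single_apply] at *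
        grind
      · have := h i
        have := h (i + 1)
        have := hu.le i
        simp only [clamp, add_single_apply] at *
        grind
  · simp [stripWeight, h]

open Classical in
-- If `u` interlaces with the raised row, then either it interlaced before, and this is a free jump
-- of the lower row, or `u j = z j + 1`. The second term is the push of `stripWeight_up_left`.
theorem stripWeight_up_right (ha : a ≠ 0) (hu : IsRow d' u) (hz : IsRow d z)
    (G : (ℕ → ℤ) → ℝ) {j : ℕ} (hj : j < d) :
    stripWeight d a u (z + Pi.single j 1) * G (z + Pi.single j 1) =
      a * (stripWeight d a u z * (if j = 0 ∨ z j < u (j - 1) then G (z + Pi.single j 1) else 0)) +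
        (if u j = z j + 1 then stripWeight d a u (z + Pi.single j 1) * G (z + Pi.single j 1)
          else 0) := by
  simp only [stripWeight, sum_add_single_sub hj, zpow_add_one₀ ha]
  by_cases h0 : u j = z j + 1
  · have h1 : ¬ Interlace u z := fun h => by have := (h j).2; omega
    rw [if_pos h0, if_neg h1]
    ring
  · rw [if_neg h0]
    by_cases h1 : Interlace u (z + Pi.single j 1)
    · have h2 : Interlace u z := by
        intro i
        have := h1 i
        simp only [add_single_apply] at *
        grind
      have h3 : j = 0 ∨ z j < u (j - 1) := by
        rcases j with _ | j
        · simp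
        · have := h1 j
          simp only [add_single_apply] at *
          right
          grind
      rw [if_pos h1, if_pos h2, if_pos h3]
      ring
    · have h2 : Interlace u z → ¬ (j = 0 ∨ z j < u (j - 1)) := by
        intro h h'
        refine h1 fun i => ?_
        have := h i
        simp only [add_single_apply] at *
        grind
      grind

open Classical in
-- Mirror image of `stripWeight_up_left`, with a shift of the index: lowering `u j` pushes the entry
-- `z (j + 1)` lying below it.
theorem stripWeight_down_left (ha : a ≠ 0) (hd : d' ≤ d) (hu : IsRow d' u) (hz : IsRow d z)
    (G : (ℕ → ℤ) → ℝ) {j : ℕ} (hj : j < d') :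
    stripWeight d a (u + Pi.single j 1) z * G (clamp z u) =
      a⁻¹ * (if u j < z j then 1 else 0) * (stripWeight d a u z * G z) +
        (if u j + 1 = z (j + 1) then
          stripWeight d a u (z + Pi.single (j + 1) (-1)) * G (z + Pi.single (j + 1) (-1))
          else 0) := by
  have hjd : j < d := hj.trans_le hd
  by_cases h1 : Interlace (u + Pi.single j 1) z
  · by_cases h2 : z (j + 1) ≤ u j
    · have h3 : Interlace u z := by
        intro i
        have := h1 i
        simp only [add_single_apply] at this
        grind
      have h4 := h1 j
      simp only [add_single_apply, if_true] at h4
      simp only [stripWeight, sum_sub_add_single hjd, zpow_sub_one₀ ha]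
      rw [if_pos h1, if_pos h3, if_pos (by omega), if_neg (by omega), clamp_eq_self h3]
      ring
    · have h4 := h1 j
      simp only [add_single_apply, if_true] at h4
      have h3 : ¬ Interlace u z := fun h => h2 (h j).1
      have h5 : clamp z u = z + Pi.single (j + 1) (-1) := by
        ext i
        rcases i with _ | i
        · have := h1 0
          simp only [clamp, add_single_apply] at this ⊢
          grind
        · have := h1 i
          have := h1 (i + 1)
          have := hu.le i
          simp only [clamp, add_single_apply] at *
          grind
      have h6 : Interlace u (z + Pi.single (j + 1) (-1)) := by
        intro i
        have := h1 i
        have := hu.le j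
        simp only [add_single_apply] at *
        grind
      -- The weight only sees the first `d` entries. The pushed entry is among them, since `z (j +
      -- 1) = 0` is incompatible with `z (j + 1) > u j ≥ 0`.
      have h7 : j + 1 < d := by
        by_contra h
        have := hz.zero (j + 1) (by omega)
        have := hu.nonneg j
        omega
      simp only [stripWeight, sum_sub_add_single hjd, sum_add_single_sub h7, zpow_sub_one₀ ha,
        ← sub_eq_add_neg]
      rw [if_pos h1, if_neg h3, if_pos (by omega : u j + 1 = z (j + 1)), if_pos h6, h5]
      ring
  · have h2 : Interlace u z → ¬ u j < z j := by
      intro h h'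
      refine h1 fun i => ?_
      have := h i
      simp only [add_single_apply]
      grind
    have h3 : Interlace u (z + Pi.single (j + 1) (-1)) → u j + 1 ≠ z (j + 1) := by
      intro h h'
      refine h1 fun i => ?_
      have := h i
      have := hz.le i
      simp only [add_single_apply] at *
      grind
    simp only [stripWeight]
    grind

open Classical in
theorem stripWeight_down_mid (hu : IsRow d' u) (hz : IsRow d z)
    (G : (ℕ → ℤ) → ℝ) (j : ℕ) :
    stripWeight d a u z * G (clamp (z + Pi.single j (-1)) u) =
      stripWeight d a u z * (if u j < z j then G (z + Pi.single j (-1)) else G z) := by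
  by_cases h : Interlace u z
  · congr 2
    split_ifs with h1
    · refine congrArg G (clamp_eq_self fun i => ?_)
      have := h i
      simp only [add_single_apply] at *
      grind
    · refine congrArg G ?_
      ext i
      rcases i with _ | i
      · have := h 0
        simp only [clamp, add_single_apply] at *
        grind
      · have := h i
        have := h (i + 1)
        have := hu.le i
        simp only [clamp, add_single_apply] at *
        grind
  · simp [stripWeight, h]

open Classical in
-- Same splitting as in `stripWeight_up_right`; the last term is the downward push from `u (j - 1)`,
-- which does not exist for `j = 0`.
theorem stripWeight_down_right (ha : a ≠ 0) (hu : IsRow d' u) (hz : IsRow d z)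
    (G : (ℕ → ℤ) → ℝ) {j : ℕ} (hj : j < d) :
    stripWeight d a u (z + Pi.single j (-1)) * G (z + Pi.single j (-1)) =
      a⁻¹ * (stripWeight d a u z * (if u j < z j then G (z + Pi.single j (-1)) else 0)) +
        (if 0 < j ∧ u (j - 1) + 1 = z j then
          stripWeight d a u (z + Pi.single j (-1)) * G (z + Pi.single j (-1)) else 0) := by
  simp only [stripWeight, sum_add_single_sub hj, ← sub_eq_add_neg, zpow_sub_one₀ ha]
  by_cases h0 : 0 < j ∧ u (j - 1) + 1 = z j
  · have h1 : ¬ Interlace u z := fun h => by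
      have := (h (j - 1)).1
      rw [Nat.sub_add_cancel h0.1] at this
      omega
    rw [if_pos h0, if_neg h1]
    ring
  · rw [if_neg h0]
    by_cases h1 : Interlace u (z + Pi.single j (-1))
    · have h2 : Interlace u z := by
        intro i
        have := h1 i
        simp only [add_single_apply] at *
        grind
      have h3 : u j < z j := by
        have := h1 j
        simp only [add_single_apply] at *
        grind
      rw [if_pos h1, if_pos h2, if_pos h3]
      ring
    · have h2 : Interlace u z → ¬ u j < z j := by
        intro h h'
        refine h1 fun i => ?_
        have := h i
        simp only [add_single_apply] at *
        grind
      grind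

end TwoRows
end

noncomputable section

/-! ### The intertwining of two consecutive rows -/

open Classical in
-- The upper row enters through its adjoint unit-rate generator, and the lower row is pushed or
-- jumps by itself; together they must give the unit-rate generator in `z` applied to weight times
-- `G`. Free jumps and pushes match term by term. What remains are multiples of `w * G z`: upward
-- jumps allowed for the lower row are counted by the same inequalities as upward arrivals of the
-- upper row, and likewise downwards, except at the ends. The end terms are the difference between
-- `c` and `c'`.
theorem two_rows_intertwine {d' d : ℕ} {a c c' : ℝ} {u z : ℕ → ℤ} (ha : a ≠ 0) (hd0 : 0 < d)
    (hd : d' = d ∧ c = c' + a * (if 0 < u (d - 1) then 0 else 1) ∨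
      d' + 1 = d ∧ c = c' + a + a⁻¹ * (if 0 < z (d - 1) then 1 else 0))
    (hu : IsRow d' u) (hz : IsRow d z) (G : (ℕ → ℤ) → ℝ) :
    ∑ j ∈ Finset.range d', (stripWeight d a (u + Pi.single j (-1)) z * G (clamp z u) +
        stripWeight d a (u + Pi.single j 1) z * G (clamp z u)) -
      c' * (stripWeight d a u z * G (clamp z u)) +
      stripWeight d a u z * ∑ j ∈ Finset.range d,
        (a * (G (clamp (z + Pi.single j 1) u) - G z) +
          a⁻¹ * (G (clamp (z + Pi.single j (-1)) u) - G z)) =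
    ∑ j ∈ Finset.range d, (stripWeight d a u (z + Pi.single j 1) * G (z + Pi.single j 1) +
        stripWeight d a u (z + Pi.single j (-1)) * G (z + Pi.single j (-1))) -
      c * (stripWeight d a u z * G z) := by
  have hdd : d' ≤ d := by omega
  obtain ⟨e, rfl⟩ : ∃ e, d = e + 1 := ⟨d - 1, by omega⟩
  set w := stripWeight (e + 1) a u z with hw
  -- `Y` collects the upward pushes and `X` the downward pushes; both occur on either side of the
  -- identity.
  set Y : ℕ → ℝ := fun j => if u j = z j + 1 then
    stripWeight (e + 1) a u (z + Pi.single j 1) * G (z + Pi.single j 1) else 0 with hY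
  set X : ℕ → ℝ := fun j => if 0 < j ∧ u (j - 1) + 1 = z j then
    stripWeight (e + 1) a u (z + Pi.single j (-1)) * G (z + Pi.single j (-1)) else 0 with hX
  have hself : w * G (clamp z u) = w * G z := by
    by_cases h : Interlace u z
    · rw [clamp_eq_self h]
    · simp [hw, stripWeight, h]
  have e1 : ∑ j ∈ Finset.range d', stripWeight (e + 1) a (u + Pi.single j (-1)) z * G (clamp z u) =
      a * (w * G z) * ∑ j ∈ Finset.range d', (if z (j + 1) < u j then 1 else 0) +
        ∑ j ∈ Finset.range d', Y j := by
    rw [Finset.mul_sum, ← Finset.sum_add_distrib]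
    refine Finset.sum_congr rfl fun j hj => ?_
    rw [stripWeight_up_left ha hdd hu hz G (Finset.mem_range.1 hj)]
    ring
  have e2 : ∑ j ∈ Finset.range d', stripWeight (e + 1) a (u + Pi.single j 1) z * G (clamp z u) =
      a⁻¹ * (w * G z) * ∑ j ∈ Finset.range d', (if u j < z j then 1 else 0) +
        ∑ j ∈ Finset.range d', X (j + 1) := by
    rw [Finset.mul_sum, ← Finset.sum_add_distrib]
    refine Finset.sum_congr rfl fun j hj => ?_
    rw [stripWeight_down_left ha hdd hu hz G (Finset.mem_range.1 hj)]
    simp only [hX, Nat.add_sub_cancel, Nat.succ_pos, true_and]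
    ring
  have e3 : w * ∑ j ∈ Finset.range (e + 1),
        (a * (G (clamp (z + Pi.single j 1) u) - G z) +
          a⁻¹ * (G (clamp (z + Pi.single j (-1)) u) - G z)) =
      ∑ j ∈ Finset.range (e + 1), (a * (w * if j = 0 ∨ z j < u (j - 1) then
          G (z + Pi.single j 1) else 0) + a⁻¹ * (w * if u j < z j then G (z + Pi.single j (-1))
          else 0)) -
      a * (w * G z) * ∑ j ∈ Finset.range (e + 1), (if j = 0 ∨ z j < u (j - 1) then 1 else 0) -
      a⁻¹ * (w * G z) * ∑ j ∈ Finset.range (e + 1), (if u j < z j then 1 else 0) := by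
    simp only [Finset.mul_sum, ← Finset.sum_sub_distrib]
    refine Finset.sum_congr rfl fun j _ => ?_
    have h1 := stripWeight_up_mid (d := e + 1) (a := a) hu hz G j
    have h2 := stripWeight_down_mid (d := e + 1) (a := a) hu hz G j
    rw [← hw] at h1 h2
    rw [mul_add, mul_left_comm w, mul_left_comm w, mul_sub w, mul_sub w, h1, h2]
    split_ifs <;> ring
  have e4 : ∑ j ∈ Finset.range (e + 1),
        (stripWeight (e + 1) a u (z + Pi.single j 1) * G (z + Pi.single j 1) +
        stripWeight (e + 1) a u (z + Pi.single j (-1)) * G (z + Pi.single j (-1))) =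
      ∑ j ∈ Finset.range (e + 1), (a * (w * if j = 0 ∨ z j < u (j - 1) then
          G (z + Pi.single j 1) else 0) + a⁻¹ * (w * if u j < z j then G (z + Pi.single j (-1))
          else 0)) + ∑ j ∈ Finset.range (e + 1), Y j + ∑ j ∈ Finset.range (e + 1), X j := by
    rw [← Finset.sum_add_distrib, ← Finset.sum_add_distrib]
    refine Finset.sum_congr rfl fun j hj => ?_
    rw [stripWeight_up_right ha hu hz G (Finset.mem_range.1 hj),
      stripWeight_down_right ha hu hz G (Finset.mem_range.1 hj)]
    ring
  -- The never blocked entry `j = 0` accounts for the `+ 1`; the others are shifted by one to match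
  -- the count for the upper row.
  have eN : ∑ j ∈ Finset.range (e + 1), (if j = 0 ∨ z j < u (j - 1) then (1 : ℝ) else 0) =
      ∑ j ∈ Finset.range e, (if z (j + 1) < u j then 1 else 0) + 1 := by
    rw [Finset.sum_range_succ']
    simp
  have eX : ∑ j ∈ Finset.range (e + 1), X j = ∑ j ∈ Finset.range e, X (j + 1) := by
    rw [Finset.sum_range_succ']
    simp [hX]
  rw [Finset.sum_add_distrib, e1, e2, e3, e4, hself, eN, eX]
  have hze : z (e + 1) = 0 := hz.zero _ le_rfl
  -- For equal lengths the leftover is whether the last entry of `u` is at the wall. For a longer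
  -- lower row it is the unblocked first entry together with whether the new last entry of `z` may
  -- move down.
  rcases hd with ⟨rfl, rfl⟩ | ⟨h, rfl⟩
  · have hXe : X (e + 1) = 0 := by
      have := hu.nonneg e
      simp only [hX, Nat.add_sub_cancel, hze]
      rw [if_neg (by omega)]
    rw [Finset.sum_range_succ (fun j => X (j + 1)), hXe,
      Finset.sum_range_succ (fun j => if z (j + 1) < u j then (1 : ℝ) else 0), hze]
    simp only [Nat.add_sub_cancel]
    split_ifs <;> ring
  · obtain rfl : d' = e := by omega
    have hue : u d' = 0 := hu.zero _ le_rfl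
    have hYe : Y d' = 0 := by
      have := hz.nonneg d'
      simp only [hY, hue]
      rw [if_neg (by omega)]
    rw [Finset.sum_range_succ Y, hYe,
      Finset.sum_range_succ (fun j => if u j < z j then (1 : ℝ) else 0), hue]
    simp only [Nat.add_sub_cancel]
    split_ifs <;> ring

theorem Interlace.isRow {d : ℕ} {u z : ℕ → ℤ} (h : Interlace u z) (hu : ∀ j, d ≤ j → u j = 0) :
    IsRow d u :=
  ⟨fun j => (h (j + 1)).2.trans (h j).1, hu⟩

theorem Interlace.isRow_right {d : ℕ} {u z : ℕ → ℤ} (h : Interlace u z)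
    (hz : ∀ j, d ≤ j → z j = 0) : IsRow d z :=
  ⟨fun j => (h j).1.trans (h j).2, hz⟩

theorem finite_interlace {d : ℕ} {z : ℕ → ℤ} (hz : ∀ j, d ≤ j → z j = 0) :
    {u | Interlace u z}.Finite := by
  refine Set.Finite.of_finite_image (f := fun u (j : Fin d) => u j)
    ((Set.Finite.pi' fun j : Fin d => Set.finite_Icc (z (j + 1)) (z j)).subset ?_) ?_
  · rintro _ ⟨u, hu, rfl⟩ j
    exact hu j
  · intro u hu v hv huv
    ext j
    by_cases hj : j < d
    · exact congrFun huv ⟨j, hj⟩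
    · have h1 := hu j
      have h2 := hv j
      rw [hz j (by omega), hz (j + 1) (by omega)] at h1 h2
      omega

theorem finite_support_stripWeight_mul {d : ℕ} {z : ℕ → ℤ} (hz : ∀ j, d ≤ j → z j = 0) (a : ℝ)
    (F : (ℕ → ℤ) → ℝ) : (Function.support fun u => stripWeight d a u z * F u).Finite :=
  (finite_interlace hz).subset fun u hu => by
    by_contra h
    exact hu (by simp [stripWeight, show ¬ Interlace u z from h])

/-! ### Symplectic patterns -/

/-- Arrays with `n` rows. -/
inductive Pat : ℕ → Type
  | nil : Pat 0
  | snoc {n : ℕ} (x : Pat n) (z : ℕ → ℤ) : Pat (n + 1)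

/-- The last row of an array. -/
def Pat.bot : {n : ℕ} → Pat n → ℕ → ℤ
  | _, .nil => 0
  | _, .snoc _ z => z

/-- The array without its last row. -/
def Pat.init : {n : ℕ} → Pat (n + 1) → Pat n
  | _, .snoc x _ => x

/-- The number of entries of the `n`-th row of a symplectic pattern. -/
def rowLen (n : ℕ) : ℕ := (n + 1) / 2

/-- The rate at which the particles in row `n + 1` jump to the right. -/
def rowRate (q : ℕ → ℝ) (n : ℕ) : ℝ := if n % 2 = 0 then (q (n / 2))⁻¹ else q (n / 2)

theorem rowRate_pos {q : ℕ → ℝ} (hq : ∀ i, 0 < q i) (n : ℕ) : 0 < rowRate q n := by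
  unfold rowRate
  split_ifs
  · exact inv_pos.2 (hq _)
  · exact hq _

open Classical in
/-- The weighted sum of a function over the symplectic patterns with a given last row. -/
def patSum (q : ℕ → ℝ) : (n : ℕ) → (Pat n → ℝ) →ₗ[ℝ] ((ℕ → ℤ) → ℝ)
  | 0 =>
    { toFun := fun f z => if z = 0 then f .nil else 0
      map_add' := fun f g => by ext z; by_cases h : z = 0 <;> simp [h]
      map_smul' := fun c f => by ext z; by_cases h : z = 0 <;> simp [h] }
  | n + 1 =>
    { toFun := fun f z => if IsRow (rowLen (n + 1)) z then
        ∑ᶠ u, stripWeight (rowLen (n + 1)) (rowRate q n) u z * patSum q n (fun x : Pat n => f (x.snoc z)) u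
        else 0
      map_add' := fun f g => by
        ext z
        by_cases h : IsRow (rowLen (n + 1)) z
        · simp only [Pi.add_apply, h, if_true]
          rw [← finsum_add_distrib (finite_support_stripWeight_mul h.zero _ _)
            (finite_support_stripWeight_mul h.zero _ _)]
          refine finsum_congr fun u => ?_
          rw [← mul_add, ← Pi.add_apply, ← map_add]
          rfl
        · simp [h]
      map_smul' := fun c f => by
        ext z
        by_cases h : IsRow (rowLen (n + 1)) z
        · simp only [Pi.smul_apply, h, if_true, RingHom.id_apply]
          rw [smul_finsum' c (finite_support_stripWeight_mul h.zero _ _)]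
          refine finsum_congr fun u => ?_
          rw [← mul_smul_comm, ← Pi.smul_apply, ← map_smul]
          rfl
        · simp [h] }

theorem patSum_eq_zero {q : ℕ → ℝ} {n : ℕ} {z : ℕ → ℤ} (hz : ¬ IsRow (rowLen n) z)
    (f : Pat n → ℝ) : patSum q n f z = 0 := by
  cases n with
  | zero =>
    have : z ≠ 0 := by
      rintro rfl
      exact hz ⟨fun _ => le_rfl, fun _ _ => rfl⟩
    simp [patSum, this]
  | succ n => simp [patSum, hz]

theorem patSum_succ (q : ℕ → ℝ) {n : ℕ} {z : ℕ → ℤ} (hz : ∀ j, rowLen (n + 1) ≤ j → z j = 0)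
    (f : Pat (n + 1) → ℝ) : patSum q (n + 1) f z =
      ∑ᶠ u, stripWeight (rowLen (n + 1)) (rowRate q n) u z * patSum q n (fun x : Pat n => f (x.snoc z)) u := by
  by_cases h : IsRow (rowLen (n + 1)) z
  · simp [patSum, h]
  · rw [patSum_eq_zero h]
    refine (finsum_eq_zero_of_forall_eq_zero fun u => ?_).symm
    have : ¬ Interlace u z := fun h' => h (h'.isRow_right hz)
    simp [stripWeight, this]

/-- This allows functions of the last row to be treated as constants under `patSum`. -/
theorem patSum_congr {q : ℕ → ℝ} {n : ℕ} {z : ℕ → ℤ} {f g : Pat n → ℝ}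
    (h : ∀ x, x.bot = z → f x = g x) : patSum q n f z = patSum q n g z := by
  cases n with
  | zero =>
    by_cases hz : z = 0
    · simp [patSum, hz, h .nil hz.symm]
    · simp [patSum, hz]
  | succ n =>
    have : (fun x : Pat n => f (x.snoc z)) = fun x => g (x.snoc z) := funext fun x => h (x.snoc z) rfl
    simp only [patSum, LinearMap.coe_mk, AddHom.coe_mk, this]

/-- The generator of the dynamics on arrays with `n` rows: the particles in each row jump
independently, unless blocked by the row above, and push the particles in the rows below. -/
def patGen (q : ℕ → ℝ) : (n : ℕ) → (Pat n → ℝ) →ₗ[ℝ] (Pat n → ℝ)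
  | 0 => 0
  | n + 1 =>
    { toFun := fun f x =>
        patGen q n (fun x' => f (x'.snoc (clamp x.bot x'.bot))) x.init +
          ∑ j ∈ Finset.range (rowLen (n + 1)),
            (rowRate q n * (f (x.init.snoc (clamp (x.bot + Pi.single j 1) x.init.bot)) - f x) +
              (rowRate q n)⁻¹ * (f (x.init.snoc (clamp (x.bot + Pi.single j (-1)) x.init.bot)) - f x))
      map_add' := fun f g => by
        ext x
        have := congrFun ((patGen q n).map_add (fun x' => f (x'.snoc (clamp x.bot x'.bot)))
          (fun x' => g (x'.snoc (clamp x.bot x'.bot)))) x.init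
        simp only [Pi.add_apply] at this ⊢
        rw [add_add_add_comm, ← this, ← Finset.sum_add_distrib]
        congr 1
        exact Finset.sum_congr rfl fun j _ => by ring
      map_smul' := fun c f => by
        ext x
        have := congrFun ((patGen q n).map_smul c (fun x' => f (x'.snoc (clamp x.bot x'.bot)))) x.init
        simp only [Pi.smul_apply, smul_eq_mul, RingHom.id_apply] at this ⊢
        rw [mul_add, ← this, Finset.mul_sum]
        congr 1
        exact Finset.sum_congr rfl fun j _ => by ring }

theorem patGen_succ (q : ℕ → ℝ) {n : ℕ} (f : Pat (n + 1) → ℝ) (x : Pat n) (z : ℕ → ℤ) :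
    patGen q (n + 1) f (x.snoc z) = patGen q n (fun x' => f (x'.snoc (clamp z x'.bot))) x +
      ∑ j ∈ Finset.range (rowLen (n + 1)),
        (rowRate q n * (f (x.snoc (clamp (z + Pi.single j 1) x.bot)) - f (x.snoc z)) +
          (rowRate q n)⁻¹ * (f (x.snoc (clamp (z + Pi.single j (-1)) x.bot)) - f (x.snoc z))) := rfl

/-- The total rate of the walk of the `n`-th row of a pattern, reduced by the rate of the jumps
which are suppressed at the wall. -/
def rowExit (q : ℕ → ℝ) (n : ℕ) (z : ℕ → ℤ) : ℝ :=
  ∑ i ∈ Finset.range (n / 2), (q i + (q i)⁻¹) +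
    if n % 2 = 0 then 0 else (q (n / 2))⁻¹ + q (n / 2) * if 0 < z (n / 2) then 1 else 0

/-- The generator of the walk with unit rates on partitions. -/
def rowGen (q : ℕ → ℝ) (n : ℕ) (g : (ℕ → ℤ) → ℝ) (z : ℕ → ℤ) : ℝ :=
  ∑ j ∈ Finset.range (rowLen n), (g (z + Pi.single j 1) + g (z + Pi.single j (-1))) -
    rowExit q n z * g z

/-- The parity of `n` decides which alternative of `two_rows_intertwine` applies: a row following an
even one is longer by one entry, a row following an odd one has the same length and restores the
full exit rate. -/
theorem rowExit_succ (q : ℕ → ℝ) (n : ℕ) (u z : ℕ → ℤ) :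
    rowLen n = rowLen (n + 1) ∧ rowExit q (n + 1) z = rowExit q n u +
        rowRate q n * (if 0 < u (rowLen (n + 1) - 1) then 0 else 1) ∨
      rowLen n + 1 = rowLen (n + 1) ∧ rowExit q (n + 1) z = rowExit q n u + rowRate q n +
        (rowRate q n)⁻¹ * (if 0 < z (rowLen (n + 1) - 1) then 1 else 0) := by
  rcases Nat.even_or_odd' n with ⟨i, rfl | rfl⟩
  · right
    have h1 : rowLen (2 * i) = i := by unfold rowLen; omega
    have h2 : rowLen (2 * i + 1) = i + 1 := by unfold rowLen; omega
    refine ⟨by omega, ?_⟩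
    have h3 : (2 * i + 1) / 2 = i := by omega
    have h4 : 2 * i / 2 = i := by omega
    have h5 : (2 * i + 1) % 2 = 1 := by omega
    have h6 : (2 * i) % 2 = 0 := by omega
    simp [rowExit, rowRate, h2, h3, h4, h5, h6, add_assoc]
  · left
    have h1 : rowLen (2 * i + 1) = i + 1 := by unfold rowLen; omega
    have h2 : rowLen (2 * i + 1 + 1) = i + 1 := by unfold rowLen; omega
    refine ⟨by omega, ?_⟩
    have h3 : (2 * i + 1) / 2 = i := by omega
    have h4 : (2 * i + 1 + 1) / 2 = i + 1 := by omega
    have h5 : (2 * i + 1) % 2 = 1 := by omega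
    have h6 : (2 * i + 1 + 1) % 2 = 0 := by omega
    simp only [rowExit, rowRate, h2, h3, h4, h5, h6, Finset.sum_range_succ, Nat.add_sub_cancel]
    by_cases h : 0 < u i
    · simp only [h, if_true, one_ne_zero, if_false]
      ring
    · simp only [h, one_ne_zero, if_false, if_true]
      ring

theorem finite_support_finset_sum {α β : Type*} (s : Finset β) {f : β → α → ℝ}
    (h : ∀ b ∈ s, (Function.support (f b)).Finite) :
    (Function.support fun a => ∑ b ∈ s, f b a).Finite := by
  refine (s.finite_toSet.biUnion h).subset fun a ha => ?_
  obtain ⟨b, hb, hb'⟩ := Finset.exists_ne_zero_of_sum_ne_zero ha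
  exact Set.mem_biUnion hb hb'

theorem finsum_comp_add_right (F : (ℕ → ℤ) → ℝ) (e : ℕ → ℤ) :
    ∑ᶠ u, F (u + e) = ∑ᶠ u, F u :=
  finsum_comp_equiv (Equiv.addRight e)

theorem isRow_of_add_single {d j : ℕ} (hj : j < d) {z : ℕ → ℤ} {c : ℤ}
    (h : ∀ i, d ≤ i → (z + Pi.single j c : ℕ → ℤ) i = 0) : ∀ i, d ≤ i → z i = 0 := by
  intro i hi
  have := h i hi
  rwa [add_single_apply, if_neg (by omega), add_zero] at this

theorem add_single_zero {d j : ℕ} (hj : j < d) {z : ℕ → ℤ} {c : ℤ}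
    (h : ∀ i, d ≤ i → z i = 0) : ∀ i, d ≤ i → (z + Pi.single j c : ℕ → ℤ) i = 0 := by
  intro i hi
  rw [add_single_apply, if_neg (by omega), add_zero, h i hi]

theorem rowLen_pos (n : ℕ) : 0 < rowLen (n + 1) := by unfold rowLen; omega

/-- Induction on the rows. The part of the generator acting on the upper rows is handled by the
induction hypothesis, applied to `f` with the last row already pushed. Moving the jumps of `u` from
the function to the weight then leaves a sum over `u` of the two sides of `two_rows_intertwine`. -/
theorem patSum_patGen {q : ℕ → ℝ} (hq : ∀ i, 0 < q i) (n : ℕ) (f : Pat n → ℝ) {z : ℕ → ℤ}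
    (hz : IsRow (rowLen n) z) : patSum q n (patGen q n f) z = rowGen q n (patSum q n f) z := by
  induction n generalizing z with
  | zero => simp [patGen, rowGen, rowLen, rowExit]
  | succ n ih =>
    set a := rowRate q n
    set d := rowLen (n + 1)
    have ha : a ≠ 0 := (rowRate_pos hq n).ne'
    set F : (ℕ → ℤ) → (ℕ → ℤ) → ℝ := fun u y => patSum q n (fun x : Pat n => f (x.snoc y)) u with hF
    have hF0 : ∀ u y, ¬ IsRow (rowLen n) u → F u y = 0 := fun u y hu => patSum_eq_zero hu _
    have hFc : ∀ u (y : (ℕ → ℤ) → ℕ → ℤ), patSum q n (fun x => f (x.snoc (y x.bot))) u = F u (y u) :=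
      fun u y => patSum_congr fun x hx => by rw [hx]
    have hstep : ∀ u, patSum q n (fun x => patGen q (n + 1) f (x.snoc z)) u =
        patSum q n (patGen q n fun x' => f (x'.snoc (clamp z x'.bot))) u +
          ∑ j ∈ Finset.range d, (a * (F u (clamp (z + Pi.single j 1) u) - F u z) +
            a⁻¹ * (F u (clamp (z + Pi.single j (-1)) u) - F u z)) := by
      intro u
      have e : (fun x => patGen q (n + 1) f (x.snoc z)) =
          patGen q n (fun x' => f (x'.snoc (clamp z x'.bot))) +
            ∑ j ∈ Finset.range d, (a • ((fun x : Pat n => f (x.snoc (clamp (z + Pi.single j 1) x.bot))) -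
              fun x : Pat n => f (x.snoc z)) + a⁻¹ • ((fun x : Pat n => f (x.snoc (clamp (z + Pi.single j (-1)) x.bot))) -
              fun x : Pat n => f (x.snoc z))) := by
        ext x
        simp [patGen_succ, a, d]
      rw [e]
      simp only [map_add, map_sum, map_smul, map_sub, Pi.add_apply, Finset.sum_apply, Pi.smul_apply,
        Pi.sub_apply, smul_eq_mul]
      refine congrArg₂ _ rfl (Finset.sum_congr rfl fun j _ => ?_)
      have h1 : ∀ c, patSum q n (fun x => f (x.snoc (clamp (z + Pi.single j c) x.bot))) u =
          F u (clamp (z + Pi.single j c) u) := fun c => hFc u fun v => clamp (z + Pi.single j c) v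
      rw [h1, h1]
    -- If `u` interlaces with `z` but is too long, a jump at an index below `rowLen n` cannot repair
    -- it, so every term vanishes.
    have hih : ∀ u, stripWeight d a u z *
          patSum q n (patGen q n fun x' => f (x'.snoc (clamp z x'.bot))) u =
        stripWeight d a u z * (∑ j ∈ Finset.range (rowLen n),
          (F (u + Pi.single j 1) (clamp z (u + Pi.single j 1)) +
            F (u + Pi.single j (-1)) (clamp z (u + Pi.single j (-1)))) -
          rowExit q n u * F u (clamp z u)) := by
      intro u
      by_cases hu : IsRow (rowLen n) u
      · rw [ih _ hu, rowGen]
        simp only [hFc _ (fun v => clamp z v)]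
      · by_cases hI : Interlace u z
        · have hu' : ¬ ∀ j, rowLen n ≤ j → u j = 0 := fun h => hu (hI.isRow h)
          rw [patSum_eq_zero hu, hF0 u _ hu, Finset.sum_eq_zero]
          · simp
          · intro j hj
            rw [Finset.mem_range] at hj
            rw [hF0 _ _ fun h => hu' (isRow_of_add_single hj h.zero),
              hF0 _ _ fun h => hu' (isRow_of_add_single hj h.zero), add_zero]
        · simp [stripWeight, hI]
    have fin : ∀ H : (ℕ → ℤ) → ℝ, (Function.support fun u => stripWeight d a u z * H u).Finite :=
      finite_support_stripWeight_mul hz.zero a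
    have fin' : ∀ (H : (ℕ → ℤ) → ℝ) (e : ℕ → ℤ),
        (Function.support fun u => stripWeight d a (u + e) z * H u).Finite := by
      intro H e
      have h1 := (fin fun u => H (u - e)).preimage (f := fun u => u + e)
        (Set.injOn_of_injective (add_left_injective e))
      refine h1.subset fun u hu => ?_
      simpa using hu
    -- Summation by parts: translating `u` puts the generator of the upper row on the weight.
    have shift : ∀ e : ℕ → ℤ, ∑ᶠ u, stripWeight d a u z * F (u + e) (clamp z (u + e)) =
        ∑ᶠ u, stripWeight d a (u + -e) z * F u (clamp z u) := by
      intro e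
      rw [← finsum_comp_add_right (fun u => stripWeight d a (u + -e) z * F u (clamp z u)) e]
      simp
    have hneg : ∀ (j : ℕ) (c : ℤ), -(Pi.single j c : ℕ → ℤ) = Pi.single j (-c) := fun j c =>
      (Pi.single_neg (f := fun _ => ℤ) j c).symm
    have finsupp_add : ∀ {A B : (ℕ → ℤ) → ℝ}, (Function.support A).Finite →
        (Function.support B).Finite → (Function.support fun u => A u + B u).Finite :=
      fun hA hB => (hA.union hB).subset (Function.support_add _ _)
    calc patSum q (n + 1) (patGen q (n + 1) f) z
        = ∑ᶠ u, (∑ j ∈ Finset.range (rowLen n),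
            (stripWeight d a u z * F (u + Pi.single j 1) (clamp z (u + Pi.single j 1)) +
              stripWeight d a u z * F (u + Pi.single j (-1)) (clamp z (u + Pi.single j (-1)))) +
            stripWeight d a u z * (- (rowExit q n u * F u (clamp z u)) +
              ∑ j ∈ Finset.range d, (a * (F u (clamp (z + Pi.single j 1) u) - F u z) +
            a⁻¹ * (F u (clamp (z + Pi.single j (-1)) u) - F u z)))) := by
          rw [patSum_succ q hz.zero]
          refine finsum_congr fun u => ?_
          rw [hstep, mul_add, hih, mul_sub, Finset.mul_sum]
          simp only [mul_add]
          ring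
      _ = ∑ j ∈ Finset.range (rowLen n),
            (∑ᶠ u, stripWeight d a (u + Pi.single j (-1)) z * F u (clamp z u) +
              ∑ᶠ u, stripWeight d a (u + Pi.single j 1) z * F u (clamp z u)) +
            ∑ᶠ u, stripWeight d a u z * (- (rowExit q n u * F u (clamp z u)) +
              ∑ j ∈ Finset.range d, (a * (F u (clamp (z + Pi.single j 1) u) - F u z) +
            a⁻¹ * (F u (clamp (z + Pi.single j (-1)) u) - F u z))) := by
          rw [finsum_add_distrib _ (fin _), finsum_sum_comm]
          · congr 1
            refine Finset.sum_congr rfl fun j _ => ?_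
            rw [finsum_add_distrib (fin _) (fin _), shift, shift, hneg, hneg, neg_neg]
          · exact fun j _ => finsupp_add (fin _) (fin _)
          · exact finite_support_finset_sum _ fun j _ => finsupp_add (fin fun u => F (u + Pi.single j 1) (clamp z (u + Pi.single j 1)))
                (fin fun u => F (u + Pi.single j (-1)) (clamp z (u + Pi.single j (-1))))
      _ = ∑ᶠ u, (∑ j ∈ Finset.range (rowLen n),
            (stripWeight d a (u + Pi.single j (-1)) z * F u (clamp z u) +
              stripWeight d a (u + Pi.single j 1) z * F u (clamp z u)) +
            stripWeight d a u z * (- (rowExit q n u * F u (clamp z u)) +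
              ∑ j ∈ Finset.range d, (a * (F u (clamp (z + Pi.single j 1) u) - F u z) +
            a⁻¹ * (F u (clamp (z + Pi.single j (-1)) u) - F u z)))) := by
          rw [finsum_add_distrib _ (fin _), finsum_sum_comm]
          · congr 1
            refine Finset.sum_congr rfl fun j _ => ?_
            rw [finsum_add_distrib (fin' _ _) (fin' _ _)]
          · exact fun j _ => finsupp_add (fin' _ _) (fin' _ _)
          · exact finite_support_finset_sum _ fun j _ => finsupp_add
              (fin' (fun u => F u (clamp z u)) (Pi.single j (-1)))
              (fin' (fun u => F u (clamp z u)) (Pi.single j 1))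
      _ = ∑ᶠ u, (∑ j ∈ Finset.range d,
            (stripWeight d a u (z + Pi.single j 1) * F u (z + Pi.single j 1) +
              stripWeight d a u (z + Pi.single j (-1)) * F u (z + Pi.single j (-1))) +
            stripWeight d a u z * (- rowExit q (n + 1) z * F u z)) := by
          refine finsum_congr fun u => ?_
          by_cases hu : IsRow (rowLen n) u
          · have := two_rows_intertwine ha (rowLen_pos n) (rowExit_succ q n u z) hu hz (F u)
            linear_combination this
          · simp [hF0 u _ hu]
      _ = _ := by
          have finz : ∀ j ∈ Finset.range d, ∀ c : ℤ, (Function.support fun u =>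
              stripWeight d a u (z + Pi.single j c) * F u (z + Pi.single j c)).Finite :=
            fun j hj c => finite_support_stripWeight_mul
              (add_single_zero (Finset.mem_range.1 hj) hz.zero) a _
          rw [finsum_add_distrib _ (fin _), finsum_sum_comm, rowGen, sub_eq_add_neg]
          · congr 1
            · refine Finset.sum_congr rfl fun j hj => ?_
              rw [finsum_add_distrib (finz j hj _) (finz j hj _),
                patSum_succ q (add_single_zero (Finset.mem_range.1 hj) hz.zero),
                patSum_succ q (add_single_zero (Finset.mem_range.1 hj) hz.zero)]
            · rw [patSum_succ q hz.zero, ← neg_mul, mul_finsum]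
              exact finsum_congr fun u => by ring
          · exact fun j hj => finsupp_add (finz j hj _) (finz j hj _)
          · exact finite_support_finset_sum _ fun j hj => finsupp_add (finz j hj 1) (finz j hj (-1))
end

noncomputable section

/-! ### Positivity and bounds for sums over patterns -/

theorem stripWeight_nonneg {a : ℝ} (ha : 0 ≤ a) (d : ℕ) (u z : ℕ → ℤ) :
    0 ≤ stripWeight d a u z := by
  unfold stripWeight
  split_ifs
  · exact zpow_nonneg ha _
  · exact le_rfl

theorem patSum_nonneg {q : ℕ → ℝ} (hq : ∀ i, 0 < q i) {n : ℕ} {f : Pat n → ℝ} (hf : ∀ x, 0 ≤ f x)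
    (z : ℕ → ℤ) : 0 ≤ patSum q n f z := by
  induction n generalizing z with
  | zero =>
    by_cases h : z = 0
    · simp [patSum, h, hf]
    · simp [patSum, h]
  | succ n ih =>
    by_cases hz : IsRow (rowLen (n + 1)) z
    · rw [patSum_succ q hz.zero]
      exact finsum_nonneg fun u => mul_nonneg
        (stripWeight_nonneg (rowRate_pos hq n).le _ _ _) (ih (fun x => hf _) u)
    · rw [patSum_eq_zero hz]

/-- Positivity applied to `B - f` and `B + f`. -/
theorem abs_patSum_le {q : ℕ → ℝ} (hq : ∀ i, 0 < q i) {n : ℕ} {f : Pat n → ℝ} {B : ℝ}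
    (hf : ∀ x, |f x| ≤ B) (z : ℕ → ℤ) : |patSum q n f z| ≤ B * patSum q n 1 z := by
  have h1 : 0 ≤ patSum q n (B • 1 - f) z := patSum_nonneg hq (fun x => by
    have := (abs_le.1 (hf x)).2
    simpa using this) z
  have h2 : 0 ≤ patSum q n (B • 1 + f) z := patSum_nonneg hq (fun x => by
    have := (abs_le.1 (hf x)).1
    simp only [Pi.add_apply, Pi.smul_apply, Pi.one_apply, smul_eq_mul, mul_one]
    linarith) z
  simp only [map_sub, map_add, map_smul, Pi.sub_apply, Pi.add_apply, Pi.smul_apply,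
    smul_eq_mul] at h1 h2
  rw [abs_le]
  constructor <;> linarith

theorem rowLen_le_succ (n : ℕ) : rowLen n ≤ rowLen (n + 1) ∧ rowLen (n + 1) ≤ rowLen n + 1 := by
  unfold rowLen
  omega

theorem patSum_one_pos {q : ℕ → ℝ} (hq : ∀ i, 0 < q i) {n : ℕ} {z : ℕ → ℤ}
    (hz : IsRow (rowLen n) z) : 0 < patSum q n 1 z := by
  induction n generalizing z with
  | zero =>
    have : z = 0 := by
      ext i
      exact hz.zero i (by simp [rowLen])
    simp [patSum, this]
  | succ n ih =>
    have hl := rowLen_le_succ n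
    -- Cutting `z` off at the length of the previous row gives one admissible row, hence one
    -- strictly positive summand.
    set u : ℕ → ℤ := fun j => if j < rowLen n then z j else 0 with hu
    have hI : Interlace u z := by
      intro j
      have h1 := hz.le j
      have h2 := hz.nonneg j
      simp only [hu]
      split_ifs with h
      · exact ⟨h1, le_rfl⟩
      · exact ⟨(hz.zero _ (by omega)).le, h2⟩
    have hu' : IsRow (rowLen n) u := hI.isRow fun j hj => by simp [hu, not_lt.2 hj]
    rw [patSum_succ q hz.zero]
    refine finsum_pos' (fun v => mul_nonneg
        (stripWeight_nonneg (rowRate_pos hq n).le _ _ _) (patSum_nonneg hq (fun _ => zero_le_one) v))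
      ⟨u, mul_pos ?_ (ih hu')⟩ (finite_support_stripWeight_mul hz.zero _ _)
    rw [stripWeight, if_pos hI]
    exact zpow_pos (rowRate_pos hq n) _

/-- The pattern whose entries are all zero. -/
def zeroPat : (n : ℕ) → Pat n
  | 0 => .nil
  | n + 1 => (zeroPat n).snoc 0

/-- Interlacing squeezes every row above a zero row to zero, and the only weight is `1`. -/
theorem patSum_apply_zero (q : ℕ → ℝ) {n : ℕ} (f : Pat n → ℝ) :
    patSum q n f 0 = f (zeroPat n) := by
  induction n with
  | zero => simp [patSum, zeroPat]
  | succ n ih =>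
    rw [patSum_succ q (z := 0) (fun _ _ => rfl), finsum_eq_single _ 0]
    · rw [ih, stripWeight, if_pos (show Interlace 0 0 from fun j => ⟨le_rfl, le_rfl⟩)]
      simp [zeroPat]
    · intro u hu
      have : ¬ Interlace u 0 := fun h => hu (funext fun j => le_antisymm (h j).2 (h j).1)
      simp [stripWeight, this]

theorem exists_patGen_bound (q : ℕ → ℝ) (n : ℕ) : ∃ C : ℝ, ∀ (f : Pat n → ℝ) (B : ℝ),
    (∀ x, |f x| ≤ B) → ∀ x, |patGen q n f x| ≤ C * B := by
  induction n with
  | zero => exact ⟨0, fun f B _ x => by simp [patGen]⟩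
  | succ n ih =>
    obtain ⟨C, hC⟩ := ih
    refine ⟨C + ∑ j ∈ Finset.range (rowLen (n + 1)),
      (|rowRate q n| * 2 + |(rowRate q n)⁻¹| * 2), fun f B hf x => ?_⟩
    rcases x with _ | ⟨x, z⟩
    rw [patGen_succ, add_mul, Finset.sum_mul]
    refine (abs_add_le _ _).trans (add_le_add (hC _ B (fun _ => hf _) x)
      ((Finset.abs_sum_le_sum_abs _ _).trans (Finset.sum_le_sum fun j _ => ?_)))
    have h2 : ∀ y y', |f y - f y'| ≤ 2 * B := fun y y' =>
      (abs_sub _ _).trans (by linarith [hf y, hf y'])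
    refine (abs_add_le _ _).trans ?_
    rw [abs_mul, abs_mul, add_mul, mul_assoc, mul_assoc]
    gcongr <;> exact h2 _ _

/-- The generator of the dynamics on patterns as a bounded operator. -/
def patGenL (q : ℕ → ℝ) (n : ℕ) : BddFun (Pat n) →L[ℝ] BddFun (Pat n) :=
  boundedOp (patGen q n) (exists_patGen_bound q n).choose (exists_patGen_bound q n).choose_spec

/-! ### The right edge of a pattern -/

/-- The last entry of a tuple, which is zero for the empty tuple. -/
def topVal : {n : ℕ} → (Fin n → ℤ) → ℤ
  | 0, _ => 0
  | n + 1, e => e (Fin.last n)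

/-- The running maximum of `0` and the entries of a tuple. -/
def runMax : (n : ℕ) → (Fin n → ℤ) → Fin n → ℤ
  | 0, e => e
  | n + 1, e => Fin.snoc (α := fun _ => ℤ) (runMax n (Fin.init e))
      (max (topVal (runMax n (Fin.init e))) (e (Fin.last n)))

/-- Non-negative increasing tuples. -/
def SortedEdge : {n : ℕ} → (Fin n → ℤ) → Prop
  | 0, _ => True
  | n + 1, e => SortedEdge (Fin.init e : Fin n → ℤ) ∧
      topVal (Fin.init e : Fin n → ℤ) ≤ e (Fin.last n)

theorem runMax_snoc {n : ℕ} (e : Fin n → ℤ) (y : ℤ) :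
    runMax (n + 1) (Fin.snoc (α := fun _ => ℤ) e y) =
      Fin.snoc (α := fun _ => ℤ) (runMax n e) (max (topVal (runMax n e)) y) := by
  simp [runMax]

@[simp]
theorem topVal_snoc {n : ℕ} (e : Fin n → ℤ) (y : ℤ) :
    topVal (Fin.snoc (α := fun _ => ℤ) e y) = y := by
  simp [topVal]

theorem sortedEdge_snoc {n : ℕ} (e : Fin n → ℤ) (y : ℤ) :
    SortedEdge (Fin.snoc (α := fun _ => ℤ) e y) ↔ SortedEdge e ∧ topVal e ≤ y := by
  simp [SortedEdge]

theorem sortedEdge_runMax {n : ℕ} (e : Fin n → ℤ) : SortedEdge (runMax n e) := by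
  induction n with
  | zero => trivial
  | succ n ih =>
    rw [runMax, sortedEdge_snoc]
    exact ⟨ih _, le_max_left _ _⟩

theorem runMax_eq_self {n : ℕ} {e : Fin n → ℤ} (h : SortedEdge e) : runMax n e = e := by
  induction n with
  | zero => rfl
  | succ n ih =>
    rw [runMax, ih h.1, max_eq_right h.2]
    exact Fin.snoc_init_self e

/-- The right edge of a pattern. -/
def Pat.edge : {n : ℕ} → Pat n → Fin n → ℤ
  | _, .nil => Fin.elim0
  | _, .snoc x z => Fin.snoc (α := fun _ => ℤ) x.edge (z 0)

theorem topVal_edge {n : ℕ} (x : Pat n) : topVal x.edge = x.bot 0 := by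
  cases x with
  | nil => rfl
  | snoc x z => simp [Pat.edge, Pat.bot]

/-- The clamp keeps the first entry of a row above that of the previous row, so the dynamics does
not leave the arrays with sorted edge. The values of a function on other arrays are irrelevant. -/
theorem patGen_congr_sorted {q : ℕ → ℝ} {n : ℕ} {f g : Pat n → ℝ}
    (h : ∀ x, SortedEdge x.edge → f x = g x) {x : Pat n} (hx : SortedEdge x.edge) :
    patGen q n f x = patGen q n g x := by
  induction n with
  | zero => simp [patGen]
  | succ n ih =>
    rcases x with _ | ⟨x, z⟩
    rw [Pat.edge, sortedEdge_snoc] at hx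
    rw [patGen_succ, patGen_succ]
    have key : ∀ (y : ℕ → ℤ) (x' : Pat n), SortedEdge x'.edge →
        f (x'.snoc (clamp y x'.bot)) = g (x'.snoc (clamp y x'.bot)) := by
      intro y x' hx'
      refine h _ ?_
      rw [Pat.edge, sortedEdge_snoc, topVal_edge]
      exact ⟨hx', le_max_right _ _⟩
    have hxz : f (x.snoc z) = g (x.snoc z) := h _ (by rw [Pat.edge, sortedEdge_snoc]; exact hx)
    rw [ih (fun x' hx' => key z x' hx') hx.1, hxz]
    simp only [key _ x hx.1]

/-- The generator of the right edge dynamics, with rates `a i` and `(a i)⁻¹`. -/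
def edgeGen (a : ℕ → ℝ) (n : ℕ) (φ : (Fin n → ℤ) → ℝ) (e : Fin n → ℤ) : ℝ :=
  ∑ i : Fin n, (a i * (φ (runMax n (e + Pi.single i 1)) - φ e) +
    (a i)⁻¹ * (φ (runMax n (e + Pi.single i (-1))) - φ e))

theorem snoc_add_single_castSucc {n : ℕ} (e : Fin n → ℤ) (y c : ℤ) (i : Fin n) :
    (Fin.snoc (α := fun _ => ℤ) e y : Fin (n + 1) → ℤ) + Pi.single i.castSucc c =
      Fin.snoc (α := fun _ => ℤ) (e + Pi.single i c) y := by
  ext j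
  refine Fin.lastCases ?_ (fun j => ?_) j
  · simp [Pi.single_apply, (Fin.castSucc_lt_last i).ne']
  · simp [Pi.single_apply]

theorem snoc_add_single_last {n : ℕ} (e : Fin n → ℤ) (y c : ℤ) :
    (Fin.snoc (α := fun _ => ℤ) e y : Fin (n + 1) → ℤ) + Pi.single (Fin.last n) c =
      Fin.snoc (α := fun _ => ℤ) e (y + c) := by
  ext j
  refine Fin.lastCases ?_ (fun j => ?_) j
  · simp
  · simp [Pi.single_apply, (Fin.castSucc_lt_last j).ne]

/-- The first entry of `clamp y u` is `max (y 0) (u 0)`, which involves only first entries. The edge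
is therefore Markovian by itself: upper entries push lower ones, and a lower entry may not fall
below the one above. -/
theorem patGen_comp_edge {q : ℕ → ℝ} {n : ℕ} (φ : (Fin n → ℤ) → ℝ) {x : Pat n}
    (hx : SortedEdge x.edge) :
    patGen q n (fun x => φ x.edge) x = edgeGen (rowRate q) n φ x.edge := by
  induction n with
  | zero => simp [patGen, edgeGen]
  | succ n ih =>
    rcases x with _ | ⟨x, z⟩
    rw [Pat.edge, sortedEdge_snoc] at hx
    have htop : topVal x.edge = x.bot 0 := topVal_edge x
    have e1 : (fun x' : Pat n => φ (x'.snoc (clamp z x'.bot)).edge) =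
        fun x' => (fun e : Fin n → ℤ => φ (Fin.snoc (α := fun _ => ℤ) e (max (topVal e) (z 0)))) x'.edge := by
      ext x'
      simp only [Pat.edge, clamp, topVal_edge, max_comm]
    have e3 := ih (fun e : Fin n → ℤ => φ (Fin.snoc (α := fun _ => ℤ) e (max (topVal e) (z 0)))) hx.1
    rw [patGen_succ, e1, e3, edgeGen, edgeGen, Fin.sum_univ_castSucc]
    congr 1
    · refine Finset.sum_congr rfl fun i _ => ?_
      simp only [Pat.edge, snoc_add_single_castSucc, runMax_snoc, Fin.val_castSucc,
        max_eq_right hx.2]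
    · obtain ⟨d, hd⟩ : ∃ d, rowLen (n + 1) = d + 1 := ⟨rowLen (n + 1) - 1, by have := rowLen_pos n; omega⟩
      -- Jumps away from the first position do not change the edge; sortedness is needed because the
      -- clamp would otherwise lift the first entry.
      have e2 : ∀ j c, (x.snoc (clamp (z + Pi.single (j + 1) c) x.bot)).edge = (x.snoc z).edge := by
        intro j c
        simp only [Pat.edge, clamp, add_single_apply]
        rw [if_neg (by omega), add_zero, ← htop, max_eq_left hx.2]
      rw [hd, Finset.sum_range_succ']
      simp only [e2, sub_self, mul_zero, add_zero, Finset.sum_const_zero, zero_add]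
      simp only [Pat.edge, snoc_add_single_last, runMax_snoc, runMax_eq_self hx.1, clamp,
        add_single_apply, if_true, htop, Fin.val_last, max_comm]
end

noncomputable section

/-! ### Q-matrices with finite rows as bounded operators -/

section MatrixOp

variable {E : Type*} {Q : E → E → ℝ}

theorem summable_row_mul (hQ : ∀ x, (Function.support (Q x)).Finite) (x : E) (f : E → ℝ) :
    Summable fun y => Q x y * f y :=
  summable_of_finite_support ((hQ x).subset fun y hy h => hy (by simp [h]))

/-- The bounded operator of a matrix with finite rows whose absolute row sums are bounded. -/
def matrixOp (Q : E → E → ℝ) (hQ : ∀ x, (Function.support (Q x)).Finite) (C : ℝ)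
    (hC : ∀ x, ∑' y, |Q x y| ≤ C) : BddFun E →L[ℝ] BddFun E :=
  boundedOp
    { toFun := fun f x => ∑' y, Q x y * f y
      map_add' := fun f g => by
        ext x
        simp only [Pi.add_apply, mul_add]
        exact (summable_row_mul hQ x f).tsum_add (summable_row_mul hQ x g)
      map_smul' := fun c f => by
        ext x
        simp only [Pi.smul_apply, smul_eq_mul, RingHom.id_apply, mul_left_comm _ c]
        exact tsum_mul_left } C fun f B hf x => by
    have h1 : Summable fun y => |Q x y * f y| := (summable_row_mul hQ x f).abs
    have h2 : Summable fun y => |Q x y| := by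
      simpa using (summable_row_mul hQ x 1).abs
    have hB : ∀ y, |Q x y * f y| ≤ |Q x y| * B := fun y => by
      rw [abs_mul]
      exact mul_le_mul_of_nonneg_left (hf y) (abs_nonneg _)
    have hB0 : 0 ≤ B := (abs_nonneg _).trans (hf x)
    calc |∑' y, Q x y * f y| ≤ ∑' y, |Q x y * f y| := by
          simpa only [Real.norm_eq_abs] using norm_tsum_le_tsum_norm (f := fun y => Q x y * f y) h1
      _ ≤ ∑' y, |Q x y| * B := h1.tsum_le_tsum hB (h2.mul_right B)
      _ = (∑' y, |Q x y|) * B := tsum_mul_right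
      _ ≤ C * B := by gcongr; exact hC x

theorem matrixOp_apply (hQ : ∀ x, (Function.support (Q x)).Finite) {C : ℝ}
    (hC : ∀ x, ∑' y, |Q x y| ≤ C) (f : BddFun E) (x : E) :
    matrixOp Q hQ C hC f x = ∑' y, Q x y * f y := rfl

/-- With zero row sum and non-negative off-diagonal entries, the off-diagonal mass equals the
absolute value of the diagonal entry. -/
theorem tsum_abs_row_le (hQ : ∀ x, (Function.support (Q x)).Finite)
    (hoff : ∀ x y, y ≠ x → 0 ≤ Q x y) (hsum : ∀ x, ∑' y, Q x y = 0) (x : E) :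
    ∑' y, |Q x y| ≤ 2 * |Q x x| := by
  classical
  have h2 : Summable fun y => Q x y := by simpa using summable_row_mul hQ x 1
  have h3 := h2.hasSum
  rw [hsum] at h3
  have h4 := h3.add (hasSum_ite_eq x (2 * |Q x x|))
  rw [zero_add] at h4
  refine hasSum_le (fun y => ?_) h2.abs.hasSum h4
  by_cases h : y = x
  · subst h
    simp only [if_true]
    linarith [neg_abs_le (Q y y)]
  · simp [h, abs_of_nonneg (hoff x y h)]

end MatrixOp

section Walk

variable {k : ℕ}

theorem hasSum_walkQ_mul (q : Fin k → ℝ) (x : Fin k → ℤ) (g : (Fin k → ℤ) → ℝ) :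
    HasSum (fun y => walkQ q x y * g y) (-(∑ i, (q i + (q i)⁻¹)) * g x +
      ∑ i, ((q i)⁻¹ * g (x + Pi.single i 1) + q i * g (x - Pi.single i 1))) := by
  have h : ∀ (z : Fin k → ℤ) (c : ℝ), HasSum (fun y => (if y = z then c else 0) * g y) (c * g z) := by
    intro z c
    convert hasSum_ite_eq z (c * g z) using 2 with y
    by_cases hy : y = z <;> simp [hy]
  have h2 := (h x (-∑ i, (q i + (q i)⁻¹))).add (hasSum_sum (s := Finset.univ) fun i _ =>
    (h (x + Pi.single i 1) (q i)⁻¹).add (h (x - Pi.single i 1) (q i)))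
  convert h2 using 2 with y
  rw [walkQ, add_mul, Finset.sum_mul]
  simp only [add_mul]

theorem finite_support_walkQ (q : Fin k → ℝ) (x : Fin k → ℤ) :
    (Function.support (walkQ q x)).Finite := by
  classical
  refine (({x} ∪ (Finset.univ.image fun i => x + Pi.single i 1) ∪
    (Finset.univ.image fun i => x - Pi.single i 1) : Finset (Fin k → ℤ))).finite_toSet.subset
    fun y hy => ?_
  by_contra h
  simp only [Finset.coe_union, Finset.coe_singleton, Finset.coe_image, Finset.coe_univ,
    Set.image_univ, Set.mem_union, Set.mem_singleton_iff, Set.mem_range, not_or, not_exists] at h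
  refine hy ?_
  have h1 : ∀ i, y ≠ x + Pi.single i 1 := fun i hi => h.1.2 i hi.symm
  have h2 : ∀ i, y ≠ x - Pi.single i 1 := fun i hi => h.2 i hi.symm
  simp [walkQ, h.1.1, h1, h2]

theorem walkQ_nonneg {q : Fin k → ℝ} (hq : ∀ i, 0 < q i) {x y : Fin k → ℤ} (h : y ≠ x) :
    0 ≤ walkQ q x y := by
  rw [walkQ, if_neg h, zero_add]
  refine Finset.sum_nonneg fun i _ => add_nonneg ?_ ?_
  · split_ifs
    exacts [(inv_pos.2 (hq i)).le, le_rfl]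
  · split_ifs
    exacts [(hq i).le, le_rfl]

theorem walkQ_self (q : Fin k → ℝ) (x : Fin k → ℤ) : walkQ q x x = -∑ i, (q i + (q i)⁻¹) := by
  have h1 : ∀ i : Fin k, x ≠ x + Pi.single i 1 := fun i h => by
    have := congrFun h i
    simp at this
  have h2 : ∀ i : Fin k, x ≠ x - Pi.single i 1 := fun i h => by
    have := congrFun h i
    simp only [Pi.sub_apply, Pi.single_eq_same] at this
    omega
  simp [walkQ, h1, h2]

theorem tsum_walkQ (q : Fin k → ℝ) (x : Fin k → ℤ) : ∑' y, walkQ q x y = 0 := by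
  have h := (hasSum_walkQ_mul q x 1).tsum_eq
  simp only [Pi.one_apply, mul_one] at h
  rw [h, neg_add_eq_zero]
  exact Finset.sum_congr rfl fun i _ => add_comm _ _

theorem tsum_abs_walkQ_le {q : Fin k → ℝ} (hq : ∀ i, 0 < q i) (x : Fin k → ℤ) :
    ∑' y, |walkQ q x y| ≤ 2 * |∑ i, (q i + (q i)⁻¹)| := by
  have := tsum_abs_row_le (finite_support_walkQ q) (fun x y h => walkQ_nonneg hq h)
    (tsum_walkQ q) x
  rwa [walkQ_self, abs_neg] at this

/-- The generator of the random walk as a bounded operator. -/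
def walkOp (q : Fin k → ℝ) (hq : ∀ i, 0 < q i) : BddFun (Fin k → ℤ) →L[ℝ] BddFun (Fin k → ℤ) :=
  matrixOp (walkQ q) (finite_support_walkQ q) _ (tsum_abs_walkQ_le hq)

end Walk

/-! ### The intertwining with the walk in the chamber -/

section Chamber

variable {k : ℕ}

/-- Extension of a finite list of parameters by ones. -/
def extendRate (q : Fin k → ℝ) (i : ℕ) : ℝ := if h : i < k then q ⟨i, h⟩ else 1

theorem extendRate_pos {q : Fin k → ℝ} (hq : ∀ i, 0 < q i) (i : ℕ) : 0 < extendRate q i := by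
  unfold extendRate
  split_ifs
  · exact hq _
  · exact one_pos

/-- The partition given by a point of the chamber. -/
def toRow (z : Fin k → ℤ) (j : ℕ) : ℤ := if h : j < k then z (Fin.rev ⟨j, h⟩) else 0

theorem isRow_toRow_iff {z : Fin k → ℤ} : IsRow k (toRow z) ↔ z ∈ chamber k := by
  constructor
  · intro h
    have ha : Antitone (toRow z) := antitone_nat_of_succ_le h.le
    have hz : ∀ i : Fin k, z i = toRow z (Fin.rev i) := fun i => by
      rw [toRow, dif_pos (Fin.rev i).isLt, Fin.eta, Fin.rev_rev]
    refine ⟨fun i j hij => ?_, fun i => ?_⟩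
    · rw [hz, hz]
      exact ha (Fin.rev_le_rev.2 hij)
    · rw [hz]
      exact h.nonneg _
  · rintro ⟨hm, h0⟩
    refine ⟨fun j => ?_, fun j hj => by simp [toRow, not_lt.2 hj]⟩
    unfold toRow
    split_ifs with h1 h2
    · exact hm (Fin.rev_le_rev.2 (Fin.mk_le_mk.2 (Nat.le_succ j)))
    · omega
    · exact h0 _
    · exact le_rfl

theorem toRow_add_single (z : Fin k → ℤ) (i : Fin k) (c : ℤ) :
    toRow (z + Pi.single i c) = toRow z + Pi.single (Fin.rev i : ℕ) c := by
  ext j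
  rw [add_single_apply]
  unfold toRow
  by_cases h : j < k
  · simp only [h, dif_pos, Pi.add_apply, Pi.single_apply]
    congr 2
    simp only [eq_iff_iff, Fin.ext_iff, Fin.val_rev]
    omega
  · have := (Fin.rev i).isLt
    rw [dif_neg h, dif_neg h, if_neg (by omega), add_zero]

theorem rowLen_two_mul (k : ℕ) : rowLen (2 * k) = k := by unfold rowLen; omega

theorem rowExit_two_mul (q : Fin k → ℝ) (z : ℕ → ℤ) :
    rowExit (extendRate q) (2 * k) z = ∑ i, (q i + (q i)⁻¹) := by
  have h1 : 2 * k / 2 = k := by omega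
  have h2 : 2 * k % 2 = 0 := by omega
  rw [rowExit, h1, h2, if_pos rfl, add_zero, Finset.sum_range]
  simp [extendRate]

theorem rowGen_toRow (q : Fin k → ℝ) (g : (ℕ → ℤ) → ℝ) (z : Fin k → ℤ) :
    rowGen (extendRate q) (2 * k) g (toRow z) =
      ∑ i, (g (toRow (z + Pi.single i 1)) + g (toRow (z - Pi.single i 1))) -
        (∑ i, (q i + (q i)⁻¹)) * g (toRow z) := by
  rw [rowGen, rowExit_two_mul, rowLen_two_mul, Finset.sum_range,
    ← Equiv.sum_comp (Fin.revPerm : Equiv.Perm (Fin k))]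
  simp only [sub_eq_add_neg, ← Pi.single_neg, toRow_add_single, Fin.revPerm_apply]

/-- The average of a function over the symplectic patterns with a given bottom row. -/
def patAvg (q : Fin k → ℝ) : (Pat (2 * k) → ℝ) →ₗ[ℝ] (chamber k → ℝ) where
  toFun f z := patSum (extendRate q) (2 * k) f (toRow (z : Fin k → ℤ)) /
    patSum (extendRate q) (2 * k) 1 (toRow (z : Fin k → ℤ))
  map_add' f g := by
    ext z
    simp [add_div]
  map_smul' c f := by
    ext z
    simp [mul_div_assoc]

theorem patSum_toRow_pos {q : Fin k → ℝ} (hq : ∀ i, 0 < q i) {z : Fin k → ℤ} (hz : z ∈ chamber k) :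
    0 < patSum (extendRate q) (2 * k) 1 (toRow z) :=
  patSum_one_pos (extendRate_pos hq) (by rw [rowLen_two_mul]; exact isRow_toRow_iff.2 hz)

/-- `patAvg` as a bounded operator. -/
def patAvgL (q : Fin k → ℝ) (hq : ∀ i, 0 < q i) : BddFun (Pat (2 * k)) →L[ℝ] BddFun (chamber k) :=
  boundedOp (patAvg q) 1 fun f B hf z => by
    have h := patSum_toRow_pos hq z.2
    rw [patAvg, LinearMap.coe_mk, AddHom.coe_mk, abs_div, abs_of_pos h, div_le_iff₀ h, one_mul]
    exact abs_patSum_le (extendRate_pos hq) hf _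

@[simp]
theorem patAvgL_apply (q : Fin k → ℝ) (hq : ∀ i, 0 < q i) (f : BddFun (Pat (2 * k)))
    (z : chamber k) : patAvgL q hq f z =
      patSum (extendRate q) (2 * k) f (toRow (z : Fin k → ℤ)) /
    patSum (extendRate q) (2 * k) 1 (toRow (z : Fin k → ℤ)) := rfl

theorem finite_support_doobQ (q : Fin k → ℝ) (h : (Fin k → ℤ) → ℝ) (x : chamber k) :
    (Function.support (doobQ (walkQ q) h (chamber k) x)).Finite := by
  refine ((finite_support_walkQ q x).preimage (f := Subtype.val)
    Subtype.val_injective.injOn).subset fun y hy hy' => hy ?_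
  simp only [doobQ]
  rw [hy', mul_zero, zero_mul]

theorem prod_zpow_add_single {q : Fin k → ℝ} (hq : ∀ i, 0 < q i) (x : Fin k → ℤ) (i : Fin k) (c : ℤ) :
    ∏ j, q j ^ (x + Pi.single i c : Fin k → ℤ) j = (∏ j, q j ^ x j) * q i ^ c := by
  have : ∀ j, q j ^ (x + Pi.single i c : Fin k → ℤ) j = q j ^ x j * if j = i then q i ^ c else 1 := by
    intro j
    rw [Pi.add_apply, zpow_add₀ (hq j).ne', Pi.single_apply]
    split_ifs with h
    · rw [h]
    · simp
  rw [Finset.prod_congr rfl fun j _ => this j, Finset.prod_mul_distrib]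
  simp

/-- The normalisation of the average cancels the Schur function in `h`, and the monomial in `h`
absorbs the rates of the walk. Both sides become `rowGen` applied to `patSum`, so this is
`patSum_patGen` after an `h`-transform. -/
theorem tsum_doobQ_mul_patAvg {q : Fin k → ℝ} (hq : ∀ i, 0 < q i)
    (hSp : ∀ z ∈ chamber k, sympSchur q z = patSum (extendRate q) (2 * k) 1 (toRow z))
    (f : Pat (2 * k) → ℝ) (x : chamber k) :
    ∑' y, doobQ (walkQ q) (harmonicH q) (chamber k) x y * patAvg q f y =
      patAvg q (patGen (extendRate q) (2 * k) f) x := by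
  have hx := patSum_toRow_pos hq x.2
  have hp : 0 < ∏ i, q i ^ (x : Fin k → ℤ) i := Finset.prod_pos fun i _ => zpow_pos (hq i) _
  set S := patSum (extendRate q) (2 * k) with hS
  -- Sums over patterns vanish outside the chamber, so killing costs nothing and the sum may run
  -- over all of `ℤ ^ k`.
  have hout : ∀ y : Fin k → ℤ, y ∉ chamber k → S f (toRow y) = 0 := fun y hy =>
    patSum_eq_zero (fun h => hy (isRow_toRow_iff.1 (by rwa [rowLen_two_mul] at h))) f
  have e1 : ∀ y : chamber k, doobQ (walkQ q) (harmonicH q) (chamber k) x y * patAvg q f y =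
      (harmonicH q x)⁻¹ * (walkQ q x y * ((∏ i, q i ^ (y : Fin k → ℤ) i) * S f (toRow (y : Fin k → ℤ)))) := by
    intro y
    have hy := patSum_toRow_pos hq y.2
    rw [← hS] at hy
    simp only [doobQ, patAvg, LinearMap.coe_mk, AddHom.coe_mk]
    rw [harmonicH, harmonicH, hSp y y.2, ← hS]
    field_simp
  have e2 := tsum_subtype (chamber k) fun y : Fin k → ℤ =>
    walkQ q x y * ((∏ i, q i ^ y i) * S f (toRow y))
  have e3 : (chamber k).indicator (fun y : Fin k → ℤ =>
      walkQ q x y * ((∏ i, q i ^ y i) * S f (toRow y))) = fun y : Fin k → ℤ =>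
      walkQ q x y * ((∏ i, q i ^ y i) * S f (toRow y)) := by
    ext y
    by_cases hy : y ∈ chamber k
    · rw [Set.indicator_of_mem hy]
    · rw [Set.indicator_of_notMem hy, hout y hy, mul_zero, mul_zero]
  rw [tsum_congr e1, tsum_mul_left, e2, e3,
    (hasSum_walkQ_mul q x fun y => (∏ i, q i ^ y i) * S f (toRow y)).tsum_eq]
  have e4 : patAvg q (patGen (extendRate q) (2 * k) f) x =
      rowGen (extendRate q) (2 * k) (S f) (toRow (x : Fin k → ℤ)) / S 1 (toRow (x : Fin k → ℤ)) := by
    rw [← patSum_patGen (extendRate_pos hq) _ f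
      (by rw [rowLen_two_mul]; exact isRow_toRow_iff.2 x.2)]
    rfl
  rw [e4, rowGen_toRow, harmonicH, hSp x x.2]
  -- A jump to the right has rate `(q i)⁻¹` and multiplies the monomial by `q i`; a jump to the left
  -- does the opposite. Both end up with rate one.
  have e5 : ∀ (v : Fin k → ℤ) (i : Fin k),
      (q i)⁻¹ * ((∏ j, q j ^ (v + Pi.single i 1 : Fin k → ℤ) j) * S f (toRow (v + Pi.single i 1))) +
      q i * ((∏ j, q j ^ (v - Pi.single i 1 : Fin k → ℤ) j) * S f (toRow (v - Pi.single i 1))) =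
      (∏ j, q j ^ v j) * (S f (toRow (v + Pi.single i 1)) + S f (toRow (v - Pi.single i 1))) := by
    intro v i
    have hi := (hq i).ne'
    have e6 : v - Pi.single i 1 = v + Pi.single i (-1) := by
      rw [Pi.single_neg, sub_eq_add_neg]
    rw [e6, prod_zpow_add_single hq, prod_zpow_add_single hq, zpow_one, zpow_neg_one]
    field_simp
  rw [Finset.sum_congr rfl fun i _ => e5 x i, ← Finset.mul_sum]
  field_simp
  ring

theorem patGen_one (q : ℕ → ℝ) (n : ℕ) : patGen q n 1 = 0 := by
  induction n with
  | zero => rfl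
  | succ n ih =>
    ext x
    rcases x with _ | ⟨x, z⟩
    rw [patGen_succ]
    have : (fun x' : Pat n => (1 : Pat (n + 1) → ℝ) (x'.snoc (clamp z x'.bot))) = 1 := rfl
    rw [this, ih]
    simp

theorem tsum_abs_doobQ_le {q : Fin k → ℝ} (hq : ∀ i, 0 < q i)
    (hSp : ∀ z ∈ chamber k, sympSchur q z = patSum (extendRate q) (2 * k) 1 (toRow z))
    (x : chamber k) : ∑' y, |doobQ (walkQ q) (harmonicH q) (chamber k) x y| ≤
      2 * |∑ i, (q i + (q i)⁻¹)| := by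
  have hpos : ∀ y : chamber k, 0 < harmonicH q y := fun y => by
    rw [harmonicH, hSp y y.2]
    exact mul_pos (Finset.prod_pos fun i _ => zpow_pos (hq i) _) (patSum_toRow_pos hq y.2)
  have h1 := tsum_abs_row_le (finite_support_doobQ q (harmonicH q)) (fun x y h => by
    have : (y : Fin k → ℤ) ≠ x := fun h' => h (Subtype.ext h')
    exact mul_nonneg (mul_nonneg (inv_pos.2 (hpos x)).le (walkQ_nonneg hq this)) (hpos y).le)
    -- Zero row sums, which express the harmonicity of `h`, are the intertwining applied to the
    -- constant function.
    (fun x => by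
      have h2 := tsum_doobQ_mul_patAvg hq hSp 1 x
      have h3 : ∀ y : chamber k, patAvg q 1 y = 1 := fun y =>
        div_self (patSum_toRow_pos hq y.2).ne'
      rw [patGen_one, map_zero] at h2
      simpa only [h3, mul_one, Pi.zero_apply] using h2) x
  have h4 : doobQ (walkQ q) (harmonicH q) (chamber k) x x = -∑ i, (q i + (q i)⁻¹) := by
    rw [doobQ, walkQ_self]
    have := (hpos x).ne'
    field_simp
  rwa [h4, abs_neg] at h1

end Chamber
end

noncomputable section

/-! ### Symplectic Schur functions as sums over patterns -/

section FinsumLemmas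

variable {α β : Type*}

theorem finsum_eq_finsum_comp {f : α → ℝ} {g : β → α} (hg : Function.Injective g)
    (h : Function.support f ⊆ Set.range g) : ∑ᶠ a, f a = ∑ᶠ b, f (g b) := by
  rw [← finsum_mem_range hg, finsum_mem_def, Set.indicator_eq_self.2 h]

theorem finsum_comm_of_finite {f : α → β → ℝ}
    (hf : (Function.support fun p : α × β => f p.1 p.2).Finite) :
    ∑ᶠ a, ∑ᶠ b, f a b = ∑ᶠ b, ∑ᶠ a, f a b := by
  have h1 := finsum_curry (fun p : α × β => f p.1 p.2) hf
  have h2 : (Function.support fun p : β × α => f p.2 p.1).Finite := by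
    refine (hf.preimage (f := Prod.swap) Prod.swap_injective.injOn).subset fun p hp => hp
  have h3 := finsum_curry (fun p : β × α => f p.2 p.1) h2
  rw [← h1, ← h3]
  exact (finsum_comp_equiv (Equiv.prodComm β α) (f := fun p : α × β => f p.1 p.2)).symm

open Classical in
theorem finsum_fiberwise {f : α → ℝ} (g : α → β) (hf : (Function.support f).Finite) :
    ∑ᶠ a, f a = ∑ᶠ b, ∑ᶠ a, if g a = b then f a else 0 := by
  rw [← finsum_comm_of_finite]
  · refine finsum_congr fun a => ?_
    rw [finsum_eq_single _ (g a) fun b hb => if_neg hb.symm, if_pos rfl]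
  · refine (hf.image fun a => (a, g a)).subset ?_
    rintro ⟨a, b⟩ hab
    simp only [Function.mem_support, ne_eq, ite_eq_right_iff, Classical.not_imp] at hab
    exact ⟨a, hab.2, Prod.ext rfl hab.1⟩

end FinsumLemmas

theorem toRow_injective (k : ℕ) : Function.Injective (toRow : (Fin k → ℤ) → ℕ → ℤ) := by
  intro y z h
  ext i
  have := congrFun h (Fin.rev i)
  rwa [toRow, toRow, dif_pos (Fin.rev i).isLt, dif_pos (Fin.rev i).isLt, Fin.eta, Fin.rev_rev] at this

theorem mem_range_toRow {k : ℕ} {u : ℕ → ℤ} (hu : ∀ j, k ≤ j → u j = 0) :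
    u ∈ Set.range (toRow : (Fin k → ℤ) → ℕ → ℤ) := by
  refine ⟨fun i => u (Fin.rev i), ?_⟩
  ext j
  unfold toRow
  split_ifs with h
  · simp
  · exact (hu j (not_lt.1 h)).symm

theorem sum_toRow {k : ℕ} (z : Fin k → ℤ) : ∑ j ∈ Finset.range k, toRow z j = ∑ i, z i := by
  rw [Finset.sum_range, ← Equiv.sum_comp (Fin.revPerm : Equiv.Perm (Fin k)) z]
  refine Finset.sum_congr rfl fun i _ => ?_
  rw [toRow, dif_pos i.isLt]
  rfl

/-- Reversal turns increasing tuples into decreasing sequences; the last comparison, with the zero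
padding, is the condition `0 ≤ o 0`. -/
theorem interlace_toRow_iff {k : ℕ} {o z : Fin (k + 1) → ℤ} :
    Interlace (toRow o) (toRow z) ↔
      (∀ j, o j ≤ z j) ∧ (∀ j : Fin k, z j.castSucc ≤ o j.succ) ∧ 0 ≤ o 0 := by
  constructor
  · intro h
    refine ⟨fun j => ?_, fun j => ?_, ?_⟩
    · have := (h (Fin.rev j)).2
      rwa [toRow, toRow, dif_pos (Fin.rev j).isLt, dif_pos (Fin.rev j).isLt, Fin.eta,
        Fin.rev_rev] at this
    · have := (h (Fin.rev j.succ)).1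
      rw [toRow, toRow, dif_pos (Fin.rev j.succ).isLt, Fin.eta, Fin.rev_rev,
        dif_pos (by simp only [Fin.val_rev, Fin.val_succ]; omega)] at this
      convert this using 2
      ext
      simp only [Fin.val_rev, Fin.val_succ, Fin.val_castSucc]
      omega
    · have := (h k).1
      rw [toRow, toRow, dif_neg (by omega), dif_pos (by omega)] at this
      convert this using 2
      ext
      simp
  · rintro ⟨h1, h2, h3⟩ j
    unfold toRow
    by_cases hj : j < k
    · rw [dif_pos (by omega), dif_pos (by omega), dif_pos (by omega)]
      refine ⟨?_, h1 _⟩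
      have := h2 (Fin.rev ⟨j, hj⟩)
      convert this using 2
      · ext
        simp only [Fin.val_rev, Fin.val_castSucc]
        omega
      · ext
        simp only [Fin.val_rev, Fin.val_succ]
        omega
    · rw [dif_neg (by omega)]
      by_cases hj' : j < k + 1
      · rw [dif_pos hj', dif_pos hj']
        refine ⟨?_, h1 _⟩
        convert h3 using 2
        ext
        simp only [Fin.val_rev, Fin.val_zero]
        omega
      · simp [hj']

theorem interlace_toRow_succ_iff {k : ℕ} {b : Fin k → ℤ} {o : Fin (k + 1) → ℤ} :
    Interlace (toRow b) (toRow o) ↔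
      (∀ j : Fin k, o j.castSucc ≤ b j) ∧ (∀ j : Fin k, b j ≤ o j.succ) ∧ 0 ≤ o 0 := by
  constructor
  · intro h
    refine ⟨fun j => ?_, fun j => ?_, ?_⟩
    · have := (h (Fin.rev j)).1
      rw [toRow, toRow, dif_pos (Fin.rev j).isLt, Fin.eta, Fin.rev_rev,
        dif_pos (by have := (Fin.rev j).isLt; omega)] at this
      convert this using 2
      ext
      simp only [Fin.val_rev, Fin.val_castSucc]
      omega
    · have := (h (Fin.rev j)).2
      rw [toRow, toRow, dif_pos (Fin.rev j).isLt, Fin.eta, Fin.rev_rev,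
        dif_pos (by have := (Fin.rev j).isLt; omega)] at this
      convert this using 2
      ext
      simp only [Fin.val_rev, Fin.val_succ]
      omega
    · have := (h k).2
      rw [toRow, toRow, dif_neg (by omega), dif_pos (by omega)] at this
      convert this using 2
      ext
      simp
  · rintro ⟨h1, h2, h3⟩ j
    unfold toRow
    by_cases hj : j < k
    · rw [dif_pos (by omega), dif_pos (by omega), dif_pos (by omega)]
      constructor
      · convert h1 (Fin.rev ⟨j, hj⟩) using 2
        ext
        simp only [Fin.val_rev, Fin.val_castSucc]
        omega
      · convert h2 (Fin.rev ⟨j, hj⟩) using 2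
        ext
        simp only [Fin.val_rev, Fin.val_succ]
        omega
    · rw [dif_neg (by omega), dif_neg hj]
      refine ⟨le_rfl, ?_⟩
      by_cases hj' : j < k + 1
      · rw [dif_pos hj']
        convert h3 using 2
        ext
        simp only [Fin.val_rev, Fin.val_zero]
        omega
      · simp [hj']

/-! ### Symplectic arrays built two rows at a time -/

namespace SympArray

variable {k : ℕ}

/-- The last row of a symplectic array, which is empty if the array is empty. -/
def bottom : {k : ℕ} → SympArray k → Fin k → ℤ
  | 0, _ => Fin.elim0
  | m + 1, x => x.even (Fin.last m)

theorem hasBottomRow_iff (x : SympArray k) (z : Fin k → ℤ) : x.HasBottomRow z ↔ x.bottom = z := by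
  cases k with
  | zero =>
    refine ⟨fun _ => Subsingleton.elim _ _, fun _ i => i.elim0⟩
  | succ m =>
    constructor
    · intro h
      ext j
      exact h (Fin.last m) rfl j
    · rintro rfl i hi j
      obtain rfl : i = Fin.last m := Fin.ext (by simpa using hi)
      rfl

/-- The symplectic array obtained by adding two rows. -/
def snoc (x : SympArray k) (o e : Fin (k + 1) → ℤ) : SympArray (k + 1) where
  odd i j := if h : (i : ℕ) < k then x.odd ⟨i, h⟩ j else o ⟨j, j.isLt.trans_le i.isLt⟩
  even i j := if h : (i : ℕ) < k then x.even ⟨i, h⟩ j else e ⟨j, j.isLt.trans_le i.isLt⟩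

theorem snoc_bottom (x : SympArray k) (o e : Fin (k + 1) → ℤ) : (x.snoc o e).bottom = e := by
  ext j
  simp [bottom, snoc]

theorem exists_eq_snoc (x : SympArray (k + 1)) : ∃ y : SympArray k,
    x = y.snoc (x.odd (Fin.last k)) (x.even (Fin.last k)) := by
  refine ⟨⟨fun i => x.odd i.castSucc, fun i => x.even i.castSucc⟩, ?_⟩
  have h : ∀ i : Fin (k + 1), ¬ (i : ℕ) < k → i = Fin.last k := fun i hi =>
    Fin.ext (by have := i.isLt; simp only [Fin.val_last]; omega)
  cases x with
  | mk odd even =>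
    simp only [snoc, SympArray.mk.injEq]
    constructor
    · ext i j
      split_ifs with hi
      · rfl
      · obtain rfl := h i hi
        rfl
    · ext i j
      split_ifs with hi
      · rfl
      · obtain rfl := h i hi
        rfl

theorem snoc_injective (z : Fin (k + 1) → ℤ) :
    Function.Injective fun p : SympArray k × (Fin (k + 1) → ℤ) => p.1.snoc p.2 z := by
  rintro ⟨⟨odd, even⟩, o⟩ ⟨⟨odd', even'⟩, o'⟩ h
  simp only [snoc, SympArray.mk.injEq] at h
  obtain ⟨h1, h2⟩ := h
  have e1 : odd = odd' := by
    ext i j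
    have := congrFun (congrFun h1 i.castSucc) j
    simpa using this
  have e2 : even = even' := by
    ext i j
    have := congrFun (congrFun h2 i.castSucc) j
    simpa using this
  have e3 : o = o' := by
    ext j
    have := congrFun (congrFun h1 (Fin.last k)) j
    simpa using this
  rw [e1, e2, e3]

/-- Interlacing of zero-padded rows already contains non-negativity, so the two relations account
for all conditions on the new rows. -/
theorem isPattern_snoc_iff (x : SympArray k) (o z : Fin (k + 1) → ℤ) :
    (x.snoc o z).IsPattern ↔ x.IsPattern ∧ Interlace (toRow x.bottom) (toRow o) ∧
      Interlace (toRow o) (toRow z) := by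
  constructor
  · intro h
    refine ⟨⟨fun i j => ?_, fun i j => ?_, fun i j => ?_, fun i j => ?_, fun i hi j => ?_,
      fun i hi j => ?_⟩, ?_, ?_⟩
    · simpa [snoc] using h.odd_nonneg i.castSucc j
    · simpa [snoc] using h.even_nonneg i.castSucc j
    · simpa [snoc] using h.odd_le_even i.castSucc j
    · simpa [snoc] using h.even_le_odd_next i.castSucc j
    · simpa [snoc, hi, Nat.lt_of_succ_lt hi] using h.odd_le_even_prev i (hi.trans (Nat.lt_succ_self k)) j
    · simpa [snoc, hi, Nat.lt_of_succ_lt hi] using h.even_prev_le_odd i (hi.trans (Nat.lt_succ_self k)) j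
    · rw [interlace_toRow_succ_iff]
      refine ⟨fun j => ?_, fun j => ?_, by simpa [snoc] using h.odd_nonneg (Fin.last k) 0⟩
      · cases k with
        | zero => exact j.elim0
        | succ m =>
          have := h.odd_le_even_prev m (by omega) j
          simp [snoc] at this
          exact this
      · cases k with
        | zero => exact j.elim0
        | succ m =>
          have := h.even_prev_le_odd m (by omega) j
          simp [snoc] at this
          exact this
    · rw [interlace_toRow_iff]
      refine ⟨fun j => ?_, fun j => ?_, by simpa [snoc] using h.odd_nonneg (Fin.last k) 0⟩
      · simpa [snoc] using h.odd_le_even (Fin.last k) j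
      · have := h.even_le_odd_next (Fin.last k) j
        simp [snoc] at this
        exact this
  · rintro ⟨hx, h1, h2⟩
    have ho : o ∈ chamber (k + 1) := isRow_toRow_iff.1 (h2.isRow fun j hj => by
      simp [toRow, not_lt.2 hj])
    have hz : z ∈ chamber (k + 1) := isRow_toRow_iff.1 (h2.isRow_right fun j hj => by
      simp [toRow, not_lt.2 hj])
    rw [interlace_toRow_succ_iff] at h1
    rw [interlace_toRow_iff] at h2
    have hik : ∀ i : Fin (k + 1), ¬ (i : ℕ) < k → i = Fin.last k := fun i hi =>
      Fin.ext (by have := i.isLt; simp only [Fin.val_last]; omega)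
    refine ⟨fun i j => ?_, fun i j => ?_, fun i j => ?_, fun i j => ?_, fun i hi j => ?_,
      fun i hi j => ?_⟩
    · simp only [snoc]
      split_ifs with h
      · exact hx.odd_nonneg _ _
      · exact ho.2 _
    · simp only [snoc]
      split_ifs with h
      · exact hx.even_nonneg _ _
      · exact hz.2 _
    · simp only [snoc]
      split_ifs with h
      · exact hx.odd_le_even _ _
      · exact h2.1 _
    · simp only [snoc]
      split_ifs with h
      · exact hx.even_le_odd_next ⟨i, h⟩ j
      · obtain rfl := hik i h
        exact h2.2.1 j
    · simp only [snoc]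
      by_cases h : i + 1 < k
      · simpa [h, Nat.lt_of_succ_lt h] using hx.odd_le_even_prev i h j
      · obtain rfl : k = i + 1 := by omega
        rw [dif_neg (lt_irrefl _), dif_pos (Nat.lt_succ_self i)]
        exact h1.1 j
    · simp only [snoc]
      by_cases h : i + 1 < k
      · simpa [h, Nat.lt_of_succ_lt h] using hx.even_prev_le_odd i h j
      · obtain rfl : k = i + 1 := by omega
        rw [dif_neg (lt_irrefl _), dif_pos (Nat.lt_succ_self i)]
        exact h1.2.1 j

theorem weight_snoc (q : ℕ → ℝ) (x : SympArray k) (o z : Fin (k + 1) → ℤ) :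
    (x.snoc o z).weight (fun i : Fin (k + 1) => q i) = x.weight (fun i : Fin k => q i) *
      q k ^ (2 * ∑ j, o j - ∑ j, x.bottom j - ∑ j, z j) := by
  rw [weight, Fin.prod_univ_castSucc]
  congr 1
  · refine Finset.prod_congr rfl fun i _ => ?_
    have hi : ∀ j : Fin k, (j.castSucc : ℕ) < k := fun j => j.isLt
    have e1 : (x.snoc o z).prevSum i.castSucc = x.prevSum i := by
      unfold prevSum
      by_cases h : 0 < (i : ℕ)
      · have h' : (i : ℕ) - 1 < k := by omega
        simp [h, snoc, h']
      · simp [h]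
    rw [e1]
    simp [snoc]
  · have e1 : (x.snoc o z).prevSum (Fin.last k) = ∑ j, x.bottom j := by
      unfold prevSum
      cases k with
      | zero => simp
      | succ m => simp [snoc, bottom]; rfl
    rw [e1]
    have e2 : ∀ j, (x.snoc o z).odd (Fin.last k) j = o j := fun j => by simp [snoc]
    have e3 : ∀ j, (x.snoc o z).even (Fin.last k) j = z j := fun j => by simp [snoc]
    simp only [e2, e3]
    congr 1
    change ∑ j, o j - ∑ j, x.bottom j + ∑ j, o j - ∑ j, z j = _
    ring

end SympArray
end

noncomputable section

/-! ### Reflection of the row between two fixed rows -/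

open Classical in
/-- The sum over the middle row `o` of the geometric weights, for given outer rows `e` and `z`. -/
def twoRowSum (d : ℕ) (a : ℝ) (e z : ℕ → ℤ) : ℝ :=
  ∑ᶠ o, if Interlace e o ∧ Interlace o z then
    a ^ (2 * ∑ j ∈ Finset.range d, o j - ∑ j ∈ Finset.range d, e j - ∑ j ∈ Finset.range d, z j) else 0

open Classical in
-- For fixed `e` and `z` each entry of the middle row ranges over its own interval. Reflecting all
-- intervals preserves both interlacings and replaces `|o|` by `|e| + |z| - |o|`, which negates the
-- exponent `|e| + |z| - 2 |o|`.
theorem finsum_stripWeight_mul_stripWeight {d : ℕ} {a : ℝ} (ha : a ≠ 0) {e z : ℕ → ℤ}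
    (he : e d = 0) (hz : z (d + 1) = 0) :
    ∑ᶠ o, stripWeight (d + 1) a o z * stripWeight (d + 1) a⁻¹ e o = twoRowSum (d + 1) a e z := by
  -- `s j` is the sum of the two endpoints of the interval for `o j`, except that `o 0` has only `z
  -- 0` as upper bound. In the total, each maximum pairs with the minimum of the same two numbers,
  -- leaving `|e| + |z|`.
  set s : ℕ → ℤ := fun j => max (e j) (z (j + 1)) +
    (match j with | 0 => z 0 | i + 1 => min (z (i + 1)) (e i)) with hs
  have hsum : ∑ j ∈ Finset.range (d + 1), s j =
      ∑ j ∈ Finset.range (d + 1), e j + ∑ j ∈ Finset.range (d + 1), z j := by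
    simp only [hs, Finset.sum_add_distrib]
    rw [Finset.sum_range_succ, Finset.sum_range_succ', Finset.sum_range_succ e,
      Finset.sum_range_succ' z, he, hz]
    have : ∑ j ∈ Finset.range d, max (e j) (z (j + 1)) + ∑ j ∈ Finset.range d, min (z (j + 1)) (e j) =
        ∑ j ∈ Finset.range d, e j + ∑ j ∈ Finset.range d, z (j + 1) := by
      rw [← Finset.sum_add_distrib, ← Finset.sum_add_distrib]
      exact Finset.sum_congr rfl fun j _ => by rw [min_comm, max_add_min]
    simp only [max_self]
    linarith
  have hiff : ∀ o, Interlace e o ∧ Interlace o z →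
      Interlace e (s - o) ∧ Interlace (s - o) z := by
    rintro o ⟨h1, h2⟩
    simp only [Interlace, Pi.sub_apply] at *
    have : ∀ j, e j ≤ (s - o) j ∧ z (j + 1) ≤ (s - o) j ∧ (s - o) (j + 1) ≤ e j ∧ (s - o) j ≤ z j := by
      intro j
      rcases j with _ | j
      · have := h1 0; have := h2 0; have := h1 1; have := h2 1
        simp only [hs, Pi.sub_apply]
        grind
      · have := h1 j; have := h2 j; have := h1 (j + 1); have := h2 (j + 1)
        have := h2 (j + 1 + 1)
        simp only [hs, Pi.sub_apply]
        grind
    exact ⟨fun j => ⟨(this j).2.2.1, (this j).1⟩, fun j => ⟨(this j).2.1, (this j).2.2.2⟩⟩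
  have hiff' : ∀ o, Interlace e (s - o) ∧ Interlace (s - o) z ↔ Interlace e o ∧ Interlace o z :=
    fun o => ⟨fun h => by simpa using hiff _ h, hiff o⟩
  rw [twoRowSum, ← finsum_comp_equiv (Equiv.subLeft s)]
  refine finsum_congr fun o => ?_
  simp only [Equiv.subLeft_apply]
  rw [← if_congr (hiff' o) rfl rfl]
  unfold stripWeight
  by_cases h1 : Interlace (s - o) z <;> by_cases h2 : Interlace e (s - o) <;> simp only [h1, h2, and_true,
    and_false, if_true, if_false, mul_zero, zero_mul]
  rw [inv_zpow, ← zpow_neg, ← zpow_add₀ ha]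
  simp only [Pi.sub_apply, Finset.sum_sub_distrib, hsum]
  congr 1
  ring

theorem finite_setOf_interlace_interlace {d : ℕ} {z : ℕ → ℤ} (hz : ∀ j, d ≤ j → z j = 0) :
    {p : (ℕ → ℤ) × (ℕ → ℤ) | Interlace p.2 p.1 ∧ Interlace p.1 z}.Finite := by
  refine ((finite_interlace hz).biUnion fun o ho =>
    ((finite_interlace (d := d) (z := o) fun j hj => ?_).image fun e => (o, e))).subset ?_
  · have := ho j
    have := hz j hj
    have := hz (j + 1) (by omega)
    omega
  · rintro ⟨o, e⟩ ⟨h1, h2⟩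
    exact Set.mem_biUnion (x := o) h2 ⟨e, h1, rfl⟩

/-- The two new rows carry the parameters `(q k)⁻¹` and `q k`, so summing out the odd one produces a
product of strip weights to which the reflection applies. -/
theorem patSum_two_mul_succ {q : ℕ → ℝ} (hq : ∀ i, 0 < q i) (k : ℕ) {z : ℕ → ℤ}
    (hz : ∀ j, k + 1 ≤ j → z j = 0) : patSum q (2 * (k + 1)) 1 z =
      ∑ᶠ e, patSum q (2 * k) 1 e * twoRowSum (k + 1) (q k) e z := by
  have r1 : rowRate q (2 * k + 1) = q k := by
    unfold rowRate
    rw [if_neg (by omega)]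
    congr 1
    omega
  have r0 : rowRate q (2 * k) = (q k)⁻¹ := by
    unfold rowRate
    rw [if_pos (by omega)]
    congr 2
    omega
  have l2 : rowLen (2 * k + 1 + 1) = k + 1 := by unfold rowLen; omega
  have l1 : rowLen (2 * k + 1) = k + 1 := by unfold rowLen; omega
  have l0 : rowLen (2 * k) = k := by unfold rowLen; omega
  have hfin := finite_setOf_interlace_interlace hz
  have h1 : ∀ o, stripWeight (k + 1) (q k) o z * patSum q (2 * k + 1) 1 o =
      ∑ᶠ e, patSum q (2 * k) 1 e * (stripWeight (k + 1) (q k) o z *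
        stripWeight (k + 1) (q k)⁻¹ e o) := by
    intro o
    by_cases ho : Interlace o z
    · have ho' : ∀ j, k + 1 ≤ j → o j = 0 := fun j hj => by
        have := ho j
        have := hz j hj
        have := hz (j + 1) (by omega)
        omega
      rw [patSum_succ q (by rwa [l1]), l1, r0, ← smul_eq_mul, smul_finsum]
      refine finsum_congr fun e => ?_
      change _ * (_ * patSum q (2 * k) 1 e) = _
      ring
    · simp [stripWeight, ho]
  change patSum q (2 * k + 1 + 1) 1 z = _
  rw [patSum_succ q (by rwa [l2]), l2, r1]
  change ∑ᶠ o, stripWeight (k + 1) (q k) o z * patSum q (2 * k + 1) 1 o = _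
  rw [finsum_congr h1, finsum_comm_of_finite]
  · refine finsum_congr fun e => ?_
    by_cases he : IsRow (rowLen (2 * k)) e
    · rw [← finsum_stripWeight_mul_stripWeight (hq k).ne' (he.zero k l0.le) (hz _ le_rfl)]
      exact (smul_finsum (patSum q (2 * k) 1 e) _).symm
    · simp [patSum_eq_zero he]
  · refine hfin.subset fun p hp => ?_
    by_contra h
    refine hp ?_
    simp only [Set.mem_setOf_eq, not_and_or] at h
    rcases h with h | h <;> simp [stripWeight, h]

namespace SympArray

variable {k : ℕ}

theorem finite_isPattern (k : ℕ) (z : Fin k → ℤ) :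
    {x : SympArray k | x.IsPattern ∧ x.HasBottomRow z}.Finite := by
  induction k with
  | zero =>
    have : Subsingleton (SympArray 0) := ⟨by
      rintro ⟨a, b⟩ ⟨c, d⟩
      rw [Subsingleton.elim a c, Subsingleton.elim b d]⟩
    exact Set.toFinite _
  | succ k ih =>
    refine (((Set.finite_Icc (0 : Fin (k + 1) → ℤ) z).biUnion fun o _ =>
      ((Set.finite_Icc (0 : Fin k → ℤ) (fun j => o j.succ)).biUnion fun b _ =>
        (ih b).image fun x => x.snoc o z))).subset ?_
    rintro x ⟨hx, hb⟩
    obtain ⟨y, o, rfl⟩ : ∃ (y : SympArray k) (o : Fin (k + 1) → ℤ), x = y.snoc o z := by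
      obtain ⟨y, hy⟩ := exists_eq_snoc x
      rw [hasBottomRow_iff] at hb
      subst hb
      exact ⟨y, _, hy⟩
    obtain ⟨h1, h2, h3⟩ := (isPattern_snoc_iff _ _ _).1 hx
    have ho : o ∈ chamber (k + 1) := isRow_toRow_iff.1 (h3.isRow fun j hj => by
      simp [toRow, not_lt.2 hj])
    have hy : y.bottom ∈ chamber k := isRow_toRow_iff.1 (h2.isRow fun j hj => by
      simp [toRow, not_lt.2 hj])
    refine Set.mem_biUnion (x := o) ⟨ho.2, (interlace_toRow_iff.1 h3).1⟩
      (Set.mem_biUnion (x := y.bottom) ⟨hy.2, (interlace_toRow_succ_iff.1 h2).2.1⟩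
        ⟨y, ⟨h1, (hasBottomRow_iff _ _).2 rfl⟩, rfl⟩)

end SympArray

theorem twoRowSum_toRow {k : ℕ} (a : ℝ) (e : Fin k → ℤ) (z : Fin (k + 1) → ℤ) :
    twoRowSum (k + 1) a (toRow e) (toRow z) = ∑ᶠ o : Fin (k + 1) → ℤ, open Classical in
      if Interlace (toRow e) (toRow o) ∧ Interlace (toRow o) (toRow z) then
        a ^ (2 * ∑ j, o j - ∑ j, e j - ∑ j, z j) else 0 := by
  have he : ∑ j ∈ Finset.range (k + 1), toRow e j = ∑ j, e j := by
    rw [Finset.sum_range_succ, sum_toRow]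
    simp [toRow]
  rw [twoRowSum, finsum_eq_finsum_comp (toRow_injective (k + 1))]
  · simp only [sum_toRow, he]
  · intro o ho
    refine mem_range_toRow fun j hj => ?_
    have : Interlace o (toRow z) := by
      by_contra h
      exact ho (by simp [h])
    have h := this j
    simp only [toRow, not_lt.2 hj, not_lt.2 (hj.trans (Nat.le_succ j)), dif_neg, not_false_iff] at h
    omega

open Classical in
theorem sympSchur_eq_finsum {k : ℕ} (q : Fin k → ℝ) (z : Fin k → ℤ) :
    sympSchur q z = ∑ᶠ x : SympArray k, if x.bottom = z then (if x.IsPattern then x.weight q else 0) else 0 := by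
  unfold sympSchur
  refine finsum_congr fun x => ?_
  rw [finsum_eq_if]
  simp only [Set.mem_setOf_eq, SympArray.hasBottomRow_iff]
  by_cases h1 : x.IsPattern <;> by_cases h2 : x.bottom = z <;> simp [h1, h2]

open Classical in
-- Branching rule: a pattern is sorted by the bottom row of its first `2k` rows, and the weight
-- factors there.
theorem sympSchur_succ (q : ℕ → ℝ) {k : ℕ} (z : Fin (k + 1) → ℤ) :
    sympSchur (fun i : Fin (k + 1) => q i) z = ∑ᶠ e : Fin k → ℤ,
      sympSchur (fun i : Fin k => q i) e * twoRowSum (k + 1) (q k) (toRow e) (toRow z) := by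
  have hf : (Function.support fun x : SympArray (k + 1) => if x.bottom = z then
      (if x.IsPattern then x.weight (fun i : Fin (k + 1) => q i) else 0) else 0).Finite := by
    refine (SympArray.finite_isPattern (k + 1) z).subset fun x hx => ?_
    rw [Set.mem_setOf_eq, SympArray.hasBottomRow_iff]
    by_contra h
    refine hx ?_
    rw [not_and_or] at h
    rcases h with h | h <;> simp [h]
  have hr : (Function.support fun x : SympArray (k + 1) => if x.bottom = z then
      (if x.IsPattern then x.weight (fun i : Fin (k + 1) => q i) else 0) else 0) ⊆
      Set.range fun p : SympArray k × (Fin (k + 1) → ℤ) => p.1.snoc p.2 z := by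
    intro x hx
    have hb : x.bottom = z := by
      by_contra h
      exact hx (by simp [h])
    obtain ⟨y, hy⟩ := x.exists_eq_snoc
    exact ⟨(y, x.odd (Fin.last k)), by subst hb; exact hy.symm⟩
  set F : SympArray k × (Fin (k + 1) → ℤ) → ℝ := fun p =>
    if (p.1.snoc p.2 z).bottom = z then
      (if (p.1.snoc p.2 z).IsPattern then (p.1.snoc p.2 z).weight (fun i : Fin (k + 1) => q i) else 0)
      else 0 with hF
  have hFfin : (Function.support F).Finite :=
    hf.preimage (f := fun p : SympArray k × (Fin (k + 1) → ℤ) => p.1.snoc p.2 z)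
      (SympArray.snoc_injective z).injOn
  have hFeq : ∀ x : SympArray k, ∑ᶠ o, F (x, o) =
      (if x.IsPattern then x.weight (fun i : Fin k => q i) else 0) *
        twoRowSum (k + 1) (q k) (toRow x.bottom) (toRow z) := by
    intro x
    rw [twoRowSum_toRow, ← smul_eq_mul, smul_finsum]
    refine finsum_congr fun o => ?_
    simp only [hF, SympArray.snoc_bottom, if_true, SympArray.isPattern_snoc_iff,
      SympArray.weight_snoc, smul_eq_mul]
    by_cases h1 : x.IsPattern <;>
      by_cases h2 : Interlace (toRow x.bottom) (toRow o) ∧ Interlace (toRow o) (toRow z) <;>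
      simp [h1, h2]
  rw [sympSchur_eq_finsum, finsum_eq_finsum_comp (SympArray.snoc_injective z) hr]
  change ∑ᶠ p, F p = _
  rw [finsum_curry F hFfin, finsum_fiberwise SympArray.bottom]
  · refine finsum_congr fun e => ?_
    rw [sympSchur_eq_finsum, mul_comm, ← smul_eq_mul, smul_finsum]
    refine finsum_congr fun x => ?_
    rw [hFeq]
    split_ifs with h1 h2
    · rw [h1, smul_eq_mul, mul_comm]
    · simp
    · simp
  · refine (hFfin.image Prod.fst).subset fun x hx => ?_
    by_contra h
    refine hx (finsum_eq_zero_of_forall_eq_zero fun o => ?_)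
    by_contra h'
    exact h ⟨(x, o), h', rfl⟩

/-- Both sides obey the same two-row recursion, and the empty array has weight one. -/
theorem sympSchur_eq_patSum {q : ℕ → ℝ} (hq : ∀ i, 0 < q i) (k : ℕ) (z : Fin k → ℤ) :
    sympSchur (fun i : Fin k => q i) z = patSum q (2 * k) 1 (toRow z) := by
  induction k with
  | zero =>
    have e1 : toRow z = 0 := by
      ext j
      simp [toRow]
    rw [e1, patSum_apply_zero, sympSchur_eq_finsum]
    have hs : Subsingleton (SympArray 0) := ⟨by
      rintro ⟨a, b⟩ ⟨c, d⟩
      rw [Subsingleton.elim a c, Subsingleton.elim b d]⟩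
    have hp : ∀ x : SympArray 0, x.IsPattern := fun x => ⟨fun i => i.elim0, fun i => i.elim0,
      fun i => i.elim0, fun i => i.elim0, fun i hi => by omega, fun i hi => by omega⟩
    rw [finsum_eq_single _ (⟨fun i => i.elim0, fun i => i.elim0⟩ : SympArray 0)
      fun x hx => (hx (Subsingleton.elim _ _)).elim]
    rw [if_pos (Subsingleton.elim _ _), if_pos (hp _)]
    simp [SympArray.weight]
  | succ k ih =>
    rw [sympSchur_succ, patSum_two_mul_succ hq k (fun j hj => by simp [toRow, not_lt.2 hj])]
    rw [finsum_eq_finsum_comp (f := fun e => patSum q (2 * k) 1 e * _) (toRow_injective k)]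
    · exact finsum_congr fun e => by rw [ih]
    · intro e he
      refine mem_range_toRow fun j hj => ?_
      have : IsRow (rowLen (2 * k)) e := by
        by_contra h
        exact he (by simp [patSum_eq_zero h])
      exact this.zero j (by rwa [rowLen_two_mul])

theorem sympSchur_eq_patSum_extendRate {k : ℕ} {q : Fin k → ℝ} (hq : ∀ i, 0 < q i)
    (z : Fin k → ℤ) : sympSchur q z = patSum (extendRate q) (2 * k) 1 (toRow z) := by
  rw [← sympSchur_eq_patSum (extendRate_pos hq)]
  congr
  ext i
  simp [extendRate]

end

noncomputable section

/-! ### The path functional -/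

/-- The sums `∑ i, (Y (τ (i + 1)) i - Y (τ i) i)` over the chains `τ` that end in `t`. -/
def chainSums {T : Type*} [Preorder T] {n : ℕ} (Y : T → Fin n → ℤ) (t : T) : Set ℤ :=
  {s | ∃ τ : Fin (n + 1) → T, Monotone τ ∧ τ (Fin.last n) = t ∧
    s = ∑ i : Fin n, (Y (τ i.succ) i - Y (τ i.castSucc) i)}

section ChainSums

variable {T T' : Type*} [Preorder T] [Preorder T'] {n : ℕ}

theorem zero_mem_chainSums (Y : T → Fin n → ℤ) (t : T) : 0 ∈ chainSums Y t :=
  ⟨fun _ => t, monotone_const, rfl, by simp⟩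

theorem chainSums_comp_subset {φ : T' → T} (hφ : Monotone φ) (Y : T → Fin n → ℤ) (t : T') :
    chainSums (fun s => Y (φ s)) t ⊆ chainSums Y (φ t) := by
  rintro s ⟨τ, h1, h2, h3⟩
  exact ⟨fun i => φ (τ i), hφ.comp h1, congrArg φ h2, h3⟩

/-- Splitting at the last interior time gives the recursion in the number of components. -/
theorem mem_chainSums_succ_iff {Y : T → Fin (n + 1) → ℤ} {t : T} {s : ℤ} :
    s ∈ chainSums Y t ↔ ∃ r ≤ t, ∃ s' ∈ chainSums (fun r => Fin.init (Y r) : T → Fin n → ℤ) r,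
      s = s' + (Y t (Fin.last n) - Y r (Fin.last n)) := by
  constructor
  · rintro ⟨τ, h1, h2, h3⟩
    refine ⟨τ (Fin.last n).castSucc, ?_, _, ⟨fun i => τ i.castSucc,
      h1.comp Fin.strictMono_castSucc.monotone, rfl, rfl⟩, ?_⟩
    · rw [← h2]
      exact h1 (Fin.le_last _)
    · rw [h3, Fin.sum_univ_castSucc, Fin.succ_last, h2]
      rfl
  · rintro ⟨r, hr, s', ⟨τ, h1, h2, h3⟩, rfl⟩
    refine ⟨Fin.snoc (α := fun _ => T) τ t, ?_, by simp, ?_⟩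
    · intro i j hij
      induction j using Fin.lastCases with
      | last =>
        rw [Fin.snoc_last]
        induction i using Fin.lastCases with
        | last => rw [Fin.snoc_last]
        | cast i =>
          rw [Fin.snoc_castSucc]
          exact (h1 (Fin.le_last i)).trans (h2.le.trans hr)
      | cast j =>
        induction i using Fin.lastCases with
        | last => exact absurd hij (not_le.2 (Fin.castSucc_lt_last j))
        | cast i =>
          rw [Fin.snoc_castSucc, Fin.snoc_castSucc]
          exact h1 hij
    · rw [h3, Fin.sum_univ_castSucc]
      congr 1
      · refine Finset.sum_congr rfl fun i _ => ?_
        rw [← Fin.castSucc_succ, Fin.snoc_castSucc, Fin.snoc_castSucc]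
        rfl
      · rw [Fin.succ_last, Fin.snoc_last, Fin.snoc_castSucc, h2]

end ChainSums

/-- The right edge dynamics driven by a discrete-time path. -/
def edgeChain {n : ℕ} (W : ℕ → Fin n → ℤ) : ℕ → Fin n → ℤ
  | 0 => 0
  | m + 1 => runMax n (edgeChain W m + (W (m + 1) - W m))

theorem sortedEdge_zero (n : ℕ) : SortedEdge (0 : Fin n → ℤ) := by
  induction n with
  | zero => trivial
  | succ n ih =>
    refine ⟨ih, ?_⟩
    cases n <;> exact le_rfl

theorem sortedEdge_edgeChain {n : ℕ} (W : ℕ → Fin n → ℤ) (m : ℕ) : SortedEdge (edgeChain W m) := by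
  cases m
  · exact sortedEdge_zero n
  · exact sortedEdge_runMax _

theorem init_edgeChain {n : ℕ} (W : ℕ → Fin (n + 1) → ℤ) (m : ℕ) :
    (Fin.init (edgeChain W m) : Fin n → ℤ) = edgeChain (fun m => (Fin.init (W m) : Fin n → ℤ)) m := by
  induction m with
  | zero => rfl
  | succ m ih =>
    rw [edgeChain, edgeChain, runMax, Fin.init_snoc, ← ih]
    rfl

theorem edgeChain_succ_last {n : ℕ} (W : ℕ → Fin (n + 1) → ℤ) (m : ℕ) :
    edgeChain W (m + 1) (Fin.last n) =
      max (topVal (edgeChain (fun m => (Fin.init (W m) : Fin n → ℤ)) (m + 1)))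
        (edgeChain W m (Fin.last n) + (W (m + 1) (Fin.last n) - W m (Fin.last n))) := by
  rw [edgeChain, runMax, Fin.snoc_last, edgeChain, ← init_edgeChain]
  rfl

/-- Double induction on components and time. An optimal chain either makes its last switch at the
final time, which contributes the entry above, or earlier, in which case it extends an optimal chain
from the previous time. These are the two arguments of the maximum in `edgeChain_succ_last`. -/
theorem isGreatest_topVal_edgeChain {n : ℕ} (W : ℕ → Fin n → ℤ) (m : ℕ) :
    IsGreatest (chainSums W m) (topVal (edgeChain W m)) := by
  induction n generalizing m with
  | zero =>
    refine ⟨zero_mem_chainSums W m, ?_⟩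
    rintro s ⟨τ, -, -, rfl⟩
    simp [topVal]
  | succ n ih =>
    have ih' := ih fun m => Fin.init (W m)
    change IsGreatest _ (edgeChain W m (Fin.last n))
    induction m with
    | zero =>
      refine ⟨zero_mem_chainSums W 0, fun s hs => ?_⟩
      obtain ⟨r, hr, s', hs', rfl⟩ := mem_chainSums_succ_iff.1 hs
      obtain rfl : r = 0 := Nat.le_zero.1 hr
      have := (ih' 0).2 hs'
      have h0 : topVal (edgeChain (fun m => (Fin.init (W m) : Fin n → ℤ)) 0) = 0 := by
        cases n <;> rfl
      rw [h0] at this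
      rw [sub_self, add_zero]
      exact this
    | succ m ihm =>
      rw [edgeChain_succ_last]
      constructor
      · rcases max_choice (topVal (edgeChain (fun m => (Fin.init (W m) : Fin n → ℤ)) (m + 1)))
          (edgeChain W m (Fin.last n) + (W (m + 1) (Fin.last n) - W m (Fin.last n))) with h | h
        · rw [h]
          exact mem_chainSums_succ_iff.2 ⟨m + 1, le_rfl, _, (ih' (m + 1)).1, by simp⟩
        · rw [h]
          obtain ⟨r, hr, s', hs', e⟩ := mem_chainSums_succ_iff.1 ihm.1
          exact mem_chainSums_succ_iff.2 ⟨r, hr.trans (Nat.le_succ m), s', hs', by rw [e]; ring⟩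
      · intro s hs
        obtain ⟨r, hr, s', hs', rfl⟩ := mem_chainSums_succ_iff.1 hs
        rcases Nat.le_succ_iff.1 hr with h | rfl
        · refine le_max_of_le_right ?_
          have := ihm.2 (mem_chainSums_succ_iff.2 ⟨r, h, s', hs', rfl⟩)
          linarith
        · refine le_max_of_le_left ?_
          simpa using (ih' _).2 hs'

/-- A right-continuous path with left limits in a discrete space. -/
def IsCadlagPath {E : Type*} (Y : ℝ≥0 → E) : Prop :=
  ∀ t, (∀ᶠ s in 𝓝[>] t, Y s = Y t) ∧ ∃ y, ∀ᶠ s in 𝓝[<] t, Y s = y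

namespace IsCadlagPath

theorem comp {E F : Type*} {Y : ℝ≥0 → E} (hY : IsCadlagPath Y) (f : E → F) :
    IsCadlagPath fun t => f (Y t) := by
  intro t
  obtain ⟨h1, y, h2⟩ := hY t
  exact ⟨h1.mono fun s hs => congrArg f hs, f y, h2.mono fun s hs => congrArg f hs⟩

theorem prodMk {E F : Type*} {Y : ℝ≥0 → E} {Y' : ℝ≥0 → F} (hY : IsCadlagPath Y)
    (hY' : IsCadlagPath Y') : IsCadlagPath fun t => (Y t, Y' t) := by
  intro t
  obtain ⟨h1, y, h2⟩ := hY t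
  obtain ⟨h3, y', h4⟩ := hY' t
  exact ⟨(h1.and h3).mono fun s hs => Prod.ext hs.1 hs.2, (y, y'),
    (h2.and h4).mono fun s hs => Prod.ext hs.1 hs.2⟩

theorem eventually_eq {E : Type*} {Y : ℝ≥0 → E} (hY : IsCadlagPath Y) (t : ℝ≥0) :
    ∀ᶠ s in 𝓝[≥] t, Y s = Y t := by
  rw [← Set.Ioi_insert, nhdsWithin_insert]
  exact ⟨Filter.mem_pure.2 rfl, (hY t).1⟩

/-- Near each point the path takes at most two values, its left limit and its current value;
compactness of the interval does the rest. -/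
theorem finite_image {E : Type*} {Y : ℝ≥0 → E} (hY : IsCadlagPath Y) (t : ℝ≥0) :
    (Y '' Set.Icc 0 t).Finite := by
  refine isCompact_Icc.induction_on (p := fun S => (Y '' S).Finite) (by simp)
    (fun s t hst ht => ht.subset (Set.image_mono hst))
    (fun s t hs ht => by rw [Set.image_union]; exact hs.union ht) fun x _ => ?_
  obtain ⟨-, y, h2⟩ := hY x
  refine ⟨{s | Y s = y ∨ Y s = Y x}, mem_nhdsWithin_of_mem_nhds ?_,
    (Set.toFinite {y, Y x}).subset ?_⟩
  · rw [← nhdsLT_sup_nhdsGE]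
    exact ⟨h2.mono fun s => Or.inl, (hY.eventually_eq x).mono fun s => Or.inr⟩
  · rintro _ ⟨s, hs, rfl⟩
    exact hs

theorem bddAbove_chainSums {n : ℕ} {Y : ℝ≥0 → Fin n → ℤ} (hY : IsCadlagPath Y) (t : ℝ≥0) :
    BddAbove (chainSums Y t) := by
  have hfin : ∀ i, ∃ C, ∀ s ≤ t, |Y s i| ≤ C := fun i => by
    obtain ⟨C, hC⟩ := ((hY.finite_image t).image fun y => |y i|).bddAbove
    exact ⟨C, fun s hs => hC ⟨Y s, ⟨s, ⟨zero_le, hs⟩, rfl⟩, rfl⟩⟩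
  choose C hC using hfin
  refine ⟨∑ i, (C i + C i), ?_⟩
  rintro s ⟨τ, h1, h2, rfl⟩
  refine Finset.sum_le_sum fun i _ => ?_
  have hτ : ∀ j, τ j ≤ t := fun j => h2 ▸ h1 (Fin.le_last j)
  have e1 := (abs_le.1 (hC i _ (hτ i.succ))).2
  have e2 := (abs_le.1 (hC i _ (hτ i.castSucc))).1
  linarith

end IsCadlagPath

/-! ### Approximation of the path functional on a grid -/

/-- The points of the grid with mesh `1 / (N + 1)`. -/
def gridPoint (N m : ℕ) : ℝ≥0 := m / (N + 1)

/-- The index of the first grid point after `t`. -/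
def gridIndex (N : ℕ) (t : ℝ≥0) : ℕ := ⌈t * (N + 1)⌉₊

theorem gridPoint_mono (N : ℕ) : Monotone (gridPoint N) := fun a b hab => by
  unfold gridPoint
  gcongr

theorem gridIndex_mono (N : ℕ) : Monotone (gridIndex N) := fun a b hab => by
  unfold gridIndex
  gcongr

theorem gridIndex_zero (N : ℕ) : gridIndex N 0 = 0 := by simp [gridIndex]

theorem le_gridPoint_gridIndex (N : ℕ) (t : ℝ≥0) : t ≤ gridPoint N (gridIndex N t) := by
  unfold gridPoint gridIndex
  rw [le_div_iff₀ (by positivity)]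
  exact Nat.le_ceil _

theorem gridPoint_gridIndex_le (N : ℕ) (t : ℝ≥0) :
    gridPoint N (gridIndex N t) ≤ t + 1 / (N + 1) := by
  unfold gridPoint gridIndex
  rw [div_le_iff₀ (by positivity), add_mul, one_div, inv_mul_cancel₀ (by positivity)]
  exact (Nat.ceil_lt_add_one zero_le).le

theorem tendsto_gridPoint_gridIndex (t : ℝ≥0) :
    Tendsto (fun N => gridPoint N (gridIndex N t)) atTop (𝓝[≥] t) := by
  refine tendsto_nhdsWithin_iff.2 ⟨?_, Eventually.of_forall fun N => le_gridPoint_gridIndex N t⟩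
  refine tendsto_of_tendsto_of_tendsto_of_le_of_le tendsto_const_nhds ?_
    (fun N => le_gridPoint_gridIndex N t) (fun N => gridPoint_gridIndex_le N t)
  have h : Tendsto (fun N : ℕ => (1 : ℝ≥0) / (N + 1)) atTop (𝓝 0) :=
    tendsto_one_div_add_atTop_nhds_zero_nat
  simpa using tendsto_const_nhds.add h

/-- Integer values make the approximation exact from some mesh on. The supremum is attained, and
rounding the optimal times up to the grid does not change the path there, by right-continuity.
Conversely a grid chain is already a chain in continuous time, apart from its endpoint. -/
theorem IsCadlagPath.eventually_topVal_edgeChain_eq {n : ℕ} {Y : ℝ≥0 → Fin n → ℤ}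
    (hY : IsCadlagPath Y) (t : ℝ≥0) :
    ∀ᶠ N in atTop, topVal (edgeChain (fun m => Y (gridPoint N m)) (gridIndex N t)) =
      sSup (chainSums Y t) := by
  have hb := hY.bddAbove_chainSums t
  obtain ⟨τ, h1, h2, h3⟩ := Int.csSup_mem ⟨0, zero_mem_chainSums Y t⟩ hb
  have hτ : ∀ᶠ N in atTop, ∀ j, Y (gridPoint N (gridIndex N (τ j))) = Y (τ j) :=
    eventually_all.2 fun j => (tendsto_gridPoint_gridIndex (τ j)).eventually (hY.eventually_eq _)
  obtain ⟨u, hu, hu'⟩ := mem_nhdsGE_iff_exists_Icc_subset.1 (hY.eventually_eq t)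
  have ht : ∀ᶠ N in atTop, gridPoint N (gridIndex N t) ≤ u :=
    ((tendsto_gridPoint_gridIndex t).mono_right nhdsWithin_le_nhds).eventually
      (Iic_mem_nhds hu)
  filter_upwards [hτ, ht] with N hN hN'
  have hg := isGreatest_topVal_edgeChain (fun m => Y (gridPoint N m)) (gridIndex N t)
  refine le_antisymm ?_ ?_
  · obtain ⟨σ, e1, e2, e3⟩ := chainSums_comp_subset (gridPoint_mono N) Y _ hg.1
    -- The grid chain ends slightly after `t`. Cutting it off at `t` does not alter its sum because
    -- the path is constant between `t` and that grid point.
    refine le_csSup hb ⟨fun j => min (σ j) t, fun i j hij => min_le_min_right t (e1 hij), ?_, ?_⟩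
    · change min (σ (Fin.last n)) t = t
      rw [e2, min_eq_right (le_gridPoint_gridIndex N t)]
    · have : ∀ j, Y (min (σ j) t) = Y (σ j) := fun j => by
        rcases le_total (σ j) t with h | h
        · rw [min_eq_left h]
        · rw [min_eq_right h]
          exact (hu' ⟨h, (e1 (Fin.le_last j)).trans (e2.le.trans hN')⟩).symm
      simpa only [this] using e3
  · refine hg.2 ⟨fun j => gridIndex N (τ j), (gridIndex_mono N).comp h1, congrArg (gridIndex N) h2, ?_⟩
    simpa only [hN] using h3

theorem measurable_edgeChain {Ω : Type*} [MeasurableSpace Ω] {n : ℕ} {W : ℕ → Ω → Fin n → ℤ}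
    (hW : ∀ m, Measurable (W m)) (m : ℕ) : Measurable fun ω => edgeChain (fun m => W m ω) m := by
  induction m with
  | zero => exact measurable_const
  | succ m ih => exact (measurable_of_countable (runMax n)).comp (ih.add ((hW _).sub (hW _)))

/-- The supremum is uncountable, but it is a pointwise limit of measurable functions of the path on
grids. -/
theorem measurable_sSup_chainSums {Ω : Type*} [MeasurableSpace Ω] {n : ℕ}
    {Y : ℝ≥0 → Ω → Fin n → ℤ} (hY : ∀ t, Measurable (Y t)) (hc : ∀ ω, IsCadlagPath fun t => Y t ω)
    (t : ℝ≥0) : Measurable fun ω => sSup (chainSums (fun s => Y s ω) t) := by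
  refine measurable_of_tendsto_metrizable (f := fun N ω =>
      topVal (edgeChain (fun m => Y (gridPoint N m) ω) (gridIndex N t)))
    (fun N => (measurable_of_countable topVal).comp (measurable_edgeChain (fun m => hY _) _))
    (tendsto_pi_nhds.2 fun ω => ?_)
  exact tendsto_const_nhds.congr' (((hc ω).eventually_topVal_edgeChain_eq t).mono fun N h => h.symm)

end

noncomputable section

/-! ### Stationary independent increments -/

section Increments

open NormedSpace

variable {Ω : Type*} [MeasurableSpace Ω] {P : Measure Ω}

/-- The process `X` has stationary increments, which are independent of the past. -/
def StationaryIncrements {G : Type*} [Sub G] (P : Measure Ω) (X : ℝ≥0 → Ω → G) : Prop :=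
  ∀ t : ℕ → ℝ≥0, Monotone t → t 0 = 0 → ∀ (m : ℕ) (a : Fin (m + 1) → G) (x : G),
    P.real {ω | (fun j : Fin (m + 1) => X (t j) ω) = a ∧ X (t (m + 1)) ω - X (t m) ω = x} =
      P.real {ω | (fun j : Fin (m + 1) => X (t j) ω) = a} * P.real {ω | X (t (m + 1) - t m) ω = x}

theorem IsMarkovChain.integral_comp [IsProbabilityMeasure P] {E : Type*} [Countable E]
    [MeasurableSpace E] [MeasurableSingletonClass E] {Q : E → E → ℝ}
    {T : BddFun E →L[ℝ] BddFun E} {x₀ : E} {X : ℝ≥0 → Ω → E} (hX : IsMarkovChain Q x₀ P X)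
    (hT : ∀ f x, T f x = ∑' y, Q x y * f y) (hQ : ∀ x, (Function.support (Q x)).Finite) (s : ℝ≥0)
    (g : BddFun E) : ∫ ω, g (X s ω) ∂P = exp ((s : ℝ) • T) g x₀ := by
  have h := hX.integral_prod hT hQ (t := fun n => if n = 0 then 0 else s)
    (monotone_nat_of_le_succ fun n => by by_cases h : n = 0 <;> simp [h]) rfl
    (fun _ => BddFun.indicator Set.univ) 1 g
  simpa [iterExpect] using h

theorem IsMarkovChain.real_eq [IsProbabilityMeasure P] {E : Type*} [Countable E]
    [MeasurableSpace E] [MeasurableSingletonClass E] {Q : E → E → ℝ}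
    {T : BddFun E →L[ℝ] BddFun E} {x₀ : E} {X : ℝ≥0 → Ω → E} (hX : IsMarkovChain Q x₀ P X)
    (hT : ∀ f x, T f x = ∑' y, Q x y * f y) (hQ : ∀ x, (Function.support (Q x)).Finite) (s : ℝ≥0)
    (y : E) : P.real {ω | X s ω = y} = transitionProb Q s x₀ y := by
  rw [transitionProb_eq hT, ← hX.integral_comp hT hQ, ← integral_indicator_one (hX.measurable s y)]
  refine integral_congr_ae (Eventually.of_forall fun ω => ?_)
  by_cases h : X s ω = y <;> simp [h]

theorem qPow_add_right {G : Type*} [AddGroup G] {Q : G → G → ℝ}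
    (hQ : ∀ x y c, Q (x + c) (y + c) = Q x y) (n : ℕ) (x y c : G) :
    qPow Q n (x + c) (y + c) = qPow Q n x y := by
  induction n generalizing x with
  | zero =>
    simp only [qPow]
    by_cases h : x = y <;> simp [h]
  | succ n ih =>
    rw [qPow, qPow, ← (Equiv.addRight c).tsum_eq]
    exact tsum_congr fun z => by rw [Equiv.coe_addRight, hQ, ih]

theorem transitionProb_add_right {G : Type*} [AddGroup G] {Q : G → G → ℝ}
    (hQ : ∀ x y c, Q (x + c) (y + c) = Q x y) (t : ℝ) (x y c : G) :
    transitionProb Q t (x + c) (y + c) = transitionProb Q t x y := by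
  simp only [transitionProb, qPow_add_right hQ]

theorem walkQ_add_right {k : ℕ} (q : Fin k → ℝ) (x y c : Fin k → ℤ) :
    walkQ q (x + c) (y + c) = walkQ q x y := by
  have h1 : ∀ e, x + c + e = x + e + c := fun e => by abel
  have h2 : ∀ e, x + c - e = x - e + c := fun e => by abel
  simp only [walkQ, h1, h2, add_left_inj]

/-- The rates are translation invariant, hence so are the transition probabilities. -/
theorem IsMarkovChain.stationaryIncrements [IsProbabilityMeasure P] {k : ℕ} {q : Fin k → ℝ}
    (hq : ∀ i, 0 < q i) {Z : ℝ≥0 → Ω → Fin k → ℤ} (hZ : IsMarkovChain (walkQ q) 0 P Z) :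
    StationaryIncrements P Z := by
  intro t ht ht0 m a x
  have h := hZ.fdd_snoc ht ht0 m a (x + a (Fin.last m))
  have e : transitionProb (walkQ q) ((t (m + 1) : ℝ) - t m) (a (Fin.last m)) (x + a (Fin.last m)) =
      transitionProb (walkQ q) ((t (m + 1) : ℝ) - t m) 0 x := by
    rw [← transitionProb_add_right (walkQ_add_right q) _ 0 x (a (Fin.last m)), zero_add]
  rw [e, ← NNReal.coe_sub (ht (Nat.le_succ m)),
    ← hZ.real_eq (T := walkOp q hq) (fun f x => rfl) (finite_support_walkQ q)] at h
  rw [← h]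
  congr 1
  ext ω
  simp only [Set.mem_setOf_eq]
  refine and_congr_right fun h' => ?_
  have : a (Fin.last m) = Z (t m) ω := by rw [← h']; rfl
  rw [this, sub_eq_iff_eq_add]

theorem StationaryIncrements.neg {G : Type*} [AddCommGroup G] {X : ℝ≥0 → Ω → G}
    (h : StationaryIncrements P X) : StationaryIncrements P fun t ω => -X t ω := by
  intro t ht ht0 m a x
  have h1 : ∀ ω, ((fun j : Fin (m + 1) => -X (t j) ω) = a ↔
      (fun j : Fin (m + 1) => X (t j) ω) = -a) := fun ω => by
    rw [← neg_inj (b := -a), neg_neg]; rfl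
  have h2 : ∀ ω, (-X (t (m + 1)) ω - -X (t m) ω = x ↔ X (t (m + 1)) ω - X (t m) ω = -x) :=
    fun ω => by rw [← neg_inj (b := -x), neg_neg, neg_sub, neg_sub_neg]
  have h3 : ∀ s ω, (-X s ω = x ↔ X s ω = -x) := fun s ω => neg_eq_iff_eq_neg
  simp only [h1, h2, h3]
  exact h t ht ht0 m _ _

theorem measurableSet_history_eq {G : Type*} [Countable G] [MeasurableSpace G]
    [MeasurableSingletonClass G] (t : ℕ → ℝ≥0) (m : ℕ) (a : Fin (m + 1) → G) :
    MeasurableSet {f : ℝ≥0 → G | (fun j : Fin (m + 1) => f (t j)) = a} := by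
  have h : Measurable fun (f : ℝ≥0 → G) (j : Fin (m + 1)) => f (t j) :=
    measurable_pi_lambda _ fun j => measurable_pi_apply _
  exact h (measurableSet_singleton a)

theorem measurableSet_increment_eq {G : Type*} [AddCommGroup G] [Countable G] [MeasurableSpace G]
    [MeasurableSingletonClass G] (s r : ℝ≥0) (x : G) :
    MeasurableSet {f : ℝ≥0 → G | f s - f r = x} := by
  have h : Measurable ((fun p : G × G => p.1 - p.2) ∘ fun f : ℝ≥0 → G => (f s, f r)) :=
    Measurable.of_discrete.comp ((measurable_pi_apply s).prodMk (measurable_pi_apply r))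
  exact h (measurableSet_singleton x)

theorem measurableSet_eval_eq {G : Type*} [MeasurableSpace G] [MeasurableSingletonClass G]
    (s : ℝ≥0) (x : G) : MeasurableSet {f : ℝ≥0 → G | f s = x} := by
  have h : Measurable fun f : ℝ≥0 → G => f s := measurable_pi_apply s
  exact h (measurableSet_singleton x)

theorem StationaryIncrements.congr {G : Type*} [AddCommGroup G] [Countable G] [MeasurableSpace G]
    [MeasurableSingletonClass G] {X Y : ℝ≥0 → Ω → G}
    (h : StationaryIncrements P X) (hXY : IdentDistrib (fun ω t => Y t ω) (fun ω t => X t ω) P P) :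
    StationaryIncrements P Y := by
  intro t ht ht0 m a x
  have key : ∀ S : Set (ℝ≥0 → G), MeasurableSet S →
      P.real {ω | (fun t => Y t ω) ∈ S} = P.real {ω | (fun t => X t ω) ∈ S} := fun S hS =>
    congrArg ENNReal.toReal (hXY.measure_mem_eq hS)
  have m1 := measurableSet_history_eq t m a
  have m2 := measurableSet_increment_eq (t (m + 1)) (t m) x
  have m3 := measurableSet_eval_eq (t (m + 1) - t m) x
  have e1 := key _ (m1.inter m2)
  have e2 := key _ m1
  have e3 := key _ m3
  have := h t ht ht0 m a x
  exact (e1.trans this).trans (congrArg₂ (· * ·) e2.symm e3.symm)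

theorem StationaryIncrements.prodMk [IsProbabilityMeasure P] {G H : Type*}
    [AddCommGroup G] [Countable G] [MeasurableSpace G] [MeasurableSingletonClass G]
    [AddCommGroup H] [Countable H] [MeasurableSpace H] [MeasurableSingletonClass H]
    {X : ℝ≥0 → Ω → G} {Y : ℝ≥0 → Ω → H} (hX : StationaryIncrements P X)
    (hY : StationaryIncrements P Y) (h : IndepFun (fun ω t => X t ω) (fun ω t => Y t ω) P) :
    StationaryIncrements P fun t ω => (X t ω, Y t ω) := by
  intro t ht ht0 m a x
  have key : ∀ (S : Set (ℝ≥0 → G)) (S' : Set (ℝ≥0 → H)), MeasurableSet S → MeasurableSet S' →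
      P.real {ω | (fun t => X t ω) ∈ S ∧ (fun t => Y t ω) ∈ S'} =
        P.real {ω | (fun t => X t ω) ∈ S} * P.real {ω | (fun t => Y t ω) ∈ S'} :=
    fun S S' hS hS' => by
      rw [measureReal_def, measureReal_def, measureReal_def, ← ENNReal.toReal_mul]
      exact congrArg ENNReal.toReal (h.measure_inter_preimage_eq_mul _ _ hS hS')
  have m3 := measurableSet_eval_eq (t (m + 1) - t m) x.1
  have n3 := measurableSet_eval_eq (t (m + 1) - t m) x.2
  have m1 := measurableSet_history_eq t m fun j => (a j).1
  have n1 := measurableSet_history_eq t m fun j => (a j).2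
  have e1 := key _ _ (m1.inter (measurableSet_increment_eq (t (m + 1)) (t m) x.1))
    (n1.inter (measurableSet_increment_eq (t (m + 1)) (t m) x.2))
  have e2 := key _ _ m1 n1
  have e3 := key _ _ m3 n3
  have s1 : ∀ ω, ((fun j : Fin (m + 1) => (X (t j) ω, Y (t j) ω)) = a ↔
      (fun j : Fin (m + 1) => X (t j) ω) = (fun j => (a j).1) ∧
      (fun j : Fin (m + 1) => Y (t j) ω) = (fun j => (a j).2)) := fun ω => by
    simp only [funext_iff, Prod.ext_iff, forall_and]
  simp only [Set.mem_inter_iff, Set.mem_setOf_eq] at e1 e2 e3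
  rw [hX t ht ht0, hY t ht ht0] at e1
  simp only [s1, Prod.ext_iff, Prod.fst_sub, Prod.snd_sub]
  rw [e2, e3, mul_mul_mul_comm, ← e1]
  congr 1
  ext ω
  simp only [Set.mem_setOf_eq]
  tauto

end Increments
end

noncomputable section

/-! ### The right edge dynamics in discrete time -/

/-- The states of the right edge dynamics. -/
abbrev EdgeState (n : ℕ) : Type := {e : Fin n → ℤ // SortedEdge e}

namespace EdgeState

variable {n : ℕ}

instance : Inhabited (EdgeState n) := ⟨⟨0, sortedEdge_zero n⟩⟩

/-- The state after the jump `w`. -/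
def move (e : EdgeState n) (w : Fin n → ℤ) : EdgeState n := ⟨runMax n (e + w), sortedEdge_runMax _⟩

theorem move_zero (e : EdgeState n) : e.move 0 = e :=
  Subtype.ext ((congrArg (runMax n) (add_zero _)).trans (runMax_eq_self e.2))

end EdgeState

/-- The right edge dynamics driven by a discrete-time path, as an element of the state space. -/
def edgeState {n : ℕ} (W : ℕ → Fin n → ℤ) (m : ℕ) : EdgeState n :=
  ⟨edgeChain W m, sortedEdge_edgeChain W m⟩

theorem edgeState_succ {n : ℕ} (W : ℕ → Fin n → ℤ) (m : ℕ) :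
    edgeState W (m + 1) = (edgeState W m).move (W (m + 1) - W m) := rfl

/-- The generator of the right edge dynamics as a bounded operator. -/
def edgeGenL (a : ℕ → ℝ) (n : ℕ) : BddFun (EdgeState n) →L[ℝ] BddFun (EdgeState n) :=
  boundedOp
    { toFun := fun φ e => ∑ i : Fin n, (a i * (φ (e.move (Pi.single i 1)) - φ e) +
        (a i)⁻¹ * (φ (e.move (Pi.single i (-1))) - φ e))
      map_add' := fun φ ψ => by
        ext e
        simp only [Pi.add_apply, ← Finset.sum_add_distrib]
        exact Finset.sum_congr rfl fun i _ => by ring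
      map_smul' := fun c φ => by
        ext e
        simp only [Pi.smul_apply, smul_eq_mul, RingHom.id_apply, Finset.mul_sum]
        exact Finset.sum_congr rfl fun i _ => by ring }
    (∑ i : Fin n, (|a i| * 2 + |(a i)⁻¹| * 2)) fun φ B hφ e => by
      have h2 : ∀ y y', |φ y - φ y'| ≤ 2 * B := fun y y' =>
        (abs_sub (φ y) (φ y')).trans (by linarith [hφ y, hφ y'])
      rw [Finset.sum_mul, LinearMap.coe_mk, AddHom.coe_mk]
      refine (Finset.abs_sum_le_sum_abs _ _).trans ?_
      refine Finset.sum_le_sum fun i _ => (abs_add_le _ _).trans ?_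
      rw [abs_mul, abs_mul, add_mul, mul_assoc, mul_assoc]
      gcongr <;> exact h2 _ _

@[simp]
theorem edgeGenL_apply (a : ℕ → ℝ) {n : ℕ} (φ : BddFun (EdgeState n)) (e : EdgeState n) :
    edgeGenL a n φ e = ∑ i : Fin n, (a i * (φ (e.move (Pi.single i 1)) - φ e) +
        (a i)⁻¹ * (φ (e.move (Pi.single i (-1))) - φ e)) := rfl

/-! ### The transition operator of one grid step -/

section Step

variable {Ω : Type*} [MeasurableSpace Ω] {P : Measure Ω} [IsProbabilityMeasure P] {n : ℕ}

theorem BddFun.integrable_comp {E : Type*} [Countable E] [MeasurableSpace E]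
    [MeasurableSingletonClass E] (f : BddFun E) {X : Ω → E} (hX : Measurable X) :
    Integrable (fun ω => f (X ω)) P :=
  (integrable_const ‖f‖).mono' (Measurable.of_discrete.comp hX).aestronglyMeasurable
    (Eventually.of_forall fun _ => f.abs_apply_le _)

theorem BddFun.abs_integral_comp_le {E : Type*} (f : BddFun E) (X : Ω → E) :
    |∫ ω, f (X ω) ∂P| ≤ ‖f‖ := by
  have := norm_integral_le_of_norm_le_const (μ := P) (f := fun ω => f (X ω)) (C := ‖f‖)
    (Eventually.of_forall fun ω => f.abs_apply_le _)
  simpa using this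

variable (P) in
/-- The transition operator of the right edge dynamics for a random jump. -/
def edgeStep {W : Ω → Fin n → ℤ} (hW : Measurable W) :
    BddFun (EdgeState n) →L[ℝ] BddFun (EdgeState n) :=
  LinearMap.mkContinuous
    { toFun := fun φ => BddFun.mk (fun e => ∫ ω, φ (e.move (W ω)) ∂P) ‖φ‖
        fun e => φ.abs_integral_comp_le _
      map_add' := fun φ ψ => by
        ext e
        exact integral_add (φ.integrable_comp ((measurable_of_countable e.move).comp hW))
          (ψ.integrable_comp ((measurable_of_countable e.move).comp hW))
      map_smul' := fun c φ => by
        ext e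
        exact integral_const_mul c _ } 1
    fun φ => by
      rw [one_mul]
      exact BddFun.norm_le (norm_nonneg _) fun e => φ.abs_integral_comp_le _

theorem edgeStep_apply {W : Ω → Fin n → ℤ} (hW : Measurable W) (φ : BddFun (EdgeState n))
    (e : EdgeState n) : edgeStep P hW φ e = ∫ ω, φ (e.move (W ω)) ∂P := rfl

theorem norm_edgeStep_le {W : Ω → Fin n → ℤ} (hW : Measurable W) : ‖edgeStep P hW‖ ≤ 1 :=
  LinearMap.mkContinuous_norm_le _ zero_le_one _

variable {G : Type*} [AddCommGroup G] [Countable G] [MeasurableSpace G] [MeasurableSingletonClass G]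

/-- The hypothesis identifies the joint law of history and increment, on a countable space, with a
product measure; then Fubini. -/
theorem integral_history_increment {V : ℕ → Ω → G} {R : Ω → G} (hV : ∀ m, Measurable (V m))
    (hR : Measurable R) {m : ℕ} (hinc : ∀ (a : Fin (m + 1) → G) (x : G),
      P.real {ω | (fun j : Fin (m + 1) => V j ω) = a ∧ V (m + 1) ω - V m ω = x} =
        P.real {ω | (fun j : Fin (m + 1) => V j ω) = a} * P.real {ω | R ω = x})
    (F : BddFun ((Fin (m + 1) → G) × G)) :
    ∫ ω, F (fun j => V j ω, V (m + 1) ω - V m ω) ∂P =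
      ∫ ω, ∫ ω', F (fun j => V j ω, R ω') ∂P ∂P := by
  have hH : Measurable fun ω (j : Fin (m + 1)) => V j ω := measurable_pi_lambda _ fun j => hV j
  have hD : Measurable fun ω => V (m + 1) ω - V m ω :=
    (Measurable.of_discrete (f := fun p : G × G => p.1 - p.2)).comp ((hV (m + 1)).prodMk (hV m))
  have hmap : P.map (fun ω => ((fun j : Fin (m + 1) => V j ω), V (m + 1) ω - V m ω)) =
      (P.map fun ω (j : Fin (m + 1)) => V j ω).prod (P.map R) := by
    refine Measure.ext_of_singleton fun p => ?_
    rw [← Prod.mk.eta (p := p), ← Set.singleton_prod_singleton, Measure.prod_prod,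
      Measure.map_apply (hH.prodMk hD) (measurableSet_singleton _ |>.prod (measurableSet_singleton _)),
      Measure.map_apply hH (measurableSet_singleton _), Measure.map_apply hR (measurableSet_singleton _),
      ← ENNReal.toReal_eq_toReal_iff' (measure_ne_top _ _)
        (ENNReal.mul_ne_top (measure_ne_top _ _) (measure_ne_top _ _)), ENNReal.toReal_mul]
    exact hinc p.1 p.2
  have : IsProbabilityMeasure (P.map fun ω (j : Fin (m + 1)) => V j ω) :=
    Measure.isProbabilityMeasure_map hH.aemeasurable
  have : IsProbabilityMeasure (P.map R) := Measure.isProbabilityMeasure_map hR.aemeasurable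
  rw [← integral_map (hH.prodMk hD).aemeasurable (f := fun p => F p)
    Measurable.of_discrete.aestronglyMeasurable, hmap,
    integral_prod (fun p => F p) (F.integrable_comp measurable_id),
    integral_map hH.aemeasurable Measurable.of_discrete.aestronglyMeasurable]
  refine integral_congr_ae (Eventually.of_forall fun ω => ?_)
  exact integral_map hR.aemeasurable Measurable.of_discrete.aestronglyMeasurable

/-- The random variable `H` is a function of `V 0, …, V m`. -/
def DependsOnPast {α : Type*} (V : ℕ → Ω → G) (m : ℕ) (H : Ω → α) : Prop :=
  ∀ ω ω', (∀ j ≤ m, V j ω = V j ω') → H ω = H ω'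

theorem DependsOnPast.mono {α : Type*} {V : ℕ → Ω → G} {m m' : ℕ} (h : m ≤ m') {H : Ω → α}
    (hH : DependsOnPast V m H) : DependsOnPast V m' H :=
  fun ω ω' hω => hH ω ω' fun j hj => hω j (hj.trans h)

theorem DependsOnPast.factorsThrough {α : Type*} {V : ℕ → Ω → G} {m : ℕ} {H : Ω → α}
    (hH : DependsOnPast V m H) :
    Function.FactorsThrough H fun ω (j : Fin (m + 1)) => V j ω :=
  fun ω ω' h => hH ω ω' fun j hj => congrFun h ⟨j, Nat.lt_succ_of_le hj⟩

theorem dependsOnPast_edgeState (V : ℕ → Ω → G) (ι : G → Fin n → ℤ) (m : ℕ) :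
    DependsOnPast V m fun ω => edgeState (fun j => ι (V j ω)) m := by
  intro ω ω' h
  refine Subtype.ext ?_
  change edgeChain _ m = edgeChain _ m
  induction m with
  | zero => rfl
  | succ m ih =>
    rw [edgeChain, edgeChain, ih fun j hj => h j (hj.trans (Nat.le_succ m)), h (m + 1) le_rfl,
      h m (Nat.le_succ m)]

/-- The state at time `m` and `H` are functions of the history, and the next state is a function of
the state and the independent increment. Integrating out the increment gives `edgeStep`. -/
theorem integral_mul_edgeState_succ {V : ℕ → Ω → G} {R : Ω → G} (hV : ∀ m, Measurable (V m))
    (hR : Measurable R) {m : ℕ} (hinc : ∀ (a : Fin (m + 1) → G) (x : G),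
      P.real {ω | (fun j : Fin (m + 1) => V j ω) = a ∧ V (m + 1) ω - V m ω = x} =
        P.real {ω | (fun j : Fin (m + 1) => V j ω) = a} * P.real {ω | R ω = x})
    (ι : G →+ (Fin n → ℤ)) (hW : Measurable fun ω => ι (R ω)) {H : Ω → ℝ} {C : ℝ}
    (hC : ∀ ω, |H ω| ≤ C) (hH : DependsOnPast V m H) (φ : BddFun (EdgeState n)) :
    ∫ ω, H ω * φ (edgeState (fun j => ι (V j ω)) (m + 1)) ∂P =
      ∫ ω, H ω * edgeStep P hW φ (edgeState (fun j => ι (V j ω)) m) ∂P := by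
  classical
  obtain ⟨s, hs⟩ := (Function.factorsThrough_iff _).1
    (dependsOnPast_edgeState V ι m).factorsThrough
  set hist : Ω → Fin (m + 1) → G := fun ω j => V j ω with hhist
  have hs' : ∀ ω, edgeState (fun j => ι (V j ω)) m = s (hist ω) := fun ω => congrFun hs ω
  have hC0 : 0 ≤ C := by
    obtain ⟨ω⟩ : Nonempty Ω := nonempty_of_isProbabilityMeasure P
    exact (abs_nonneg _).trans (hC ω)
  -- Extension by zero to histories that do not occur keeps the bound `C` everywhere; measurability
  -- is automatic on a countable discrete space.
  set h : (Fin (m + 1) → G) → ℝ := Function.extend hist H 0 with hh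
  have hh1 : ∀ ω, h (hist ω) = H ω := fun ω => hH.factorsThrough.extend_apply 0 ω
  have hh2 : ∀ v, |h v| ≤ C := fun v => by
    rw [hh, Function.extend_def]
    split_ifs
    · exact hC _
    · simpa using hC0
  have key := integral_history_increment hV hR hinc (BddFun.mk
    (fun p => h p.1 * φ ((s p.1).move (ι p.2))) (C * ‖φ‖) fun p => by
      rw [abs_mul]
      exact mul_le_mul (hh2 _) (φ.abs_apply_le _) (abs_nonneg _) hC0)
  simp only [BddFun.mk_apply] at key
  have e1 : ∀ ω, H ω * φ (edgeState (fun j => ι (V j ω)) (m + 1)) =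
      h (hist ω) * φ ((s (hist ω)).move (ι (V (m + 1) ω - V m ω))) := fun ω => by
    rw [edgeState_succ, hs', hh1, map_sub]
  have e2 : ∀ ω, H ω * edgeStep P hW φ (edgeState (fun j => ι (V j ω)) m) =
      ∫ ω', h (hist ω) * φ ((s (hist ω)).move (ι (R ω'))) ∂P := fun ω => by
    rw [hs', edgeStep_apply, hh1, integral_const_mul]
  simp only [e1, e2]
  exact key

theorem integral_mul_edgeState_add {V : ℕ → Ω → G} {R : Ω → G} (hV : ∀ m, Measurable (V m))
    (hR : Measurable R) (hinc : ∀ (m : ℕ) (a : Fin (m + 1) → G) (x : G),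
      P.real {ω | (fun j : Fin (m + 1) => V j ω) = a ∧ V (m + 1) ω - V m ω = x} =
        P.real {ω | (fun j : Fin (m + 1) => V j ω) = a} * P.real {ω | R ω = x})
    (ι : G →+ (Fin n → ℤ)) (hW : Measurable fun ω => ι (R ω)) {H : Ω → ℝ} {C : ℝ}
    (hC : ∀ ω, |H ω| ≤ C) {m : ℕ} (hH : DependsOnPast V m H) (d : ℕ) (φ : BddFun (EdgeState n)) :
    ∫ ω, H ω * φ (edgeState (fun j => ι (V j ω)) (m + d)) ∂P =
      ∫ ω, H ω * (edgeStep P hW ^ d) φ (edgeState (fun j => ι (V j ω)) m) ∂P := by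
  induction d generalizing φ with
  | zero => rfl
  | succ d ih =>
    rw [← add_assoc, integral_mul_edgeState_succ hV hR (hinc _) ι hW hC (hH.mono (Nat.le_add_right m d)),
      ih, pow_succ]
    rfl

theorem integral_prod_edgeState {V : ℕ → Ω → G} {R : Ω → G} (hV : ∀ m, Measurable (V m))
    (hR : Measurable R) (hinc : ∀ (m : ℕ) (a : Fin (m + 1) → G) (x : G),
      P.real {ω | (fun j : Fin (m + 1) => V j ω) = a ∧ V (m + 1) ω - V m ω = x} =
        P.real {ω | (fun j : Fin (m + 1) => V j ω) = a} * P.real {ω | R ω = x})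
    (ι : G →+ (Fin n → ℤ)) (hW : Measurable fun ω => ι (R ω)) {M : ℕ → ℕ} (hM : Monotone M)
    (hM0 : M 0 = 0) (f : ℕ → BddFun (EdgeState n)) (m : ℕ) (g : BddFun (EdgeState n)) :
    ∫ ω, (∏ j ∈ Finset.range m, f j (edgeState (fun j => ι (V j ω)) (M j))) *
        g (edgeState (fun j => ι (V j ω)) (M m)) ∂P =
      iterExpect (fun j => edgeStep P hW ^ (M (j + 1) - M j)) f default m g := by
  refine integral_prod_eq_iterExpect (X := fun j ω => edgeState (fun j => ι (V j ω)) (M j))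
    (Eventually.of_forall fun ω => by rw [hM0]; rfl) (fun m g => ?_) m g
  have h := integral_mul_edgeState_add hV hR hinc ι hW
    (H := fun ω => ∏ j ∈ Finset.range (m + 1), f j (edgeState (fun j => ι (V j ω)) (M j)))
    (C := ∏ j ∈ Finset.range (m + 1), ‖f j‖) (m := M m) (fun ω => by
      rw [Finset.abs_prod]
      exact Finset.prod_le_prod (fun _ _ => abs_nonneg _) fun j _ => (f j).abs_apply_le _)
    (fun ω ω' hω => Finset.prod_congr rfl fun j hj => by
      exact congrArg (f j) ((dependsOnPast_edgeState V ι (M j)).mono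
        (hM (Nat.lt_succ_iff.1 (Finset.mem_range.1 hj))) ω ω' hω))
    (M (m + 1) - M m) g
  rwa [Nat.add_sub_cancel' (hM (Nat.le_succ m))] at h

end Step
end

noncomputable section

/-! ### From discrete to continuous time -/

open NormedSpace

namespace BddFun

variable {E : Type*}

/-- Multiplication by a bounded function. -/
def mulL (f : BddFun E) : BddFun E →L[ℝ] BddFun E :=
  LinearMap.mkContinuous
    { toFun := fun g => f * g
      map_add' := fun g h => by
        ext x
        simp [mul_add]
      map_smul' := fun c g => by
        ext x
        simp [mul_left_comm] } ‖f‖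
    fun g => norm_le (by positivity) fun x => by
      change |f x * g x| ≤ _
      rw [abs_mul]
      exact mul_le_mul (f.abs_apply_le x) (g.abs_apply_le x) (abs_nonneg _) (norm_nonneg _)

/-- Composition with a map, as a bounded function. -/
def comp {F : Type*} (f : BddFun E) (φ : F → E) : BddFun F :=
  mk (fun x => f (φ x)) ‖f‖ fun x => f.abs_apply_le _

@[simp]
theorem comp_apply {F : Type*} (f : BddFun E) (φ : F → E) (x : F) : f.comp φ x = f (φ x) := rfl

theorem norm_comp_le {F : Type*} (f : BddFun E) (φ : F → E) : ‖f.comp φ‖ ≤ ‖f‖ :=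
  norm_le (norm_nonneg _) fun _ => f.abs_apply_le _

end BddFun

theorem tendsto_iterExpect {E : Type*} {U' : ℕ → ℕ → BddFun E →L[ℝ] BddFun E}
    {U : ℕ → BddFun E →L[ℝ] BddFun E} (hU : ∀ j, Tendsto (fun N => U' N j) atTop (𝓝 (U j)))
    (f : ℕ → BddFun E) (x₀ : E) (m : ℕ) {g' : ℕ → BddFun E} {g : BddFun E}
    (hg : Tendsto g' atTop (𝓝 g)) :
    Tendsto (fun N => iterExpect (U' N) f x₀ m (g' N)) atTop (𝓝 (iterExpect U f x₀ m g)) := by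
  induction m generalizing g' g with
  | zero => exact ((BddFun.evalL x₀).continuous.tendsto g).comp hg
  | succ m ih => exact ih (((BddFun.mulL (f m)).continuous.tendsto _).comp
      ((isBoundedBilinearMap_apply.continuous.tendsto (U m, g)).comp ((hU m).prodMk_nhds hg)))

/-- A second-order remainder uniform in the function and the point, in the form required for one
small time step. -/
theorem exists_abs_exp_apply_sub_le {E : Type*} [Nonempty E] (T : BddFun E →L[ℝ] BddFun E) :
    ∃ C, 0 ≤ C ∧ ∀ s : ℝ, 0 ≤ s → s ≤ 1 → ∀ (g : BddFun E) (x : E),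
      |exp (s • T) g x - g x - s * T g x| ≤ C * s ^ 2 * ‖g‖ := by
  refine ⟨‖T‖ ^ 2 * Real.exp ‖T‖, by positivity, fun s hs hs1 g x => ?_⟩
  have h1 : ‖exp (s • T) - 1 - s • T‖ ≤ ‖T‖ ^ 2 * Real.exp ‖T‖ * s ^ 2 := by
    refine (norm_exp_sub_one_sub_le (s • T)).trans ?_
    have h2 : ‖s • T‖ = s * ‖T‖ := by rw [norm_smul, Real.norm_of_nonneg hs]
    have h3 : ‖s • T‖ ≤ ‖T‖ := by
      rw [h2]
      exact mul_le_of_le_one_left (norm_nonneg _) hs1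
    calc ‖s • T‖ ^ 2 * Real.exp ‖s • T‖ ≤ ‖s • T‖ ^ 2 * Real.exp ‖T‖ := by gcongr
      _ = _ := by rw [h2]; ring
  refine ((exp (s • T) - 1 - s • T) g).abs_apply_le x |>.trans ?_
  exact (ContinuousLinearMap.le_opNorm _ g).trans (by gcongr)

section Pair

variable {Ω : Type*} [MeasurableSpace Ω] {P : Measure Ω} [IsProbabilityMeasure P]

/-- The expansion in `δ` of the expectation of a function of two independent small jumps. -/
theorem abs_integral_pair_sub_le {G H : Type*} [AddCommGroup G] [Countable G] [MeasurableSpace G]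
    [MeasurableSingletonClass G] [AddCommGroup H] [Countable H] [MeasurableSpace H]
    [MeasurableSingletonClass H] {X : Ω → G} {Y : Ω → H} (hX : Measurable X) (hY : Measurable Y)
    (h : IndepFun X Y P) (A : BddFun G →L[ℝ] ℝ) (B : BddFun H →L[ℝ] ℝ) {δ C : ℝ} (hδ0 : 0 ≤ δ)
    (hδ1 : δ ≤ 1) (hC : 0 ≤ C) (hA : ∀ g : BddFun G, |∫ ω, g (X ω) ∂P - g 0 - δ * A g| ≤ C * δ ^ 2 * ‖g‖)
    (hB : ∀ g : BddFun H, |∫ ω, g (Y ω) ∂P - g 0 - δ * B g| ≤ C * δ ^ 2 * ‖g‖) (f : BddFun (G × H)) :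
    |∫ ω, f (X ω, Y ω) ∂P - f 0 - δ * (A (f.comp fun x => (x, 0)) + B (f.comp fun y => (0, y)))| ≤
      (2 * C + (‖B‖ + C) * ‖A‖) * δ ^ 2 * ‖f‖ := by
  have : IsProbabilityMeasure (P.map X) := Measure.isProbabilityMeasure_map hX.aemeasurable
  have : IsProbabilityMeasure (P.map Y) := Measure.isProbabilityMeasure_map hY.aemeasurable
  have h1 : ∫ ω, f (X ω, Y ω) ∂P = ∫ ω', ∫ ω, f (X ω, Y ω') ∂P ∂P := by
    rw [← integral_map (hX.prodMk hY).aemeasurable (f := fun p => f p)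
      Measurable.of_discrete.aestronglyMeasurable,
      (indepFun_iff_map_prod_eq_prod_map_map hX.aemeasurable hY.aemeasurable).1 h,
      integral_prod_symm (fun p => f p) (f.integrable_comp measurable_id),
      integral_map hY.aemeasurable Measurable.of_discrete.aestronglyMeasurable]
    refine integral_congr_ae (Eventually.of_forall fun ω => ?_)
    exact integral_map hX.aemeasurable Measurable.of_discrete.aestronglyMeasurable
  set F : BddFun H := BddFun.mk (fun y => ∫ ω, f (X ω, y) ∂P) ‖f‖
    (fun y => (f.comp fun x => (x, y)).abs_integral_comp_le X |>.trans (f.norm_comp_le _)) with hF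
  set D : BddFun H := BddFun.mk (fun y => A (f.comp fun x => (x, y))) (‖A‖ * ‖f‖) (fun y =>
    (A.le_opNorm _).trans (by gcongr; exact f.norm_comp_le _)) with hD
  have hDn : ‖D‖ ≤ ‖A‖ * ‖f‖ := BddFun.norm_le (by positivity) fun y =>
    (A.le_opNorm _).trans (by gcongr; exact f.norm_comp_le _)
  set f0 : BddFun H := f.comp fun y => (0, y) with hf0
  -- First expand in `X` for frozen `Y`, uniformly in the frozen value.
  have e1 : |∫ ω, F (Y ω) ∂P - ∫ ω, f0 (Y ω) ∂P - δ * ∫ ω, D (Y ω) ∂P| ≤ C * δ ^ 2 * ‖f‖ := by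
    have hFf : Integrable (fun ω => F (Y ω) - f0 (Y ω)) P :=
      (F.integrable_comp hY).sub (f0.integrable_comp hY)
    rw [← integral_const_mul, ← integral_sub (F.integrable_comp hY) (f0.integrable_comp hY),
      ← integral_sub hFf ((D.integrable_comp hY).const_mul δ)]
    refine ((F - f0 - δ • D).abs_integral_comp_le Y).trans (BddFun.norm_le (by positivity) fun y => ?_)
    exact (hA (f.comp fun x => (x, y))).trans (by gcongr; exact f.norm_comp_le _)
  have e2 : |∫ ω, f0 (Y ω) ∂P - f0 0 - δ * B f0| ≤ C * δ ^ 2 * ‖f‖ :=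
    (hB f0).trans (by gcongr; exact f.norm_comp_le _)
  -- The first-order term in `X` still depends on `Y`; replacing `Y` by `0` costs another factor
  -- `δ`.
  have e3 : |∫ ω, D (Y ω) ∂P - D 0| ≤ (‖B‖ + C) * ‖A‖ * δ * ‖f‖ := by
    have h2 := hB D
    have h3 : |δ * B D| ≤ δ * (‖B‖ * (‖A‖ * ‖f‖)) := by
      rw [abs_mul, abs_of_nonneg hδ0]
      gcongr
      exact (B.le_opNorm D).trans (by gcongr)
    have h4 : C * δ ^ 2 * ‖D‖ ≤ C * δ * (‖A‖ * ‖f‖) := by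
      have : δ ^ 2 ≤ δ := by nlinarith
      gcongr
    have h5 := abs_add_le (∫ ω, D (Y ω) ∂P - D 0 - δ * B D) (δ * B D)
    rw [sub_add_cancel] at h5
    linarith
  have e4 : |δ * (∫ ω, D (Y ω) ∂P - D 0)| ≤ (‖B‖ + C) * ‖A‖ * δ ^ 2 * ‖f‖ := by
    rw [abs_mul, abs_of_nonneg hδ0]
    calc δ * |∫ ω, D (Y ω) ∂P - D 0| ≤ δ * ((‖B‖ + C) * ‖A‖ * δ * ‖f‖) := by gcongr
      _ = _ := by ring
  have e5 : ∫ ω, f (X ω, Y ω) ∂P - f 0 - δ * (A (f.comp fun x => (x, 0)) + B (f.comp fun y => (0, y))) =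
      (∫ ω, F (Y ω) ∂P - ∫ ω, f0 (Y ω) ∂P - δ * ∫ ω, D (Y ω) ∂P) +
        (∫ ω, f0 (Y ω) ∂P - f0 0 - δ * B f0) + δ * (∫ ω, D (Y ω) ∂P - D 0) := by
    have h6 : D 0 = A (f.comp fun x => (x, 0)) := rfl
    have h7 : f0 0 = f 0 := rfl
    have h8 : ∫ ω, F (Y ω) ∂P = ∫ ω, f (X ω, Y ω) ∂P := h1.symm
    rw [h6, h7, h8]
    ring
  rw [e5]
  refine (abs_add_le _ _).trans ((add_le_add ((abs_add_le _ _).trans (add_le_add e1 e2)) e4).trans ?_)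
  linarith

end Pair

/-! ### The interleaved walk -/

section Interleave

variable {k : ℕ}

/-- Interleaving of two vectors. -/
def interleaveHom (k : ℕ) : (Fin k → ℤ) × (Fin k → ℤ) →+ (Fin (2 * k) → ℤ) where
  toFun p i := if (i : ℕ) % 2 = 0 then p.1 ⟨i / 2, Nat.div_lt_of_lt_mul i.isLt⟩
    else p.2 ⟨i / 2, Nat.div_lt_of_lt_mul i.isLt⟩
  map_zero' := by
    ext i
    simp
  map_add' p p' := by
    ext i
    simp only [Pi.add_apply]
    split_ifs <;> rfl

theorem interleaveHom_single_left (i : Fin k) (c : ℤ) :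
    interleaveHom k (Pi.single i c, 0) = Pi.single ⟨2 * i, by omega⟩ c := by
  ext j
  simp only [interleaveHom, AddMonoidHom.coe_mk, ZeroHom.coe_mk, Pi.single_apply, Pi.zero_apply,
    Fin.ext_iff]
  split_ifs <;> first | rfl | omega

theorem interleaveHom_single_right (i : Fin k) (c : ℤ) :
    interleaveHom k (0, Pi.single i c) = Pi.single ⟨2 * i + 1, by omega⟩ c := by
  ext j
  simp only [interleaveHom, AddMonoidHom.coe_mk, ZeroHom.coe_mk, Pi.single_apply, Pi.zero_apply,
    Fin.ext_iff]
  split_ifs <;> first | rfl | omega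

theorem sum_fin_two_mul (k : ℕ) (F : Fin (2 * k) → ℝ) :
    ∑ i, F i = ∑ i : Fin k, (F ⟨2 * i, by omega⟩ + F ⟨2 * i + 1, by omega⟩) := by
  induction k with
  | zero => rfl
  | succ k ih =>
    rw [Fin.sum_univ_castSucc (n := k)]
    change ∑ i : Fin (2 * k + 1 + 1), F i = _
    rw [Fin.sum_univ_castSucc, Fin.sum_univ_castSucc, ih, add_assoc]
    rfl

theorem walkOp_apply_zero {q : Fin k → ℝ} (hq : ∀ i, 0 < q i) (g : BddFun (Fin k → ℤ)) :
    walkOp q hq g 0 = ∑ i, ((q i)⁻¹ * (g (Pi.single i 1) - g 0) +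
      q i * (g (Pi.single i (-1)) - g 0)) := by
  rw [walkOp, matrixOp_apply, (hasSum_walkQ_mul q 0 g).tsum_eq, neg_mul, Finset.sum_mul,
    neg_add_eq_sub, ← Finset.sum_sub_distrib]
  refine Finset.sum_congr rfl fun i _ => ?_
  rw [zero_add, zero_sub, ← Pi.single_neg]
  ring

/-- The even-indexed components carry the rates of the walk, the odd-indexed ones those of its
negative, which is the walk with inverted parameters. -/
theorem edgeGenL_rowRate {q : Fin k → ℝ} (hq : ∀ i, 0 < q i) (hq' : ∀ i, 0 < (q i)⁻¹)
    (φ : BddFun (EdgeState (2 * k))) (e : EdgeState (2 * k)) :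
    edgeGenL (rowRate (extendRate q)) (2 * k) φ e =
      walkOp q hq (φ.comp fun x => e.move (interleaveHom k (x, 0))) 0 +
      walkOp (fun i => (q i)⁻¹) hq' (φ.comp fun y => e.move (interleaveHom k (0, y))) 0 := by
  rw [edgeGenL_apply, sum_fin_two_mul, walkOp_apply_zero, walkOp_apply_zero,
    ← Finset.sum_add_distrib]
  refine Finset.sum_congr rfl fun i _ => ?_
  have h0 : interleaveHom k (0, 0) = 0 := map_zero _
  have r0 : rowRate (extendRate q) (2 * i) = (q i)⁻¹ := by
    rw [rowRate, if_pos (by omega), Nat.mul_div_cancel_left _ two_pos, extendRate, dif_pos i.isLt]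
  have r1 : rowRate (extendRate q) (2 * i + 1) = q i := by
    rw [rowRate, if_neg (by omega), show (2 * (i : ℕ) + 1) / 2 = i by omega, extendRate,
      dif_pos i.isLt]
  simp only [BddFun.comp_apply, interleaveHom_single_left, interleaveHom_single_right, h0,
    EdgeState.move_zero, r0, r1, inv_inv]

end Interleave
end

noncomputable section

/-! ### The law of the path functional -/

section PathFunctional

open NormedSpace

variable {Ω : Type*} [MeasurableSpace Ω] {P : Measure Ω} [IsProbabilityMeasure P] {k : ℕ}
  {q : Fin k → ℝ} {Z Z' : ℝ≥0 → Ω → Fin k → ℤ}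

theorem exists_abs_integral_walk_sub_le (hq : ∀ i, 0 < q i) (hq' : ∀ i, 0 < (q i)⁻¹)
    (hZ : IsMarkovChain (walkQ q) 0 P Z)
    (hident : IdentDistrib (fun ω t => Z' t ω) (fun ω t => -Z t ω) P P) :
    ∃ C, 0 ≤ C ∧ ∀ δ : ℝ≥0, (δ : ℝ) ≤ 1 → ∀ g : BddFun (Fin k → ℤ),
      |∫ ω, g (Z δ ω) ∂P - g 0 - δ * walkOp q hq g 0| ≤ C * (δ : ℝ) ^ 2 * ‖g‖ ∧
      |∫ ω, g (Z' δ ω) ∂P - g 0 - δ * walkOp (fun i => (q i)⁻¹) hq' g 0| ≤ C * (δ : ℝ) ^ 2 * ‖g‖ := by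
  obtain ⟨C, hC, h⟩ := exists_abs_exp_apply_sub_le (walkOp q hq)
  have hexp := hZ.integral_comp (T := walkOp q hq) (fun f x => rfl) (finite_support_walkQ q)
  refine ⟨C, hC, fun δ hδ g => ⟨?_, ?_⟩⟩
  · rw [hexp]
    exact h δ δ.2 hδ g 0
  · have h1 : ∫ ω, g (Z' δ ω) ∂P = ∫ ω, (g.comp fun x => -x) (Z δ ω) ∂P := by
      have h2 : Measurable fun f : ℝ≥0 → Fin k → ℤ => g (f δ) :=
        (Measurable.of_discrete (f := fun x => g x)).comp (measurable_pi_apply δ)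
      exact (hident.comp h2).integral_eq
    -- Reflection through the origin exchanges the two jump directions, so it inverts the
    -- parameters.
    have h3 : walkOp q hq (g.comp fun x => -x) 0 = walkOp (fun i => (q i)⁻¹) hq' g 0 := by
      rw [walkOp_apply_zero, walkOp_apply_zero]
      refine Finset.sum_congr rfl fun i _ => ?_
      simp only [BddFun.comp_apply, ← Pi.single_neg, neg_neg, neg_zero, inv_inv]
      ring
    rw [h1, hexp, ← h3]
    have h4 := h δ δ.2 hδ (g.comp fun x => -x) 0
    simp only [BddFun.comp_apply, neg_zero] at h4
    exact h4.trans (by gcongr; exact g.norm_comp_le _)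

/-- To first order only one of the two independent walks moves within a step, which gives the sum of
two generators in `edgeGenL_rowRate`. The constant does not depend on the state, so the estimate
holds in operator norm. -/
theorem exists_norm_edgeStep_sub_le (hq : ∀ i, 0 < q i)
    (hZ : IsMarkovChain (walkQ q) 0 P Z) (hZ' : ∀ t, Measurable (Z' t))
    (hident : IdentDistrib (fun ω t => Z' t ω) (fun ω t => -Z t ω) P P)
    (hindep : IndepFun (fun ω t => Z t ω) (fun ω t => Z' t ω) P) :
    ∃ C, ∀ δ : ℝ≥0, (δ : ℝ) ≤ 1 →
      ∀ hW : Measurable fun ω => interleaveHom k (Z δ ω, Z' δ ω),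
      ‖edgeStep P hW - 1 - (δ : ℝ) • edgeGenL (rowRate (extendRate q)) (2 * k)‖ ≤ C * (δ : ℝ) ^ 2 := by
  have hq' : ∀ i, 0 < (q i)⁻¹ := fun i => inv_pos.2 (hq i)
  obtain ⟨C, hC, h⟩ := exists_abs_integral_walk_sub_le hq hq' hZ hident
  set A := (BddFun.evalL (0 : Fin k → ℤ)).comp (walkOp q hq) with hA
  set B := (BddFun.evalL (0 : Fin k → ℤ)).comp (walkOp (fun i => (q i)⁻¹) hq') with hB
  refine ⟨2 * C + (‖B‖ + C) * ‖A‖, fun δ hδ hW => ?_⟩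
  refine ContinuousLinearMap.opNorm_le_bound _ (by positivity) fun φ => ?_
  refine BddFun.norm_le (by positivity) fun e => ?_
  have hi : IndepFun (Z δ) (Z' δ) P :=
    hindep.comp (measurable_pi_apply δ) (measurable_pi_apply δ)
  have key := abs_integral_pair_sub_le (measurable_of_countable_fibers (hZ.measurable δ)) (hZ' δ)
    hi A B δ.2 hδ hC (fun g => (h δ hδ g).1) (fun g => (h δ hδ g).2)
    (φ.comp fun p => e.move (interleaveHom k p))
  have e1 : (edgeStep P hW - 1 - (δ : ℝ) • edgeGenL (rowRate (extendRate q)) (2 * k)) φ e =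
      edgeStep P hW φ e - φ e - δ * edgeGenL (rowRate (extendRate q)) (2 * k) φ e := rfl
  rw [e1, edgeGenL_rowRate hq hq', edgeStep_apply]
  have e2 : (φ.comp fun p => e.move (interleaveHom k p)) 0 = φ e := by
    rw [BddFun.comp_apply, map_zero, EdgeState.move_zero]
  rw [e2] at key
  exact key.trans (mul_le_mul_of_nonneg_left (φ.norm_comp_le _) (by positivity))

theorem gridPoint_succ_sub (N m : ℕ) : gridPoint N (m + 1) - gridPoint N m = gridPoint N 1 := by
  refine tsub_eq_of_eq_add ?_
  unfold gridPoint
  rw [← add_div]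
  push_cast
  ring

theorem tendsto_gridIndex_sub_mul {s t : ℝ≥0} (hst : s ≤ t) :
    Tendsto (fun N => ((gridIndex N t - gridIndex N s : ℕ) : ℝ) * gridPoint N 1) atTop
      (𝓝 ((t : ℝ) - s)) := by
  have h : ∀ t, Tendsto (fun N => (gridPoint N (gridIndex N t) : ℝ)) atTop (𝓝 (t : ℝ)) := fun t =>
    (NNReal.continuous_coe.tendsto t).comp
      ((tendsto_gridPoint_gridIndex t).mono_right nhdsWithin_le_nhds)
  refine ((h t).sub (h s)).congr fun N => ?_
  rw [Nat.cast_sub (gridIndex_mono N hst)]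
  simp only [gridPoint]
  push_cast
  ring

theorem tendsto_gridPoint_one : Tendsto (fun N => (gridPoint N 1 : ℝ)) atTop (𝓝 0) := by
  refine tendsto_one_div_add_atTop_nhds_zero_nat.congr fun N => ?_
  simp [gridPoint]

theorem gridPoint_one_le (N : ℕ) : (gridPoint N 1 : ℝ) ≤ 1 := by
  simp only [gridPoint, Nat.cast_one, one_div]
  push_cast
  exact inv_le_one_of_one_le₀ (by linarith [N.cast_nonneg (α := ℝ)])

/-- A bounded function of the last entry of the right edge. -/
def topFun {n : ℕ} (f : BddFun ℤ) : BddFun (EdgeState n) := f.comp fun e => topVal (e : Fin n → ℤ)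

theorem interleave_eq (t : ℝ≥0) (ω : Ω) : interleave Z Z' t ω = interleaveHom k (Z t ω, Z' t ω) := rfl

/-- The finite-dimensional distributions of the path functional of the interleaved walk. -/
theorem integral_prod_pathSums (hq : ∀ i, 0 < q i)
    (hZ : IsMarkovChain (walkQ q) 0 P Z) (hZ' : ∀ t, Measurable (Z' t))
    (hpath : ∀ ω, IsCadlagPath fun t => interleave Z Z' t ω)
    (hident : IdentDistrib (fun ω t => Z' t ω) (fun ω t => -Z t ω) P P)
    (hindep : IndepFun (fun ω t => Z t ω) (fun ω t => Z' t ω) P) {t : ℕ → ℝ≥0} (ht : Monotone t)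
    (ht0 : t 0 = 0) (f : ℕ → BddFun ℤ) (m : ℕ) (g : BddFun ℤ) :
    ∫ ω, (∏ j ∈ Finset.range m, f j (sSup (chainSums (fun s => interleave Z Z' s ω) (t j)))) *
        g (sSup (chainSums (fun s => interleave Z Z' s ω) (t m))) ∂P =
      iterExpect (fun j => exp (((t (j + 1) : ℝ) - t j) • edgeGenL (rowRate (extendRate q)) (2 * k)))
        (fun j => topFun (f j)) default m (topFun g) := by
  set S : ℝ≥0 → Ω → ℤ := fun s ω => sSup (chainSums (fun s => interleave Z Z' s ω) s) with hS
  set E : ℕ → ℝ≥0 → Ω → EdgeState (2 * k) := fun N s ω =>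
    edgeState (fun m => interleave Z Z' (gridPoint N m) ω) (gridIndex N s) with hE
  have hmZ : ∀ t, Measurable (Z t) := fun t => measurable_of_countable_fibers (hZ.measurable t)
  have hV : ∀ t, Measurable fun ω => (Z t ω, Z' t ω) := fun t => (hmZ t).prodMk (hZ' t)
  have hW : ∀ t, Measurable fun ω => interleaveHom k (Z t ω, Z' t ω) := fun t =>
    (measurable_of_countable (interleaveHom k)).comp (hV t)
  have hinc := (hZ.stationaryIncrements hq).prodMk
    ((hZ.stationaryIncrements hq).neg.congr hident) hindep
  have hEint : ∀ N, ∫ ω, (∏ j ∈ Finset.range m, topFun (f j) (E N (t j) ω)) *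
      topFun g (E N (t m) ω) ∂P = iterExpect (fun j => edgeStep P (hW (gridPoint N 1)) ^
        (gridIndex N (t (j + 1)) - gridIndex N (t j))) (fun j => topFun (f j)) default m (topFun g) := by
    intro N
    have hinc' := hinc (gridPoint N) (gridPoint_mono N) (by simp [gridPoint])
    simp only [gridPoint_succ_sub] at hinc'
    exact integral_prod_edgeState (V := fun m ω => (Z (gridPoint N m) ω, Z' (gridPoint N m) ω))
      (fun m => hV _) (hV (gridPoint N 1)) hinc' (interleaveHom k) (hW (gridPoint N 1))
      (M := fun j => gridIndex N (t j)) ((gridIndex_mono N).comp ht)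
      (by rw [ht0, gridIndex_zero]) (fun j => topFun (f j)) m (topFun g)
  obtain ⟨C, hC⟩ := exists_norm_edgeStep_sub_le hq hZ hZ' hident hindep
  -- About `(t (j + 1) - t j) / δ` grid steps lie between two observation times, so the powers of
  -- the one-step operator tend to the semigroup.
  have hlim : Tendsto (fun N => iterExpect (fun j => edgeStep P (hW (gridPoint N 1)) ^
        (gridIndex N (t (j + 1)) - gridIndex N (t j))) (fun j => topFun (f j)) default m (topFun g))
      atTop (𝓝 (iterExpect (fun j => exp (((t (j + 1) : ℝ) - t j) •
        edgeGenL (rowRate (extendRate q)) (2 * k))) (fun j => topFun (f j)) default m (topFun g))) := by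
    refine tendsto_iterExpect (U' := fun N j => edgeStep P (hW (gridPoint N 1)) ^
        (gridIndex N (t (j + 1)) - gridIndex N (t j))) (fun j => ?_) _ _ _ tendsto_const_nhds
    exact tendsto_pow_exp _ (fun N => (gridPoint N 1).2) tendsto_gridPoint_one
      (fun N => norm_edgeStep_le _) (Eventually.of_forall fun N => hC _ (gridPoint_one_le N) _)
      (tendsto_gridIndex_sub_mul (ht (Nat.le_succ j)))
  refine tendsto_nhds_unique ?_ (hlim.congr fun N => (hEint N).symm)
  have hEm : ∀ N s, Measurable (E N s) := fun N s =>
    (measurable_edgeChain (W := fun m ω => interleave Z Z' (gridPoint N m) ω) (fun m => hW _) _).subtype_mk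
  refine tendsto_integral_of_dominated_convergence (fun _ => (∏ j ∈ Finset.range m, ‖topFun (n := 2 * k) (f j)‖) *
    ‖topFun (n := 2 * k) g‖) (fun N => ?_) (integrable_const _)
    (fun N => Eventually.of_forall fun ω => ?_) (Eventually.of_forall fun ω => ?_)
  · exact ((Finset.measurable_prod _ fun j _ => Measurable.of_discrete.comp (hEm N (t j))).mul
      (Measurable.of_discrete.comp (hEm N (t m)))).aestronglyMeasurable
  · rw [norm_mul, norm_prod]
    gcongr
    · exact (topFun (f _)).abs_apply_le _
    · exact (topFun g).abs_apply_le _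
  -- For fixed `ω` the integrands are eventually equal to their limit, not merely close to it.
  · have hev : ∀ s, ∀ᶠ N in atTop, topVal (E N s ω : Fin (2 * k) → ℤ) = S s ω := fun s =>
      (hpath ω).eventually_topVal_edgeChain_eq s
    have hev' : ∀ᶠ N in atTop, ∀ j ∈ Finset.range (m + 1),
        topVal (E N (t j) ω : Fin (2 * k) → ℤ) = S (t j) ω :=
      (Finset.eventually_all _).2 fun j _ => hev (t j)
    refine tendsto_const_nhds.congr' (hev'.mono fun N hN => ?_)
    simp only [topFun, BddFun.comp_apply]
    rw [hN m (Finset.self_mem_range_succ m)]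
    congr 1
    exact Finset.prod_congr rfl fun j hj => by
      rw [hN j (Finset.mem_range.2 ((Finset.mem_range.1 hj).trans (Nat.lt_succ_self m)))]

end PathFunctional
end

noncomputable section

/-! ### Comparison of the transition operators -/

section Comparison

open NormedSpace

variable {k : ℕ}

/-- The generator of the Doob transform as a bounded operator. -/
def doobOp (q : Fin k → ℝ) (hq : ∀ i, 0 < q i) : BddFun (chamber k) →L[ℝ] BddFun (chamber k) :=
  matrixOp (doobQ (walkQ q) (harmonicH q) (chamber k)) (finite_support_doobQ q _) _
    (tsum_abs_doobQ_le hq fun z _ => sympSchur_eq_patSum_extendRate hq z)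

/-- The intertwining of generators in operator form. -/
theorem doobOp_patAvgL (q : Fin k → ℝ) (hq : ∀ i, 0 < q i) (f : BddFun (Pat (2 * k))) :
    doobOp q hq (patAvgL q hq f) = patAvgL q hq (patGenL (extendRate q) (2 * k) f) := by
  ext z
  exact tsum_doobQ_mul_patAvg hq (fun z _ => sympSchur_eq_patSum_extendRate hq z) f z

/-- The function `φ` of the right edge coincides with the function `f` of the pattern. -/
def edgeGraph (n : ℕ) : Submodule ℝ (BddFun (Pat n) × BddFun (EdgeState n)) where
  carrier := {p | ∀ (x : Pat n) (hx : SortedEdge x.edge), p.1 x = p.2 ⟨x.edge, hx⟩}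
  add_mem' h h' x hx := congrArg₂ (· + ·) (h x hx) (h' x hx)
  zero_mem' _ _ := rfl
  smul_mem' c _ h x hx := congrArg (c * ·) (h x hx)

theorem isClosed_edgeGraph (n : ℕ) :
    IsClosed (edgeGraph n : Set (BddFun (Pat n) × BddFun (EdgeState n))) := by
  have : (edgeGraph n : Set (BddFun (Pat n) × BddFun (EdgeState n))) =
      ⋂ (x : Pat n) (hx : SortedEdge x.edge), {p | p.1 x = p.2 ⟨x.edge, hx⟩} := by
    ext p
    simp only [Set.mem_iInter]
    rfl
  rw [this]
  exact isClosed_iInter fun x => isClosed_iInter fun hx => isClosed_eq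
    ((BddFun.evalL x).continuous.comp continuous_fst)
    ((BddFun.evalL (⟨x.edge, hx⟩ : EdgeState n)).continuous.comp continuous_snd)

/-- Extending the edge function by zero to unsorted tuples is harmless by `patGen_congr_sorted`;
then the edge is autonomous by `patGen_comp_edge`. -/
theorem patGenL_mem_edgeGraph {q : ℕ → ℝ} {n : ℕ} {p : BddFun (Pat n) × BddFun (EdgeState n)}
    (hp : p ∈ edgeGraph n) :
    (patGenL q n p.1, edgeGenL (rowRate q) n p.2) ∈ edgeGraph n := by
  classical
  intro x hx
  set φ : (Fin n → ℤ) → ℝ := fun e => if h : SortedEdge e then p.2 ⟨e, h⟩ else 0 with hφ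
  have hφ' : ∀ e : EdgeState n, φ e = p.2 e := fun e => dif_pos e.2
  change patGen q n p.1 x = _
  rw [patGen_congr_sorted (g := fun x => φ x.edge) (fun x hx => (hp x hx).trans (hφ' ⟨x.edge, hx⟩).symm) hx,
    patGen_comp_edge φ hx, edgeGenL_apply]
  refine Finset.sum_congr rfl fun i _ => ?_
  rw [← hφ', ← hφ', ← hφ']
  rfl

/-- The graph of the averaging operator. -/
def avgGraph (q : Fin k → ℝ) (hq : ∀ i, 0 < q i) :
    Submodule ℝ (BddFun (Pat (2 * k)) × BddFun (chamber k)) :=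
  (patAvgL q hq : BddFun (Pat (2 * k)) →ₗ[ℝ] BddFun (chamber k)).graph

theorem mem_avgGraph {q : Fin k → ℝ} {hq : ∀ i, 0 < q i}
    {p : BddFun (Pat (2 * k)) × BddFun (chamber k)} :
    p ∈ avgGraph q hq ↔ p.2 = patAvgL q hq p.1 :=
  LinearMap.mem_graph_iff _ _

theorem isClosed_avgGraph (q : Fin k → ℝ) (hq : ∀ i, 0 < q i) :
    IsClosed (avgGraph q hq : Set (BddFun (Pat (2 * k)) × BddFun (chamber k))) := by
  have : (avgGraph q hq : Set (BddFun (Pat (2 * k)) × BddFun (chamber k))) =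
      {p | p.2 = patAvgL q hq p.1} := Set.ext fun p => mem_avgGraph
  rw [this]
  exact isClosed_eq continuous_snd ((patAvgL q hq).continuous.comp continuous_fst)

/-- The functions `g` of the walk in the chamber and `φ` of the right edge come from the same
function of the pattern. -/
def Related (q : Fin k → ℝ) (hq : ∀ i, 0 < q i) (g : BddFun (chamber k))
    (φ : BddFun (EdgeState (2 * k))) : Prop :=
  ∃ f, (f, g) ∈ avgGraph q hq ∧ (f, φ) ∈ edgeGraph (2 * k)

/-- One function on patterns witnesses both relations, and its image under the pattern semigroup
witnesses both again, since each graph is closed and invariant under the generators. -/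
theorem Related.exp {q : Fin k → ℝ} {hq : ∀ i, 0 < q i} {g : BddFun (chamber k)}
    {φ : BddFun (EdgeState (2 * k))} (h : Related q hq g φ) (t : ℝ) :
    Related q hq (NormedSpace.exp (t • doobOp q hq) g)
      (NormedSpace.exp (t • edgeGenL (rowRate (extendRate q)) (2 * k)) φ) := by
  obtain ⟨f, h1, h2⟩ := h
  refine ⟨NormedSpace.exp (t • patGenL (extendRate q) (2 * k)) f, ?_, ?_⟩
  · refine exp_mem_of_invariant (avgGraph q hq) (isClosed_avgGraph q hq) _ _ (fun p hp => ?_) t h1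
    rw [mem_avgGraph] at hp ⊢
    rw [hp, doobOp_patAvgL]
  · exact exp_mem_of_invariant (edgeGraph (2 * k)) (isClosed_edgeGraph _) _ _
      (fun p hp => patGenL_mem_edgeGraph hp) t h2

/-- A bounded function of the last coordinate. -/
def lastFun (hk : 0 < k) (f : BddFun ℤ) : BddFun (chamber k) :=
  f.comp fun z => (z : Fin k → ℤ) ⟨k - 1, Nat.sub_one_lt_of_lt hk⟩

/-- The coordinate observed is visible on both sides: it is the first entry of the bottom row. Being
a function of the bottom row it factors out of the average, and it is the last entry of the edge. -/
theorem Related.mul (hk : 0 < k) {q : Fin k → ℝ} {hq : ∀ i, 0 < q i} {g : BddFun (chamber k)}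
    {φ : BddFun (EdgeState (2 * k))} (h : Related q hq g φ) (F : BddFun ℤ) :
    Related q hq (lastFun hk F * g) (topFun F * φ) := by
  obtain ⟨f, h1, h2⟩ := h
  refine ⟨F.comp (fun x : Pat (2 * k) => x.bot 0) * f, ?_, fun x hx => ?_⟩
  · rw [mem_avgGraph] at h1 ⊢
    ext z
    have hz : toRow (z : Fin k → ℤ) 0 = (z : Fin k → ℤ) ⟨k - 1, Nat.sub_one_lt_of_lt hk⟩ := by
      rw [toRow, dif_pos hk]
      congr 1
    have e : patSum (extendRate q) (2 * k)
        (F.comp (fun x : Pat (2 * k) => x.bot 0) * f : BddFun (Pat (2 * k)))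
        (toRow (z : Fin k → ℤ)) =
        F ((z : Fin k → ℤ) ⟨k - 1, Nat.sub_one_lt_of_lt hk⟩) *
          patSum (extendRate q) (2 * k) f (toRow (z : Fin k → ℤ)) := by
      rw [patSum_congr (g := F ((z : Fin k → ℤ) ⟨k - 1, Nat.sub_one_lt_of_lt hk⟩) • ⇑f), map_smul]
      · rfl
      · intro x hx
        change F (x.bot 0) * f x = _
        rw [hx, hz]
        rfl
    rw [patAvgL_apply, e, mul_div_assoc]
    change F _ * g z = _
    rw [show g = patAvgL q hq f from h1]
    rfl
  · change F (x.bot 0) * f x = F (topVal x.edge) * φ _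
    rw [topVal_edge, ← h2 x hx]

theorem related_indicator_univ (q : Fin k → ℝ) (hq : ∀ i, 0 < q i) :
    Related q hq (BddFun.indicator Set.univ) (BddFun.indicator Set.univ) := by
  refine ⟨BddFun.indicator Set.univ, mem_avgGraph.2 ?_, fun x hx => by simp⟩
  ext z
  have h1 : (⇑(BddFun.indicator Set.univ : BddFun (Pat (2 * k))) : Pat (2 * k) → ℝ) = 1 := by
    ext x
    simp
  rw [patAvgL_apply, h1, div_self (patSum_toRow_pos hq z.2).ne']
  simp

theorem edge_zeroPat (n : ℕ) : (zeroPat n).edge = 0 := by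
  induction n with
  | zero => exact Subsingleton.elim _ _
  | succ n ih =>
    rw [zeroPat, Pat.edge, ih]
    ext i
    refine Fin.lastCases ?_ (fun i => ?_) i <;> simp

/-- Over the zero bottom row lies only the zero pattern, whose edge is the initial state of the edge
dynamics. -/
theorem Related.apply_zero {q : Fin k → ℝ} {hq : ∀ i, 0 < q i} {g : BddFun (chamber k)}
    {φ : BddFun (EdgeState (2 * k))} (h : Related q hq g φ) : g (chamberZero k) = φ default := by
  obtain ⟨f, h1, h2⟩ := h
  rw [mem_avgGraph] at h1
  have h0 : toRow ((chamberZero k : chamber k) : Fin k → ℤ) = 0 := by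
    ext j
    simp [toRow, chamberZero]
  have h3 := h2 (zeroPat _) (by rw [edge_zeroPat]; exact sortedEdge_zero _)
  change g _ = _
  rw [show g = patAvgL q hq f from h1, patAvgL_apply, h0, patSum_apply_zero, patSum_apply_zero,
    Pi.one_apply, div_one]
  refine h3.trans (congrArg φ (Subtype.ext (edge_zeroPat _)))

theorem Related.iterExpect_eq (hk : 0 < k) {q : Fin k → ℝ} {hq : ∀ i, 0 < q i} (t : ℕ → ℝ)
    (f : ℕ → BddFun ℤ) (m : ℕ) {g : BddFun (chamber k)} {φ : BddFun (EdgeState (2 * k))}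
    (h : Related q hq g φ) :
    iterExpect (fun j => NormedSpace.exp (t j • doobOp q hq)) (fun j => lastFun hk (f j))
      (chamberZero k) m g =
    iterExpect (fun j => NormedSpace.exp (t j • edgeGenL (rowRate (extendRate q)) (2 * k)))
      (fun j => topFun (f j)) default m φ := by
  induction m generalizing g φ with
  | zero => exact h.apply_zero
  | succ m ih => exact ih ((h.exp (t m)).mul hk (f m))

theorem iterExpect_doobOp (hk : 0 < k) (q : Fin k → ℝ) (hq : ∀ i, 0 < q i) (t : ℕ → ℝ)
    (f : ℕ → BddFun ℤ) (m : ℕ) (g : BddFun ℤ) :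
    iterExpect (fun j => NormedSpace.exp (t j • doobOp q hq)) (fun j => lastFun hk (f j))
      (chamberZero k) m (lastFun hk g) =
    iterExpect (fun j => NormedSpace.exp (t j • edgeGenL (rowRate (extendRate q)) (2 * k)))
      (fun j => topFun (f j)) default m (topFun g) := by
  refine Related.iterExpect_eq hk t f m ?_
  convert (related_indicator_univ q hq).mul hk g using 1 <;> ext x <;> simp

end Comparison

/-! ### Laws of processes -/

section Laws

variable {Ω Ω' : Type*} [MeasurableSpace Ω] [MeasurableSpace Ω'] {P : Measure Ω}
  [IsProbabilityMeasure P] {P' : Measure Ω'} [IsProbabilityMeasure P']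

theorem exists_monotone_enumeration (I : Finset ℝ≥0) : ∃ (t : ℕ → ℝ≥0) (m : ℕ), Monotone t ∧
    t 0 = 0 ∧ (∀ j, t j = 0 ∨ t j ∈ I) ∧ ∀ i ∈ I, ∃ j ≤ m, t j = i := by
  induction I using Finset.induction_on_max with
  | empty => exact ⟨fun _ => 0, 0, monotone_const, rfl, fun _ => Or.inl rfl, by simp⟩
  | insert a s ha ih =>
    obtain ⟨t, m, h1, h2, h3, h4⟩ := ih
    have hta : ∀ j, t j ≤ a := fun j => by
      rcases h3 j with h | h
      · rw [h]; exact zero_le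
      · exact (ha _ h).le
    refine ⟨fun j => if j ≤ m then t j else a, m + 1, fun i j hij => ?_, by simp [h2],
      fun j => ?_, fun i hi => ?_⟩
    · dsimp only
      split_ifs with hi hj hj
      · exact h1 hij
      · exact hta i
      · omega
      · exact le_rfl
    · dsimp only
      split_ifs
      · exact (h3 j).imp_right (Finset.mem_insert_of_mem)
      · exact Or.inr (Finset.mem_insert_self a s)
    · rcases Finset.mem_insert.1 hi with rfl | hi
      · exact ⟨m + 1, le_rfl, by simp⟩
      · obtain ⟨j, hj, rfl⟩ := h4 i hi
        exact ⟨j, hj.trans (Nat.le_succ m), by simp [hj]⟩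

open Classical in
-- Laws on the path space are determined by their finite-dimensional projections; these live on
-- countable spaces, where singletons suffice and their indicators are products.
theorem identDistrib_of_integral_prod_eq {X : ℝ≥0 → Ω' → ℤ} {Y : ℝ≥0 → Ω → ℤ}
    (hX : ∀ t, Measurable (X t)) (hY : ∀ t, Measurable (Y t))
    (h : ∀ t : ℕ → ℝ≥0, Monotone t → t 0 = 0 → ∀ (f : ℕ → BddFun ℤ) (m : ℕ) (g : BddFun ℤ),
      ∫ ω, (∏ j ∈ Finset.range m, f j (X (t j) ω)) * g (X (t m) ω) ∂P' =
        ∫ ω, (∏ j ∈ Finset.range m, f j (Y (t j) ω)) * g (Y (t m) ω) ∂P) :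
    IdentDistrib (fun ω t => X t ω) (fun ω t => Y t ω) P' P := by
  have mX : Measurable fun ω t => X t ω := measurable_pi_lambda _ hX
  have mY : Measurable fun ω t => Y t ω := measurable_pi_lambda _ hY
  refine ⟨mX.aemeasurable, mY.aemeasurable, ?_⟩
  have : IsProbabilityMeasure (P.map fun ω t => Y t ω) :=
    Measure.isProbabilityMeasure_map mY.aemeasurable
  have hfin : ∀ I : Finset ℝ≥0, IsFiniteMeasure ((P.map fun ω t => Y t ω).map I.restrict) :=
    fun I => inferInstance
  refine IsProjectiveLimit.unique (P := fun I => (P.map fun ω t => Y t ω).map I.restrict)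
    (fun I => ?_) fun I => rfl
  have hr : Measurable (I.restrict (π := fun _ : ℝ≥0 => ℤ)) := Finset.measurable_restrict I
  change (P'.map fun ω t => X t ω).map I.restrict = (P.map fun ω t => Y t ω).map I.restrict
  rw [Measure.map_map hr mX, Measure.map_map hr mY]
  refine Measure.ext_of_singleton fun a => ?_
  rw [Measure.map_apply (hr.comp mX) (measurableSet_singleton a),
    Measure.map_apply (hr.comp mY) (measurableSet_singleton a),
    ← ENNReal.toReal_eq_toReal_iff' (measure_ne_top _ _) (measure_ne_top _ _)]
  change P'.real _ = P.real _
  rw [← integral_indicator_one ((hr.comp mX) (measurableSet_singleton a)),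
    ← integral_indicator_one ((hr.comp mY) (measurableSet_singleton a))]
  obtain ⟨t, m, h1, h2, -, h4⟩ := exists_monotone_enumeration I
  -- The enumeration may contain the time `0` without `0 ∈ I`; times outside `I` receive the
  -- constant function one.
  set f : ℕ → BddFun ℤ := fun j =>
    if hj : t j ∈ I then BddFun.indicator {a ⟨t j, hj⟩} else BddFun.indicator Set.univ with hf
  have key : ∀ x : ℝ≥0 → ℤ, (if I.restrict x = a then (1 : ℝ) else 0) =
      (∏ j ∈ Finset.range m, f j (x (t j))) * f m (x (t m)) := by
    intro x
    rw [← Finset.prod_range_succ (fun j => f j (x (t j)))]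
    have hfj : ∀ j, f j (x (t j)) = if ∀ hj : t j ∈ I, x (t j) = a ⟨t j, hj⟩ then 1 else 0 := by
      intro j
      by_cases hj : t j ∈ I <;> simp [hf, hj]
    simp only [hfj]
    rw [Finset.prod_ite_zero, Finset.prod_const_one]
    refine if_congr ⟨?_, fun hx => ?_⟩ rfl rfl
    · rintro rfl j - hj
      rfl
    · ext ⟨i, hi⟩
      obtain ⟨j, hj, rfl⟩ := h4 i hi
      exact hx j (Finset.mem_range.2 (Nat.lt_succ_of_le hj)) hi
  refine (integral_congr_ae (Eventually.of_forall fun ω => ?_)).trans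
    ((h t h1 h2 f m (f m)).trans (integral_congr_ae (Eventually.of_forall fun ω => ?_)))
  · refine Eq.trans ?_ (key fun t => X t ω)
    simp [Set.indicator_apply]
  · refine (key fun t => Y t ω).symm.trans ?_
    simp [Set.indicator_apply]

end Laws

/-! ### Assembling the theorem -/

theorem isCadlagPath_interleave {Ω : Type*} {k : ℕ} {Z Z' : ℝ≥0 → Ω → Fin k → ℤ} (hZ : IsCadlag Z)
    (hZ' : IsCadlag Z') (ω : Ω) : IsCadlagPath fun t => interleave Z Z' t ω :=
  (IsCadlagPath.prodMk (Y := fun t => Z t ω) (Y' := fun t => Z' t ω) (hZ ω) (hZ' ω)).comp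
    (interleaveHom k)

/-- A process with a.e. measurable law has a version, indistinguishable from it, with measurable
coordinates. -/
theorem IsCadlag.exists_measurable_ae_eq {Ω : Type*} [MeasurableSpace Ω] {P : Measure Ω} {E : Type*}
    [MeasurableSpace E] [Inhabited E] {X : ℝ≥0 → Ω → E} (hX : IsCadlag X)
    (hm : AEMeasurable (fun ω t => X t ω) P) :
    ∃ Y : ℝ≥0 → Ω → E, IsCadlag Y ∧ (∀ t, Measurable (Y t)) ∧
      (fun ω t => X t ω) =ᵐ[P] fun ω t => Y t ω := by
  classical
  obtain ⟨g, hg, hXg⟩ := hm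
  set N := toMeasurable P {ω | ¬ (fun t => X t ω) = g ω} with hN
  have hNm : MeasurableSet N := measurableSet_toMeasurable _ _
  have hN0 : P N = 0 := by
    rw [hN, measure_toMeasurable]
    exact hXg
  have hout : ∀ ω ∉ N, ∀ t, g ω t = X t ω := fun ω hω t => by
    have : ¬ ¬ (fun t => X t ω) = g ω := fun h => hω (subset_toMeasurable _ _ h)
    exact (congrFun (not_not.1 this) t).symm
  refine ⟨fun t ω => if ω ∈ N then default else g ω t, fun ω t => ?_, fun t => ?_, ?_⟩
  · by_cases hω : ω ∈ N
    · simp only [hω, if_true]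
      exact ⟨by simp, default, by simp⟩
    · simp only [hω, if_false, hout ω hω]
      exact hX ω t
  · exact Measurable.ite hNm measurable_const ((measurable_pi_apply t).comp hg)
  · filter_upwards [measure_eq_zero_iff_ae_notMem.1 hN0] with ω hω
    ext t
    simp only [hω, if_false, hout ω hω]

theorem mainTheorem4 (k : ℕ) (hk : 0 < k) (q : Fin k → ℝ) (hq : ∀ i, 0 < q i ∧ q i < 1)
    {Ω Ω' : Type*} [MeasurableSpace Ω] [MeasurableSpace Ω']
    (P : Measure Ω) [IsProbabilityMeasure P] (P' : Measure Ω') [IsProbabilityMeasure P']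
    -- the `h`-transform of the walk killed on leaving the chamber, started at the origin
    (Zdag : ℝ≥0 → Ω' → chamber k)
    (hZdag : IsMarkovChain (doobQ (walkQ q) (harmonicH q) (chamber k)) (chamberZero k) P' Zdag)
    -- the walk, and an independent process with the law of its negative
    (Z Ztilde : ℝ≥0 → Ω → Fin k → ℤ)
    (hZ : IsMarkovChain (walkQ q) 0 P Z)
    (hZtilde : IsCadlag Ztilde)
    (hident : IdentDistrib (fun ω t => Ztilde t ω) (fun ω t => -Z t ω) P P)
    (hindep : IndepFun (fun ω t => Z t ω) (fun ω t => Ztilde t ω) P) :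
    (∀ ω t, BddAbove (pathSums (fun s => interleave Z Ztilde s ω) t)) ∧
    IdentDistrib
      (fun ω t => (Zdag t ω : Fin k → ℤ) ⟨k - 1, Nat.sub_one_lt_of_lt hk⟩)
      (fun ω t => sSup (pathSums (fun s => interleave Z Ztilde s ω) t)) P' P := by
  refine ⟨fun ω t => (isCadlagPath_interleave hZ.cadlag hZtilde ω).bddAbove_chainSums t, ?_⟩
  have hq0 : ∀ i, 0 < q i := fun i => (hq i).1
  -- Equality in law provides only almost everywhere measurability of `Ztilde`, so the argument is
  -- run with a measurable version and transferred back at the end.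
  obtain ⟨Z', hc, hm, hae⟩ := hZtilde.exists_measurable_ae_eq hident.aemeasurable_fst
  have hident' : IdentDistrib (fun ω t => Z' t ω) (fun ω t => -Z t ω) P P :=
    (IdentDistrib.of_ae_eq hident.aemeasurable_fst hae).symm.trans hident
  have hindep' : IndepFun (fun ω t => Z t ω) (fun ω t => Z' t ω) P :=
    hindep.congr (ae_eq_refl _) hae
  have hpath := isCadlagPath_interleave hZ.cadlag hc
  have hmZ : ∀ t, Measurable (Z t) := fun t => measurable_of_countable_fibers (hZ.measurable t)
  have hmY : ∀ t, Measurable fun ω => sSup (chainSums (fun s => interleave Z Z' s ω) t) :=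
    measurable_sSup_chainSums (Y := fun t ω => interleave Z Z' t ω)
      (fun t => (measurable_of_countable (interleaveHom k)).comp ((hmZ t).prodMk (hm t))) hpath
  have hmX : ∀ t, Measurable fun ω => (Zdag t ω : Fin k → ℤ) ⟨k - 1, Nat.sub_one_lt_of_lt hk⟩ :=
    fun t => (measurable_of_countable
      fun z : chamber k => (z : Fin k → ℤ) ⟨k - 1, Nat.sub_one_lt_of_lt hk⟩).comp
        (measurable_of_countable_fibers (hZdag.measurable t))
  have hlaw : IdentDistrib
      (fun ω t => (Zdag t ω : Fin k → ℤ) ⟨k - 1, Nat.sub_one_lt_of_lt hk⟩)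
      (fun ω t => sSup (chainSums (fun s => interleave Z Z' s ω) t)) P' P := by
    refine identDistrib_of_integral_prod_eq
      (X := fun t ω => (Zdag t ω : Fin k → ℤ) ⟨k - 1, Nat.sub_one_lt_of_lt hk⟩)
      (Y := fun t ω => sSup (chainSums (fun s => interleave Z Z' s ω) t)) hmX hmY
      fun t ht ht0 f m g => ?_
    -- Both finite-dimensional distributions are iterated expectations, and `iterExpect_doobOp`
    -- passes from the edge to the Doob transform.
    rw [integral_prod_pathSums hq0 hZ hm hpath hident' hindep' ht ht0, ← iterExpect_doobOp hk q hq0]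
    exact hZdag.integral_prod (T := doobOp q hq0) (fun f x => rfl) (finite_support_doobQ q _) ht ht0
      (fun j => lastFun hk (f j)) m (lastFun hk g)
  refine hlaw.trans (IdentDistrib.of_ae_eq hlaw.aemeasurable_snd ?_)
  filter_upwards [hae] with ω hω
  ext t
  have : ∀ s, interleave Z Z' s ω = interleave Z Ztilde s ω := fun s => by
    rw [interleave_eq, interleave_eq, ← congrFun hω s]
  simp only [this]
  rfl

end
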